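/- Let $k\in\mathbb C$ with $\Re(k)<0$, let $\delta>0$, and let $f:\mathbb Q\to\mathbb C$ and $h:\mathbb R\setminus\{0\}\to\mathbb C$ satisfy (i) $f(x+1)=f(x)$ for all $x\in\mathbb Q\setminus[-1,0]$ (that is, $f$ is $1$-periodic separately on the positive and on the negative rationals); (ii) $f(x)-|x|^{-k}f(-1/x)=h(x)$ for all rational $x\in[-1,1]\setminus\{0\}$; (iii) with $x,y$ ranging over $[-1,1]\setminus\{0\}$, $$\sup_{|x-y|<e^{-\varepsilon^{\delta-1}},\ |x|>2\varepsilon}|h(x)-h(y)|\to 0\quad(\varepsilon\to0^+),\qquad h(x)=O\big(e^{|x|^{\delta-1}}\big).$$ For $x\in\mathbb R$ put $f^*(x)=\lim_{j\to\infty}f(x_j)$ whenever this limit exists, where $(x_j)_{j\ge 0}$ are the convergents of the continued fraction of $x$ (if $x$ is rational, the sequence is continued by $x_j=x$). Let $\nu$ be Lebesgue measure on $[0,1]$. Then $f^*(x)$ exists for almost every $x\in\mathbb R$, $f^*$ is Lebesgue-measurable on $[0,1]$, and the multisets $$\Big\{f\big(\tfrac aq\big):1\le a\le q,\ (a,q)=1\Big\}$$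 become equidistributed, as $q\to\infty$, according to the push-forward $f^*_*(d\nu)$: for every bounded continuous $G:\mathbb C\to\mathbb R$, $$\frac1{\varphi(q)}\sum_{1\le a\le q,\ (a,q)=1}G\big(f(\tfrac aq)\big)\longrightarrow\int_0^1G(f^*(x))\,dx .$$ If, moreover, $h$ is real-analytic on $(-1,1)\setminus\{0\}$, and there are no constants $\alpha,\beta\in\mathbb C$ such that $f(x)=\alpha+\beta\,\mathrm{den}(x)^{k}$ for all $x\in\mathbb Q_{>0}$, where $\mathrm{den}(x)$ is the denominator of $x$ in lowest terms, then $f^*_*(d\nu)$ is diffuse, i.e. it has no atoms. -/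

import Mathlib

open Filter Topology MeasureTheory

/-- `f : ℚ → ℂ` is `1`-periodic separately on the negative and on the positive rationals. -/
def PeriodicOffZero (f : ℚ → ℂ) : Prop :=
  ∀ x : ℚ, x ∉ Set.Icc (-1 : ℚ) 0 → f x = f (x + 1)

/-- The reciprocity relation of weight `k` with period function `h`:
`f(x) - |x|^(-k) f(-1/x) = h(x)` for all rational `x ∈ [-1, 1] \ {0}`. -/
def SatisfiesReciprocity (k : ℂ) (f : ℚ → ℂ) (h : ℝ → ℂ) : Prop :=
  ∀ x : ℚ, x ∈ Set.Icc (-1 : ℚ) 1 → x ≠ 0 →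
    f x - (((|x| : ℚ) : ℂ) ^ (-k)) * f (-1 / x) = h (x : ℝ)

/-- The regularity condition on the period function:
`sup {|h(x) - h(y)| : |x - y| < exp(-ε^(δ-1)), |x| > 2ε} = o(1)` as `ε → 0⁺`, and
`h(x) = O(exp(|x|^(δ-1)))`, where `x, y` range over `[-1, 1] \ {0}`. -/
def PeriodRegular (δ : ℝ) (h : ℝ → ℂ) : Prop :=
  (∀ η : ℝ, 0 < η → ∀ᶠ ε : ℝ in 𝓝[>] 0,
    ∀ x ∈ Set.Icc (-1 : ℝ) 1 \ {0}, ∀ y ∈ Set.Icc (-1 : ℝ) 1 \ {0},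
      |x - y| < Real.exp (-ε ^ (δ - 1)) → 2 * ε < |x| → ‖h x - h y‖ ≤ η) ∧
  ∃ C : ℝ, ∀ x ∈ Set.Icc (-1 : ℝ) 1 \ {0}, ‖h x‖ ≤ C * Real.exp (|x| ^ (δ - 1))

/-- The extension `f*` of `f : ℚ → ℂ` to the real line: the limit of the values of `f` along the
convergents of the continued fraction of `x` (a junk value where this limit does not exist). -/
noncomputable def starExt (f : ℚ → ℂ) (x : ℝ) : ℂ :=
  limUnder atTop (fun n : ℕ => f (x.convergent n))

/-- The average of `G` over the multiset `{f(a/q) : 1 ≤ a ≤ q, (a, q) = 1}`. -/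
noncomputable def reducedAverage (f : ℚ → ℂ) (G : ℂ → ℝ) (q : ℕ) : ℝ :=
  (∑ a ∈ (Finset.Icc 1 q).filter (fun a => Nat.Coprime a q), G (f ((a : ℚ) / (q : ℚ)))) /
    (Nat.totient q : ℝ)

/-- The multisets `{f(a/q) : 1 ≤ a ≤ q, (a, q) = 1}` become distributed according to `μ` as
`q → ∞`: their normalized counting measures converge weakly to `μ`. -/
def ReducedValuesEquidistribute (f : ℚ → ℂ) (μ : Measure ℂ) : Prop :=
  ∀ G : BoundedContinuousFunction ℂ ℝ,
    Tendsto (fun q : ℕ => reducedAverage f G q) atTop (𝓝 (∫ z, G z ∂μ))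

/-! Write `σ = -Re k > 0`, let `T` be the Gauss map and `β_j(x) = x · T x ⋯ T^(j-1) x`. For a sign
`s` and a rational `r` in `(0, 1]`, reciprocity and periodicity combine into `f(s r) = h(s r) +
r^(-k) f(-s T r)`, where `f(-s T r)` is read as `f(-s)` when `T r = 0`. Iterating this until the
orbit reaches `0` writes `f(s r)` as the series `F_s(r) = ∑ β_j(r)^(-k) h((-1)^j s T^j r)`, with
`f(±1)` in place of `h` at `0` (`hasSum_gaussTerm_rat`). The same series makes sense at real points,
and on `[0, 1]` the function `f*` is almost everywhere `F_1`.

Convergence. `β_j` decays geometrically, but `h` may be as large as `exp(y^(-θ))` near `0`, with `θ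
< 1`. A small `T^j x` means that a convergent approximates `x` too well. At a `Tame` point such
approximations are excluded from some scale on, and the weight then absorbs the growth of `h`, so
the series is dominated by a geometric one, uniformly once the scale is fixed (`norm_gaussTerm_le`).
Since `1/θ > 1`, a Borel–Cantelli argument makes almost every real tame (`ae_exists_tame`). A
counting version makes all but a small proportion of the reduced fractions `a/q` tame from a scale
independent of `q` (`exists_eventually_card_not_tame_le`); it uses a sieve at small scales, plain
counting at large ones, and `q/φ(q) = O((log q)^ε)`.

Equidistribution. The partial sums are continuous at irrationals, hence their values at reduced
fractions equidistribute (`tendsto_coprimeAverage`); truncating the series costs little outside the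
few fractions that are not tame (`tendsto_coprimeAverage_gaussSeries`). Along convergents of a tame
irrational the series converges by dominated convergence, because a convergent shares its digits
with the point (`tendsto_gaussSeries_of_comparable`).

Diffuseness. Suppose `F_1 = z` on a set of positive measure, and let `x` be a density point of it.
Pulling back along the inverse branches of `T^(2n)` at `x`, whose distortion is bounded, shows that
`F_1` agrees with an analytic function `Ψ_n` outside a set of measure tending to `0`. By rigidity of
analytic functions the `Ψ_n` are eventually one function, equal to `F_1` almost everywhere, and that
function must be the constant `z` (`ae_gaussSeries_eq_const`). Then `h` satisfies an explicit
functional equation (`period_eq_of_ae_const`), and the Euclidean algorithm yields `f = z + (f 1 - z)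
den^k` on the positive rationals (`eq_add_mul_den_cpow`), the excluded case. -/

/-! ### The Gauss map, its orbit products and continuants. -/

/-- The Gauss map `x ↦ {1/x}`, with value `0` at `0`. -/
noncomputable def gaussMap (x : ℝ) : ℝ := Int.fract x⁻¹

/-- The product `x · T x ⋯ T^(n-1) x` along the orbit of the Gauss map. -/
noncomputable def gaussProd (x : ℝ) (n : ℕ) : ℝ := ∏ i ∈ Finset.range n, gaussMap^[i] x

lemma gaussMap_nonneg (x : ℝ) : 0 ≤ gaussMap x := Int.fract_nonneg _

lemma gaussMap_lt_one (x : ℝ) : gaussMap x < 1 := Int.fract_lt_one _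

lemma gaussMap_zero : gaussMap 0 = 0 := by simp [gaussMap]

lemma gaussMap_mem (x : ℝ) : gaussMap x ∈ Set.Icc (0 : ℝ) 1 :=
  ⟨gaussMap_nonneg x, (gaussMap_lt_one x).le⟩

lemma iterate_gaussMap_mem {x : ℝ} (hx : x ∈ Set.Icc (0 : ℝ) 1) (n : ℕ) :
    gaussMap^[n] x ∈ Set.Icc (0 : ℝ) 1 := by
  cases n with
  | zero => exact hx
  | succ n => rw [Function.iterate_succ_apply']; exact gaussMap_mem _

lemma iterate_gaussMap_zero (n : ℕ) : gaussMap^[n] 0 = 0 :=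
  Function.iterate_fixed gaussMap_zero n

lemma gaussProd_zero (x : ℝ) : gaussProd x 0 = 1 := by simp [gaussProd]

lemma gaussProd_succ (x : ℝ) (n : ℕ) :
    gaussProd x (n + 1) = gaussProd x n * gaussMap^[n] x := Finset.prod_range_succ _ _

lemma gaussProd_succ' (x : ℝ) (n : ℕ) :
    gaussProd x (n + 1) = x * gaussProd (gaussMap x) n := by
  simp only [gaussProd, Finset.prod_range_succ', Function.iterate_succ_apply,
    Function.iterate_zero, id]
  ring

lemma gaussProd_nonneg {x : ℝ} (hx : x ∈ Set.Icc (0 : ℝ) 1) (n : ℕ) : 0 ≤ gaussProd x n :=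
  Finset.prod_nonneg fun i _ => (iterate_gaussMap_mem hx i).1

lemma gaussProd_le_one {x : ℝ} (hx : x ∈ Set.Icc (0 : ℝ) 1) (n : ℕ) : gaussProd x n ≤ 1 :=
  Finset.prod_le_one (fun i _ => (iterate_gaussMap_mem hx i).1)
    fun i _ => (iterate_gaussMap_mem hx i).2

lemma one_le_floor_inv {x : ℝ} (h0 : 0 < x) (h1 : x ≤ 1) : 1 ≤ ⌊x⁻¹⌋ := by
  rw [Int.le_floor]; push_cast; exact (one_le_inv₀ h0).2 h1

lemma mul_gaussMap {x : ℝ} (h0 : x ≠ 0) : x * gaussMap x = 1 - ⌊x⁻¹⌋ * x := by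
  have : gaussMap x = x⁻¹ - ⌊x⁻¹⌋ := rfl
  rw [this]; field_simp

/-- With `a = ⌊1/x⌋ ≥ 1` one has `x · T x = 1 - a x`, while `(a + 1) x > 1` gives `a x > a/(a+1) ≥
1/2`. Hence two Gauss steps halve the orbit product, which is the source of all geometric decay
below. -/
lemma mul_gaussMap_le {x : ℝ} (hx : x ∈ Set.Icc (0 : ℝ) 1) : x * gaussMap x ≤ 1 / 2 := by
  rcases hx.1.eq_or_lt with h | h
  · rw [← h]; norm_num
  rw [mul_gaussMap h.ne']
  have h1 := one_le_floor_inv h hx.2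
  have h2 : x⁻¹ < ⌊x⁻¹⌋ + 1 := Int.lt_floor_add_one _
  have h3 : (1 : ℝ) ≤ ⌊x⁻¹⌋ := by exact_mod_cast h1
  have h4 : 1 < (⌊x⁻¹⌋ + 1) * x := by
    have := mul_lt_mul_of_pos_right h2 h
    rwa [inv_mul_cancel₀ h.ne'] at this
  nlinarith

lemma gaussProd_add_two_le {x : ℝ} (hx : x ∈ Set.Icc (0 : ℝ) 1) (n : ℕ) :
    gaussProd x (n + 2) ≤ gaussProd x n / 2 := by
  rw [gaussProd_succ, gaussProd_succ, mul_assoc, Function.iterate_succ_apply']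
  have := mul_gaussMap_le (iterate_gaussMap_mem hx n)
  have := mul_le_mul_of_nonneg_left this (gaussProd_nonneg hx n)
  linarith

lemma gaussProd_antitone {x : ℝ} (hx : x ∈ Set.Icc (0 : ℝ) 1) : Antitone (gaussProd x) :=
  antitone_nat_of_succ_le fun n => by
    rw [gaussProd_succ]
    exact mul_le_of_le_one_right (gaussProd_nonneg hx n) (iterate_gaussMap_mem hx n).2

lemma gaussProd_two_mul_le {x : ℝ} (hx : x ∈ Set.Icc (0 : ℝ) 1) (n : ℕ) :
    gaussProd x (2 * n) ≤ (1 / 2) ^ n := by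
  induction n with
  | zero => simp [gaussProd_zero]
  | succ n ih =>
    have := gaussProd_add_two_le hx (2 * n)
    rw [pow_succ, mul_add, mul_one]
    linarith

lemma gaussProd_le {x : ℝ} (hx : x ∈ Set.Icc (0 : ℝ) 1) (n : ℕ) :
    gaussProd x n ≤ (1 / 2) ^ (n / 2) :=
  (gaussProd_antitone hx (Nat.mul_div_le n 2)).trans (gaussProd_two_mul_le hx _)

/-- These are the classical identities `β_(n+1) = |q_n x - p_n|` and `q_n β_n + q_(n-1) β_(n+1) =
1`, with `b = q_n`, `b' = q_(n-1)`, `c = p_n`. They turn a small value of `T^n x` into a good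
rational approximation of `x`. Positivity of `β_n` says that the first `n` digits exist. -/
lemma exists_int_gaussProd {x : ℝ} (hx : x ∈ Set.Icc (0 : ℝ) 1) (n : ℕ)
    (hn : 0 < gaussProd x n) :
    ∃ b b' c : ℤ, 1 ≤ b ∧ 0 ≤ b' ∧ b' ≤ b ∧ gaussProd x (n + 1) = |b * x - c| ∧
      b * gaussProd x n + b' * gaussProd x (n + 1) = 1 := by
  -- The recursion involves two consecutive convergents and the alternating sign `e` of `q_n x -
  -- p_n`, so the induction carries all of these.
  suffices ∃ b b' c c' e : ℤ, 1 ≤ b ∧ 0 ≤ b' ∧ b' ≤ b ∧ (e = 1 ∨ e = -1) ∧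
      gaussProd x (n + 1) = e * (b * x - c) ∧ gaussProd x n = -e * (b' * x - c') ∧
      b * gaussProd x n + b' * gaussProd x (n + 1) = 1 by
    obtain ⟨b, b', c, c', e, h1, h2, h2', he, h3, -, h4⟩ := this
    refine ⟨b, b', c, h1, h2, h2', ?_, h4⟩
    rw [← abs_of_nonneg (gaussProd_nonneg hx (n + 1)), h3, abs_mul]
    rcases he with rfl | rfl <;> simp
  induction n with
  | zero =>
    exact ⟨1, 0, 0, 1, 1, le_rfl, le_rfl, by norm_num, Or.inl rfl, by simp [gaussProd],
      by simp [gaussProd], by simp [gaussProd]⟩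
  | succ n ih =>
    have hTn : gaussMap^[n] x ≠ 0 := by
      rintro h; rw [gaussProd_succ, h, mul_zero] at hn; exact lt_irrefl _ hn
    have hn' : 0 < gaussProd x n := (gaussProd_nonneg hx n).lt_of_ne' (by
      rintro h; rw [gaussProd_succ, h, zero_mul] at hn; exact lt_irrefl _ hn)
    obtain ⟨b, b', c, c', e, h1, h2, h2', he, h3, h3', h4⟩ := ih hn'
    set a : ℤ := ⌊(gaussMap^[n] x)⁻¹⌋
    have ha : 1 ≤ a := one_le_floor_inv
      ((iterate_gaussMap_mem hx n).1.lt_of_ne' hTn) (iterate_gaussMap_mem hx n).2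
    have key : gaussProd x (n + 2) = gaussProd x n - a * gaussProd x (n + 1) := by
      rw [gaussProd_succ, gaussProd_succ, mul_assoc, Function.iterate_succ_apply',
        mul_gaussMap hTn]
      ring
    refine ⟨a * b + b', b, a * c + c', c, -e, by nlinarith, by linarith, by nlinarith,
      by rcases he with rfl | rfl <;> simp, ?_, ?_, ?_⟩
    · rw [key, h3, h3']; push_cast; ring
    · rw [h3]; push_cast; ring
    · rw [key]; push_cast; linear_combination h4

lemma measurable_gaussMap : Measurable gaussMap := measurable_inv.fract

lemma measurable_iterate_gaussMap (n : ℕ) : Measurable (gaussMap^[n]) :=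
  measurable_gaussMap.iterate n

lemma measurable_gaussProd (n : ℕ) : Measurable fun x => gaussProd x n :=
  Finset.measurable_prod _ fun i _ => measurable_iterate_gaussMap i

lemma irrational_gaussMap {x : ℝ} (hx : Irrational x) : Irrational (gaussMap x) := by
  have : gaussMap x = x⁻¹ - ⌊x⁻¹⌋ := rfl
  rw [this]
  exact (irrational_inv_iff.2 hx).sub_intCast _

lemma irrational_iterate_gaussMap {x : ℝ} (hx : Irrational x) (n : ℕ) :
    Irrational (gaussMap^[n] x) := by
  induction n with
  | zero => exact hx
  | succ n ih => rw [Function.iterate_succ_apply']; exact irrational_gaussMap ih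

lemma continuousAt_gaussMap {x : ℝ} (hx : Irrational x) : ContinuousAt gaussMap x := by
  have h0 : x ≠ 0 := hx.ne_zero
  have h1 : ContinuousAt Int.fract x⁻¹ :=
    continuousAt_fract fun h => (irrational_inv_iff.2 hx).ne_int _ h
  exact ContinuousAt.comp h1 (continuousAt_inv₀ h0)

lemma continuousAt_iterate_gaussMap {x : ℝ} (hx : Irrational x) (n : ℕ) :
    ContinuousAt (gaussMap^[n]) x := by
  induction n with
  | zero => exact continuousAt_id
  | succ n ih =>
    rw [Function.iterate_succ']
    exact ContinuousAt.comp (continuousAt_gaussMap (irrational_iterate_gaussMap hx n)) ih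

lemma continuousAt_gaussProd {x : ℝ} (hx : Irrational x) (n : ℕ) :
    ContinuousAt (fun y => gaussProd y n) x :=
  tendsto_finsetProd _ fun i _ => continuousAt_iterate_gaussMap hx i

lemma gaussMap_add_inv {a : ℤ} {y : ℝ} (h0 : 0 ≤ y) (h1 : y < 1) :
    gaussMap ((a + y)⁻¹) = y := by
  rw [gaussMap, inv_inv, Int.fract_intCast_add, Int.fract_eq_self.2 ⟨h0, h1⟩]

/-! ### Counting integers coprime to `q` in intervals, and small residues. -/

lemma sum_moebius_divisors_gcd (a : ℕ) {q : ℕ} (hq : 0 < q) :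
    ∑ d ∈ q.divisors, (if d ∣ a then ArithmeticFunction.moebius d else 0) =
      if Nat.Coprime a q then 1 else 0 := by
  have h1 : ∑ d ∈ (Nat.gcd a q).divisors, ArithmeticFunction.moebius d =
      if Nat.gcd a q = 1 then 1 else 0 := by
    rw [← ArithmeticFunction.coe_mul_zeta_apply, ArithmeticFunction.moebius_mul_coe_zeta,
      ArithmeticFunction.one_apply]
  change _ = if Nat.gcd a q = 1 then 1 else 0
  rw [← h1, ← Finset.sum_filter]
  refine Finset.sum_congr ?_ fun _ _ => rfl
  ext d
  have : Nat.gcd a q ≠ 0 := Nat.gcd_ne_zero_right hq.ne'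
  simp only [Finset.mem_filter, Nat.mem_divisors, Nat.dvd_gcd_iff]
  have := hq.ne'
  tauto

lemma card_coprime_Ioc (X : ℕ) {q : ℕ} (hq : 0 < q) :
    (((Finset.Ioc 0 X).filter fun a => Nat.Coprime a q).card : ℤ) =
      ∑ d ∈ q.divisors, ArithmeticFunction.moebius d * ((X / d : ℕ) : ℤ) := by
  have : (((Finset.Ioc 0 X).filter fun a => Nat.Coprime a q).card : ℤ) =
      ∑ a ∈ Finset.Ioc 0 X, if Nat.Coprime a q then (1 : ℤ) else 0 := by
    simp
  rw [this, ← Finset.sum_congr rfl fun a _ => sum_moebius_divisors_gcd a hq, Finset.sum_comm]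
  refine Finset.sum_congr rfl fun d _ => ?_
  rw [← Nat.Ioc_filter_dvd_card_eq_div, ← Finset.sum_filter, Finset.sum_const, nsmul_eq_mul,
    mul_comm]

lemma card_coprime_Ioc_self (q : ℕ) :
    ((Finset.Ioc 0 q).filter fun a => Nat.Coprime a q).card = q.totient := by
  have := Nat.filter_coprime_Ico_eq_totient q 1
  rw [← this]
  congr 1
  ext a
  simp only [Finset.mem_filter, Finset.mem_Ioc, Finset.mem_Ico, Nat.coprime_comm (n := a)]
  constructor <;> rintro ⟨h1, h2⟩ <;> exact ⟨by omega, h2⟩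

/-- Legendre sieve: Möbius inversion gives `∑ μ(d) ⌊X/d⌋`, and dropping each floor costs at most
`1`. The identity with `X = q` evaluates the main term. -/
lemma abs_card_coprime_sub_le (X : ℕ) {q : ℕ} (hq : 0 < q) :
    |(((Finset.Ioc 0 X).filter fun a => Nat.Coprime a q).card : ℝ) - X * q.totient / q| ≤
      q.divisors.card := by
  have h1 : (((Finset.Ioc 0 X).filter fun a => Nat.Coprime a q).card : ℝ) =
      ∑ d ∈ q.divisors, (ArithmeticFunction.moebius d : ℝ) * ((X / d : ℕ) : ℝ) := by
    simpa only [Int.cast_sum, Int.cast_mul, Int.cast_natCast] using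
      congrArg (Int.cast : ℤ → ℝ) (card_coprime_Ioc X hq)
  have h2 : (q.totient : ℝ) =
      ∑ d ∈ q.divisors, (ArithmeticFunction.moebius d : ℝ) * ((q / d : ℕ) : ℝ) := by
    rw [← card_coprime_Ioc_self]
    simpa only [Int.cast_sum, Int.cast_mul, Int.cast_natCast] using
      congrArg (Int.cast : ℤ → ℝ) (card_coprime_Ioc q hq)
  have hq' : (q : ℝ) ≠ 0 := by positivity
  rw [h1, h2, Finset.mul_sum, Finset.sum_div, ← Finset.sum_sub_distrib]
  refine (Finset.abs_sum_le_sum_abs _ _).trans ?_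
  rw [Finset.card_eq_sum_ones, Nat.cast_sum]
  refine Finset.sum_le_sum fun d hd => ?_
  have hdq : d ∣ q := Nat.dvd_of_mem_divisors hd
  have hd0 : 0 < d := Nat.pos_of_mem_divisors hd
  have hd' : (d : ℝ) ≠ 0 := by positivity
  rw [Nat.cast_div hdq hd']
  have h3 : (ArithmeticFunction.moebius d : ℝ) * ((X / d : ℕ) : ℝ) -
      X * ((ArithmeticFunction.moebius d : ℝ) * ((q : ℝ) / d)) / q =
      ArithmeticFunction.moebius d * (((X / d : ℕ) : ℝ) - X / d) := by
    field_simp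
  rw [h3, abs_mul]
  have h4 : |(ArithmeticFunction.moebius d : ℝ)| ≤ 1 := by
    exact_mod_cast ArithmeticFunction.abs_moebius_le_one
  have h5 : |((X / d : ℕ) : ℝ) - X / d| ≤ 1 := by
    rw [abs_le]
    have h6 : ((X / d : ℕ) : ℝ) ≤ X / d := Nat.cast_div_le
    have h7 : (X : ℝ) / d < (X / d : ℕ) + 1 := by
      rw [div_lt_iff₀ (by positivity)]
      exact_mod_cast Nat.lt_mul_of_div_lt (Nat.lt_succ_self _) hd0
    constructor <;> linarith
  simpa using mul_le_one₀ h4 (abs_nonneg _) h5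

/-- In each pair `d`, `q/d` one member is at most `√q`. -/
lemma card_divisors_le_sqrt (q : ℕ) : q.divisors.card ≤ 2 * Nat.sqrt q := by
  have h : q.divisors ⊆ (Finset.Ioc 0 (Nat.sqrt q)) ∪
      (Finset.Ioc 0 (Nat.sqrt q)).image fun d => q / d := by
    intro d hd
    have hdq : d ∣ q := Nat.dvd_of_mem_divisors hd
    have hd0 : 0 < d := Nat.pos_of_mem_divisors hd
    have hq : q ≠ 0 := (Nat.mem_divisors.1 hd).2
    simp only [Finset.mem_union, Finset.mem_Ioc, Finset.mem_image]
    by_cases hs : d ≤ Nat.sqrt q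
    · exact Or.inl ⟨hd0, hs⟩
    · refine Or.inr ⟨q / d, ⟨Nat.div_pos (Nat.le_of_dvd (by omega) hdq) hd0, ?_⟩,
        Nat.div_div_self hdq hq⟩
      rw [Nat.le_sqrt]
      by_contra hlt
      have h1 : Nat.sqrt q + 1 ≤ d := by omega
      have h2 : q < (Nat.sqrt q + 1) * (Nat.sqrt q + 1) := Nat.lt_succ_sqrt q
      have h3 : q / d * d = q := Nat.div_mul_cancel hdq
      push Not at hlt hs
      have h4 : Nat.sqrt q < q / d := Nat.sqrt_lt.2 hlt
      nlinarith
  refine (Finset.card_le_card h).trans ((Finset.card_union_le _ _).trans ?_)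
  have := Finset.card_image_le (s := Finset.Ioc 0 (Nat.sqrt q)) (f := fun d => q / d)
  simp only [Nat.card_Ioc] at *
  omega

lemma card_divisors_le_two_sqrt (q : ℕ) : (q.divisors.card : ℝ) ≤ 2 * √q := by
  have h1 : (q.divisors.card : ℝ) ≤ 2 * (Nat.sqrt q : ℝ) := by
    exact_mod_cast card_divisors_le_sqrt q
  linarith [Real.nat_sqrt_le_real_sqrt (a := q)]

/-- Difference of two sieve counts. Two of the three divisor errors come from the sieve; the third
absorbs the endpoint rounding `φ(q)/q ≤ 1`. -/
lemma card_coprime_between_le {q : ℕ} (hq : 0 < q) {u v : ℝ} (huv : u ≤ v) :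
    (((Finset.Icc 1 q).filter fun a => Nat.Coprime a q ∧ u ≤ a ∧ (a : ℝ) ≤ v).card : ℝ) ≤
      (v - u) * q.totient / q + 3 * q.divisors.card := by
  classical
  have hφ : (0 : ℝ) ≤ q.totient / q := by positivity
  have hφ1 : (q.totient : ℝ) / q ≤ 1 :=
    div_le_one_of_le₀ (by exact_mod_cast q.totient_le) (by positivity)
  have hd : (1 : ℝ) ≤ q.divisors.card := by
    exact_mod_cast Finset.card_pos.2 ⟨1, Nat.one_mem_divisors.2 hq.ne'⟩
  rcases lt_or_ge v 0 with hv | hv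
  · rw [Finset.filter_false_of_mem]
    · simp only [Finset.card_empty, Nat.cast_zero]
      rw [mul_div_assoc]
      have := mul_nonneg (sub_nonneg.2 huv) hφ
      linarith
    · rintro a - ⟨-, -, h⟩
      exact absurd (h.trans_lt hv) (not_lt.2 (Nat.cast_nonneg a))
  set S := fun X : ℕ => (Finset.Ioc 0 X).filter fun a => Nat.Coprime a q
  have hsub : ((Finset.Icc 1 q).filter fun a => Nat.Coprime a q ∧ u ≤ a ∧ (a : ℝ) ≤ v) ⊆
      S ⌊v⌋₊ \ S (⌈u⌉₊ - 1) := by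
    intro a
    simp only [S, Finset.mem_filter, Finset.mem_Icc, Finset.mem_sdiff, Finset.mem_Ioc]
    rintro ⟨⟨h1, h2⟩, h3, h4, h5⟩
    refine ⟨⟨⟨h1, Nat.le_floor h5⟩, h3⟩, fun h6 => ?_⟩
    have : ⌈u⌉₊ ≤ a := Nat.ceil_le.2 h4
    omega
  have hle : ⌈u⌉₊ - 1 ≤ ⌊v⌋₊ := by
    have : ⌈u⌉₊ ≤ ⌊v⌋₊ + 1 := Nat.ceil_le.2 (by
      push_cast; exact huv.trans (Nat.lt_floor_add_one v).le)
    omega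
  have hSS : S (⌈u⌉₊ - 1) ⊆ S ⌊v⌋₊ :=
    Finset.filter_subset_filter _ (Finset.Ioc_subset_Ioc_right hle)
  have h1 : ((((Finset.Icc 1 q).filter fun a => Nat.Coprime a q ∧ u ≤ a ∧ (a : ℝ) ≤ v).card
      : ℕ) : ℝ) ≤ (S ⌊v⌋₊).card - (S (⌈u⌉₊ - 1)).card := by
    have := Finset.card_le_card hsub
    rw [Finset.card_sdiff_of_subset hSS] at this
    rw [← Nat.cast_sub (Finset.card_le_card hSS)]
    exact_mod_cast this
  have h2 := abs_le.1 (abs_card_coprime_sub_le ⌊v⌋₊ hq)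
  have h3 := abs_le.1 (abs_card_coprime_sub_le (⌈u⌉₊ - 1) hq)
  have h4 : (⌊v⌋₊ : ℝ) ≤ v := Nat.floor_le hv
  have h5 : u - 1 ≤ ((⌈u⌉₊ - 1 : ℕ) : ℝ) := by
    have h6 : u ≤ ⌈u⌉₊ := Nat.le_ceil u
    have h7 : (⌈u⌉₊ : ℝ) ≤ ((⌈u⌉₊ - 1 : ℕ) : ℝ) + 1 := by
      exact_mod_cast (by omega : ⌈u⌉₊ ≤ ⌈u⌉₊ - 1 + 1)
    linarith
  have h6 := mul_le_mul_of_nonneg_right h4 hφ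
  have h7 := mul_le_mul_of_nonneg_right h5 hφ
  simp only [mul_div_assoc] at *
  change _ ≤ (v - u) * ((q.totient : ℝ) / q) + 3 * _
  have h8 : (u - 1) * ((q.totient : ℝ) / q) = u * ((q.totient : ℝ) / q) - q.totient / q := by ring
  have h9 : (v - u) * ((q.totient : ℝ) / q) = v * ((q.totient : ℝ) / q) - u * (q.totient / q) := by
    ring
  linarith [h2.2, h3.1]

/-- A solvable congruence `b a ≡ r` modulo `q` determines `a` modulo `q / gcd(b, q)`. -/
lemma card_linear_congruence_le {q b : ℕ} (hq : 0 < q) (r : ℤ) :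
    ((Finset.Icc 1 q).filter fun a : ℕ => (q : ℤ) ∣ b * a - r).card ≤
      if ((Nat.gcd b q : ℕ) : ℤ) ∣ r then Nat.gcd b q else 0 := by
  classical
  set g := Nat.gcd b q
  have hg : 0 < g := Nat.gcd_pos_of_pos_right _ hq
  rcases Finset.eq_empty_or_nonempty
    ((Finset.Icc 1 q).filter fun a : ℕ => (q : ℤ) ∣ b * a - r) with h | ⟨a₀, ha₀⟩
  · rw [h]; simp
  rw [Finset.mem_filter] at ha₀
  have hgq : (g : ℤ) ∣ q := by exact_mod_cast Nat.gcd_dvd_right b q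
  have hgb : (g : ℤ) ∣ b := by exact_mod_cast Nat.gcd_dvd_left b q
  have hgr : (g : ℤ) ∣ r := by
    have h1 := hgq.trans ha₀.2
    have h2 : (g : ℤ) ∣ b * a₀ := hgb.mul_right _
    have := dvd_sub h2 h1
    simpa using this
  rw [if_pos hgr]
  obtain ⟨n, hn⟩ : g ∣ q := Nat.gcd_dvd_right b q
  have hn0 : 0 < n := Nat.pos_of_mul_pos_left (hn ▸ hq) |> fun h => by
    rcases Nat.eq_zero_or_pos n with h0 | h0
    · rw [h0] at hn; simp at hn; omega
    · exact h0
  have hsub : ((Finset.Icc 1 q).filter fun a : ℕ => (q : ℤ) ∣ b * a - r) ⊆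
      (Finset.Ioc 0 q).filter fun a : ℕ => a ≡ a₀ [MOD n] := by
    intro a ha
    rw [Finset.mem_filter] at ha ⊢
    refine ⟨by simpa [Nat.succ_le_iff] using ha.1, ?_⟩
    have h1 : (q : ℤ) ∣ b * ((a₀ : ℤ) - a) := by
      have := dvd_sub ha₀.2 ha.2
      rwa [show (b : ℤ) * a₀ - r - (b * a - r) = b * ((a₀ : ℤ) - a) by ring] at this
    rw [Nat.modEq_iff_dvd]
    obtain ⟨b', hb'⟩ : g ∣ b := Nat.gcd_dvd_left b q
    have hcop : IsCoprime (n : ℤ) b' := by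
      rw [Nat.isCoprime_iff_coprime]
      have := Nat.coprime_div_gcd_div_gcd (m := b) (n := q) hg
      change Nat.Coprime (b / g) (q / g) at this
      rw [hn, hb', Nat.mul_div_cancel_left _ hg, Nat.mul_div_cancel_left _ hg] at this
      exact this.symm
    rw [hb', hn] at h1
    push_cast at h1
    rw [mul_assoc] at h1
    exact hcop.dvd_of_dvd_mul_left ((mul_dvd_mul_iff_left (by positivity)).1 h1)
  refine (Finset.card_le_card hsub).trans ?_
  have := Nat.Ioc_filter_modEq_card 0 q hn0 a₀
  have h2 : (((Finset.Ioc 0 q).filter fun a : ℕ => a ≡ a₀ [MOD n]).card : ℤ) = g := by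
    rw [this]
    have hn' : (n : ℚ) ≠ 0 := by positivity
    have e1 : (((q : ℕ) : ℚ) - a₀) / n = (((0 : ℕ) : ℚ) - a₀) / n + (g : ℤ) := by
      rw [hn]; push_cast; field_simp; ring
    rw [e1, Int.floor_add_intCast]
    simp
  exact_mod_cast h2.le

-- With `g = gcd(b, q)`, the residues that occur are nonzero multiples of `g`, at most `2R/g` of
-- them, and each is hit at most `g` times: the gcd cancels. Excluding residue `0` is essential,
-- since it alone could contribute `g` solutions.
open Classical in
lemma card_small_residue_le {q b : ℕ} (hq : 0 < q) {R : ℝ} (hR : 0 ≤ R) :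
    (((Finset.Icc 1 q).filter fun a : ℕ => ∃ c : ℤ, (b : ℤ) * a - c * q ≠ 0 ∧
      |(((b : ℤ) * a - c * q : ℤ) : ℝ)| ≤ R).card : ℝ) ≤ 2 * R := by
  classical
  set g := Nat.gcd b q
  have hg : 0 < g := Nat.gcd_pos_of_pos_right _ hq
  set N := ⌊R / g⌋₊
  set I : Finset ℤ := ((Finset.Icc (-(N : ℤ)) N).erase 0).image fun t => (g : ℤ) * t
  have hsub : ((Finset.Icc 1 q).filter fun a : ℕ => ∃ c : ℤ, (b : ℤ) * a - c * q ≠ 0 ∧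
      |(((b : ℤ) * a - c * q : ℤ) : ℝ)| ≤ R) ⊆
      I.biUnion fun r => (Finset.Icc 1 q).filter fun a : ℕ => (q : ℤ) ∣ b * a - r := by
    intro a ha
    rw [Finset.mem_filter] at ha
    obtain ⟨ha1, c, hc0, hcR⟩ := ha
    rw [Finset.mem_biUnion]
    refine ⟨b * a - c * q, ?_, Finset.mem_filter.2 ⟨ha1, ⟨c, by ring⟩⟩⟩
    have hgq : (g : ℤ) ∣ q := by exact_mod_cast Nat.gcd_dvd_right b q
    have hgb : (g : ℤ) ∣ b := by exact_mod_cast Nat.gcd_dvd_left b q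
    obtain ⟨t, ht⟩ : (g : ℤ) ∣ b * a - c * q := dvd_sub (hgb.mul_right _) (hgq.mul_left _)
    rw [Finset.mem_image]
    refine ⟨t, ?_, ht.symm⟩
    rw [Finset.mem_erase, Finset.mem_Icc, ← abs_le]
    refine ⟨by rintro rfl; simp [ht] at hc0, ?_⟩
    rw [ht] at hcR
    push_cast at hcR
    rw [abs_mul, Nat.abs_cast, mul_comm, ← le_div_iff₀ (by positivity)] at hcR
    have h1 : ((t.natAbs : ℕ) : ℝ) ≤ R / g := by
      rw [Nat.cast_natAbs]; exact_mod_cast hcR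
    have := Nat.le_floor h1
    rw [Int.abs_eq_natAbs]
    exact_mod_cast this
  have hI : I.card ≤ 2 * N := by
    refine Finset.card_image_le.trans ?_
    rw [Finset.card_erase_of_mem (by simp), Int.card_Icc]
    omega
  have h1 : ((Finset.Icc 1 q).filter fun a : ℕ => ∃ c : ℤ, (b : ℤ) * a - c * q ≠ 0 ∧
      |(((b : ℤ) * a - c * q : ℤ) : ℝ)| ≤ R).card ≤ 2 * N * g := by
    refine (Finset.card_le_card hsub).trans ((Finset.card_biUnion_le).trans ?_)
    calc _ ≤ ∑ r ∈ I, g := Finset.sum_le_sum fun r _ =>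
          (card_linear_congruence_le hq r).trans (by split_ifs <;> omega)
      _ = I.card * g := by simp
      _ ≤ _ := Nat.mul_le_mul_right _ hI
  have h2 : (N : ℝ) ≤ R / g := Nat.floor_le (by positivity)
  have h3 : (N : ℝ) * g ≤ R := (le_div_iff₀ (by positivity)).1 h2
  have h4 : ((2 * N * g : ℕ) : ℝ) = 2 * (N * g) := by push_cast; ring
  calc _ ≤ ((2 * N * g : ℕ) : ℝ) := by exact_mod_cast h1
    _ ≤ 2 * R := by rw [h4]; linarith

/-! ### A lower bound for Euler's totient function. -/

lemma eventually_card_primesBelow_two_pow_le {ε : ℝ} (hε : 0 < ε) :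
    ∀ᶠ i : ℕ in atTop, ((Nat.primesBelow (2 ^ (i + 1))).card : ℝ) ≤ ε * 2 ^ i := by
  have h1 : Tendsto (fun i : ℕ => (2 : ℝ) ^ (i + 1)) atTop atTop :=
    (tendsto_pow_atTop_atTop_of_one_lt (by norm_num : (1 : ℝ) < 2)).comp (tendsto_add_atTop_nat 1)
  have h2 := h1.eventually (Chebyshev.eventually_primeCounting_le (ε := 1) one_pos)
  have h3 : Tendsto (fun i : ℕ => ((i : ℝ) + 1) * Real.log 2) atTop atTop :=
    (tendsto_atTop_add_const_right _ _ tendsto_natCast_atTop_atTop).atTop_mul_const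
      (Real.log_pos (by norm_num))
  filter_upwards [h2, h3.eventually_ge_atTop ((Real.log 4 + 1) * 2 / ε)] with i hi hi'
  have h4 : ((Nat.primesBelow (2 ^ (i + 1))).card : ℝ) ≤ Nat.primeCounting ⌊(2 : ℝ) ^ (i + 1)⌋₊ := by
    rw [Nat.primesBelow_card_eq_primeCounting', show ⌊(2 : ℝ) ^ (i + 1)⌋₊ = 2 ^ (i + 1) by
      exact_mod_cast Nat.floor_natCast (R := ℝ) (2 ^ (i + 1))]
    exact_mod_cast Nat.monotone_primeCounting' (Nat.le_succ _)
  refine h4.trans (hi.trans ?_)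
  rw [Real.log_pow]
  push_cast
  have h5 : 0 < ((i : ℝ) + 1) * Real.log 2 := by positivity
  rw [div_le_iff₀ hε] at hi'
  rw [div_le_iff₀ h5, pow_succ]
  have : (0 : ℝ) < 2 ^ i := by positivity
  nlinarith

/-- By Chebyshev, each dyadic block beyond a fixed index contributes at most `ε`. This crude form of
Mertens' estimate is enough because only an arbitrarily small power of `log q` has to be reached. -/
lemma exists_sum_inv_primes_le {ε : ℝ} (hε : 0 < ε) :
    ∃ C : ℝ, 0 ≤ C ∧ ∀ i : ℕ, ∑ p ∈ Nat.primesBelow (2 ^ i), (1 : ℝ) / p ≤ C + ε * i := by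
  obtain ⟨i₀, hi₀⟩ := eventually_atTop.1 (eventually_card_primesBelow_two_pow_le hε)
  have hmono : ∀ {m n : ℕ}, m ≤ n → ∑ p ∈ Nat.primesBelow m, (1 : ℝ) / p ≤
      ∑ p ∈ Nat.primesBelow n, (1 : ℝ) / p := fun {m n} h =>
    Finset.sum_le_sum_of_subset_of_nonneg
      (fun p hp => by
        rw [Nat.mem_primesBelow] at hp ⊢; exact ⟨hp.1.trans_le h, hp.2⟩)
      fun _ _ _ => by positivity
  refine ⟨∑ p ∈ Nat.primesBelow (2 ^ i₀), (1 : ℝ) / p,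
    Finset.sum_nonneg fun _ _ => by positivity, fun i => ?_⟩
  rcases le_total i i₀ with h | h
  · have := hmono (Nat.pow_le_pow_right two_pos h)
    have : 0 ≤ ε * i := by positivity
    linarith
  induction i, h using Nat.le_induction with
  | base => have : 0 ≤ ε * i₀ := by positivity
            linarith
  | succ i hi ih =>
    have hsub : Nat.primesBelow (2 ^ i) ⊆ Nat.primesBelow (2 ^ (i + 1)) := fun p hp => by
      rw [Nat.mem_primesBelow] at hp ⊢
      exact ⟨hp.1.trans_le (Nat.pow_le_pow_right two_pos i.le_succ), hp.2⟩
    rw [← Finset.sum_sdiff hsub]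
    have : ∑ p ∈ Nat.primesBelow (2 ^ (i + 1)) \ Nat.primesBelow (2 ^ i), (1 : ℝ) / p ≤ ε := by
      calc _ ≤ ∑ p ∈ Nat.primesBelow (2 ^ (i + 1)) \ Nat.primesBelow (2 ^ i), (1 : ℝ) / 2 ^ i := by
            refine Finset.sum_le_sum fun p hp => ?_
            rw [Finset.mem_sdiff, Nat.mem_primesBelow, Nat.mem_primesBelow] at hp
            have : 2 ^ i ≤ p := by
              by_contra hlt
              exact hp.2 ⟨by omega, hp.1.2⟩
            refine one_div_le_one_div_of_le (by positivity) (by exact_mod_cast this)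
        _ = (Nat.primesBelow (2 ^ (i + 1)) \ Nat.primesBelow (2 ^ i)).card / 2 ^ i := by
            rw [Finset.sum_const, nsmul_eq_mul]; ring
        _ ≤ (Nat.primesBelow (2 ^ (i + 1))).card / 2 ^ i := by
            have := Finset.card_le_card
              (Finset.sdiff_subset (s := Nat.primesBelow (2 ^ (i + 1))) (t := Nat.primesBelow (2 ^ i)))
            gcongr
        _ ≤ ε := by
            rw [div_le_iff₀ (by positivity)]; exact hi₀ i hi
    push_cast
    linarith

lemma two_pow_card_primeFactors_le {q : ℕ} (hq : q ≠ 0) : 2 ^ q.primeFactors.card ≤ q := by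
  calc 2 ^ q.primeFactors.card = ∏ p ∈ q.primeFactors, 2 := by simp
    _ ≤ ∏ p ∈ q.primeFactors, p :=
        Finset.prod_le_prod' fun p hp => (Nat.prime_of_mem_primeFactors hp).two_le
    _ ≤ q := Nat.le_of_dvd (Nat.pos_of_ne_zero hq) (Nat.prod_primeFactors_dvd q)

/-- There are at most `L = log₂ q` prime factors, so those exceeding `L` contribute at most `L ·
(1/L) = 1` in total; the others lie below `2^(log₂ L + 1)`. -/
lemma sum_inv_primeFactors_le {q : ℕ} (hq : 2 ≤ q) :
    ∑ p ∈ q.primeFactors, (1 : ℝ) / p ≤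
      ∑ p ∈ Nat.primesBelow (2 ^ (Nat.log 2 (Nat.log 2 q) + 1)), (1 : ℝ) / p + 1 := by
  classical
  set L := Nat.log 2 q
  have hL : 0 < L := Nat.log_pos one_lt_two hq
  have hcard : q.primeFactors.card ≤ L :=
    (Nat.le_log_iff_pow_le one_lt_two (by omega)).2 (two_pow_card_primeFactors_le (by omega))
  rw [← Finset.sum_filter_add_sum_filter_not q.primeFactors (fun p => p ≤ L)]
  refine add_le_add ?_ ?_
  · refine Finset.sum_le_sum_of_subset_of_nonneg (fun p hp => ?_) fun _ _ _ => by positivity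
    rw [Finset.mem_filter] at hp
    rw [Nat.mem_primesBelow]
    exact ⟨hp.2.trans_lt (Nat.lt_pow_succ_log_self one_lt_two _),
      Nat.prime_of_mem_primeFactors hp.1⟩
  · calc _ ≤ ∑ p ∈ q.primeFactors.filter (fun p => ¬ p ≤ L), (1 : ℝ) / L := by
          refine Finset.sum_le_sum fun p hp => ?_
          rw [Finset.mem_filter, not_le] at hp
          exact one_div_le_one_div_of_le (by positivity) (by exact_mod_cast hp.2.le)
      _ = (q.primeFactors.filter (fun p => ¬ p ≤ L)).card * (1 / L) := by
          rw [Finset.sum_const, nsmul_eq_mul]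
      _ ≤ L * (1 / L) := by
          gcongr
          exact (Finset.card_filter_le _ _).trans hcard
      _ = 1 := by field_simp

/-- Here `q/φ(q) = ∏ p/(p-1)`, and `p/(p-1) ≤ 1 + 2/p ≤ exp(2/p)` for `p ≥ 2`. -/
lemma le_totient_mul_exp (q : ℕ) :
    (q : ℝ) ≤ q.totient * Real.exp (2 * ∑ p ∈ q.primeFactors, (1 : ℝ) / p) := by
  have h := Nat.totient_mul_prod_primeFactors q
  have h' : (q.totient : ℝ) * ∏ p ∈ q.primeFactors, (p : ℝ) =
      q * ∏ p ∈ q.primeFactors, ((p - 1 : ℕ) : ℝ) := by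
    rw [← Nat.cast_prod, ← Nat.cast_prod]; exact_mod_cast h
  have hpos : 0 < ∏ p ∈ q.primeFactors, ((p - 1 : ℕ) : ℝ) :=
    Finset.prod_pos fun p hp => by
      have := (Nat.prime_of_mem_primeFactors hp).two_le
      exact_mod_cast (by omega : 0 < p - 1)
  have hle : ∏ p ∈ q.primeFactors, (p : ℝ) ≤
      (∏ p ∈ q.primeFactors, ((p - 1 : ℕ) : ℝ)) *
        Real.exp (2 * ∑ p ∈ q.primeFactors, (1 : ℝ) / p) := by
    rw [Finset.mul_sum, Real.exp_sum, ← Finset.prod_mul_distrib]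
    refine Finset.prod_le_prod (fun p _ => by positivity) fun p hp => ?_
    have h2 := (Nat.prime_of_mem_primeFactors hp).two_le
    have h2' : (2 : ℝ) ≤ p := by exact_mod_cast h2
    rw [Nat.cast_sub (by omega), Nat.cast_one]
    have h3 := Real.add_one_le_exp (2 * (1 / (p : ℝ)))
    have h4 : (p : ℝ) ≤ (p - 1) * (2 * (1 / (p : ℝ)) + 1) := by
      rw [show ((p : ℝ) - 1) * (2 * (1 / (p : ℝ)) + 1) = p + (p - 2) / p by field_simp; ring]
      have : 0 ≤ ((p : ℝ) - 2) / p := div_nonneg (by linarith) (by linarith)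
      linarith
    exact h4.trans (mul_le_mul_of_nonneg_left h3 (by linarith))
  refine le_of_mul_le_mul_right ?_ hpos
  rw [← h']
  calc _ ≤ (q.totient : ℝ) * ((∏ p ∈ q.primeFactors, ((p - 1 : ℕ) : ℝ)) *
        Real.exp (2 * ∑ p ∈ q.primeFactors, (1 : ℝ) / p)) :=
        mul_le_mul_of_nonneg_left hle (Nat.cast_nonneg _)
    _ = _ := by ring

/-- `q / φ(q)` grows slower than any positive power of `log q`. -/
lemma exists_le_totient_mul_log_rpow {ε : ℝ} (hε : 0 < ε) :
    ∃ C : ℝ, 0 < C ∧ ∀ q : ℕ, 2 ≤ q →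
      (q : ℝ) ≤ C * q.totient * (Nat.log 2 q : ℝ) ^ ε := by
  -- The exponent becomes `2 · (ε/4) · log₂ L` up to a constant, and `log₂ L ≤ 2 log L`, so `ε/4`
  -- gives exactly `L^ε`.
  obtain ⟨C, hC, h⟩ := exists_sum_inv_primes_le (ε := ε / 4) (by positivity)
  refine ⟨Real.exp (2 * (C + ε / 4 + 1)), by positivity, fun q hq => ?_⟩
  have h1 := sum_inv_primeFactors_le hq
  have h2 := h (Nat.log 2 (Nat.log 2 q) + 1)
  set L := Nat.log 2 q
  have hL : 0 < L := Nat.log_pos one_lt_two hq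
  have h3 : (Nat.log 2 L : ℝ) ≤ 2 * Real.log L := by
    have h4 : ((2 ^ Nat.log 2 L : ℕ) : ℝ) ≤ L := by
      exact_mod_cast Nat.pow_log_le_self 2 hL.ne'
    have h5 := Real.log_le_log (by positivity) h4
    push_cast at h5
    rw [Real.log_pow] at h5
    have := Real.log_two_gt_d9
    have h6 : (0 : ℝ) ≤ Nat.log 2 L := Nat.cast_nonneg _
    nlinarith
  push_cast at h2
  refine (le_totient_mul_exp q).trans ?_
  rw [Real.rpow_def_of_pos (by exact_mod_cast hL), mul_comm (Real.exp _) (q.totient : ℝ), mul_assoc,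
    ← Real.exp_add]
  refine mul_le_mul_of_nonneg_left (Real.exp_le_exp.2 ?_) (Nat.cast_nonneg _)
  nlinarith

/-! ### Tame points, and the count of reduced fractions that are not tame. -/

/-- The point `x` has no approximation `c / b` with `b ≤ 2^(m+1)` and
`0 < |b x - c| ≤ 1 / (2^m M_m)`, for any `m ≥ m₁`. -/
def Tame (M : ℕ → ℝ) (m₁ : ℕ) (x : ℝ) : Prop :=
  ∀ m, m₁ ≤ m → ∀ b : ℕ, 1 ≤ b → b ≤ 2 ^ (m + 1) → ∀ c : ℤ, (b : ℝ) * x ≠ c →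
    1 / (2 ^ m * M m) < |b * x - c|

/-- The point `x` has a nontrivial approximation `c / b` with `b ≤ 2^(m+1)` and
`|b x - c| ≤ 1 / (2^m M)`. -/
def WellApproximated (m : ℕ) (M x : ℝ) : Prop :=
  ∃ b : ℕ, 1 ≤ b ∧ b ≤ 2 ^ (m + 1) ∧ ∃ c : ℤ, (b : ℝ) * x ≠ c ∧
    |b * x - c| ≤ 1 / (2 ^ m * M)

lemma not_tame_iff {M : ℕ → ℝ} {m₁ : ℕ} {x : ℝ} :
    ¬ Tame M m₁ x ↔ ∃ m, m₁ ≤ m ∧ WellApproximated m (M m) x := by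
  unfold Tame WellApproximated
  push Not
  rfl

lemma wellApproximated_div_iff {q : ℕ} (hq : 0 < q) {a m : ℕ} {M : ℝ} :
    WellApproximated m M ((a : ℝ) / q) ↔ ∃ b : ℕ, 1 ≤ b ∧ b ≤ 2 ^ (m + 1) ∧
      ∃ c : ℤ, (b : ℤ) * a - c * q ≠ 0 ∧
        |(((b : ℤ) * a - c * q : ℤ) : ℝ)| ≤ q / (2 ^ m * M) := by
  have hq' : (0 : ℝ) < q := by positivity
  refine exists_congr fun b => and_congr_right fun _ => and_congr_right fun _ =>
    exists_congr fun c => ?_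
  have h1 : (((b : ℤ) * a - c * q : ℤ) : ℝ) = (b * ((a : ℝ) / q) - c) * q := by
    push_cast; field_simp
  refine and_congr ?_ ?_
  · rw [not_iff_not, ← Int.cast_eq_zero (α := ℝ), h1, mul_eq_zero, sub_eq_zero]
    simp [hq'.ne']
  · rw [h1, abs_mul, abs_of_pos hq', ← le_div_iff₀ hq', div_right_comm, div_self hq'.ne']

-- Coprimality is ignored here: each of the `2^(m+1)` denominators gives at most `2q/(2^m M)`
-- numerators. The bound has `q` in place of `φ(q)` but no error term, so it remains usable for
-- large `m`.
open Classical in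
lemma card_wellApproximated_le {q : ℕ} (hq : 0 < q) (m : ℕ) {M : ℝ} (hM : 0 < M) :
    (((Finset.Icc 1 q).filter fun a : ℕ => WellApproximated m M ((a : ℝ) / q)).card : ℝ) ≤
      4 * q / M := by
  set R : ℝ := q / (2 ^ m * M)
  have hR : 0 ≤ R := by positivity
  have hsub : ((Finset.Icc 1 q).filter fun a : ℕ => WellApproximated m M ((a : ℝ) / q)) ⊆
      (Finset.Icc 1 (2 ^ (m + 1))).biUnion fun b : ℕ => (Finset.Icc 1 q).filter fun a : ℕ =>
        ∃ c : ℤ, (b : ℤ) * a - c * q ≠ 0 ∧ |(((b : ℤ) * a - c * q : ℤ) : ℝ)| ≤ R := by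
    intro a ha
    rw [Finset.mem_filter, wellApproximated_div_iff hq] at ha
    obtain ⟨ha1, b, hb1, hb2, hc⟩ := ha
    exact Finset.mem_biUnion.2 ⟨b, Finset.mem_Icc.2 ⟨hb1, hb2⟩, Finset.mem_filter.2 ⟨ha1, hc⟩⟩
  calc _ ≤ ((∑ b ∈ Finset.Icc (1 : ℕ) (2 ^ (m + 1)), ((Finset.Icc 1 q).filter fun a : ℕ =>
        ∃ c : ℤ, (b : ℤ) * a - c * q ≠ 0 ∧
          |(((b : ℤ) * a - c * q : ℤ) : ℝ)| ≤ R).card : ℕ) : ℝ) := by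
        exact_mod_cast (Finset.card_le_card hsub).trans Finset.card_biUnion_le
    _ ≤ ∑ b ∈ Finset.Icc (1 : ℕ) (2 ^ (m + 1)), 2 * R := by
        rw [Nat.cast_sum]
        exact Finset.sum_le_sum fun b _ => card_small_residue_le hq hR
    _ = 4 * q / M := by
        rw [Finset.sum_const, Nat.card_Icc, nsmul_eq_mul]
        simp only [R]
        push_cast
        field_simp
        simp [pow_succ]
        ring

-- For each `b` the numerators lie in at most `b + 2 ≤ 3b` intervals of length `2R/b` about the
-- points `c q/b`. The sieve in each interval gives a main term proportional to `φ(q)`, with an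
-- error that is harmless only for small `m`.
open Classical in
lemma card_coprime_wellApproximated_le {q : ℕ} (hq : 0 < q) (m : ℕ) {M : ℝ} (hM : 1 ≤ M) :
    (((Finset.Icc 1 q).filter fun a : ℕ => Nat.Coprime a q ∧
        WellApproximated m M ((a : ℝ) / q)).card : ℝ) ≤
      12 * q.totient / M + 36 * 4 ^ m * q.divisors.card := by
  set R : ℝ := q / (2 ^ m * M)
  have hM0 : 0 < M := by linarith
  have hq' : (0 : ℝ) < q := by positivity
  have hR : 0 ≤ R := by positivity
  have hRq : R ≤ q := div_le_self (by positivity)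
    (one_le_mul_of_one_le_of_one_le (one_le_pow₀ (by norm_num)) hM)
  have hsub : ((Finset.Icc 1 q).filter fun a : ℕ => Nat.Coprime a q ∧
        WellApproximated m M ((a : ℝ) / q)) ⊆
      (Finset.Icc 1 (2 ^ (m + 1))).biUnion fun b : ℕ => (Finset.range (b + 2)).biUnion fun c =>
        (Finset.Icc 1 q).filter fun a : ℕ => Nat.Coprime a q ∧
          (c * q - R) / b ≤ a ∧ (a : ℝ) ≤ (c * q + R) / b := by
    intro a ha
    rw [Finset.mem_filter, wellApproximated_div_iff hq] at ha
    obtain ⟨ha1, hcop, b, hb1, hb2, c, -, hc⟩ := ha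
    have hb0 : (0 : ℝ) < b := by exact_mod_cast hb1
    rw [abs_le] at hc
    push_cast at hc
    have ha1' := Finset.mem_Icc.1 ha1
    have ha0 : (1 : ℝ) ≤ a := by exact_mod_cast ha1'.1
    have haq : (a : ℝ) ≤ q := by exact_mod_cast ha1'.2
    have hc0 : 0 ≤ c := by
      have : (-1 : ℝ) < c := by
        by_contra hlt
        push Not at hlt
        nlinarith [mul_le_mul_of_nonneg_right hlt hq'.le, mul_pos hb0 (by linarith : (0 : ℝ) < a)]
      have : -1 < c := by exact_mod_cast this
      omega
    have hcb : c < b + 2 := by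
      have : (c : ℝ) < b + 2 := by
        by_contra hlt
        push Not at hlt
        nlinarith [mul_le_mul_of_nonneg_right hlt hq'.le, mul_le_mul_of_nonneg_left haq hb0.le]
      exact_mod_cast this
    refine Finset.mem_biUnion.2 ⟨b, Finset.mem_Icc.2 ⟨hb1, hb2⟩,
      Finset.mem_biUnion.2 ⟨c.toNat, Finset.mem_range.2 (by omega),
        Finset.mem_filter.2 ⟨ha1, hcop, ?_⟩⟩⟩
    have : ((c.toNat : ℕ) : ℝ) = c := by exact_mod_cast Int.toNat_of_nonneg hc0
    rw [this, div_le_iff₀ hb0, le_div_iff₀ hb0]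
    constructor <;> linarith [hc.1, hc.2]
  have hD : (0 : ℝ) ≤ q.divisors.card := Nat.cast_nonneg _
  calc _ ≤ ((∑ b ∈ Finset.Icc (1 : ℕ) (2 ^ (m + 1)), ∑ c ∈ Finset.range (b + 2),
        ((Finset.Icc 1 q).filter fun a : ℕ => Nat.Coprime a q ∧
          (c * q - R) / b ≤ a ∧ (a : ℝ) ≤ (c * q + R) / b).card : ℕ) : ℝ) := by
        exact_mod_cast (Finset.card_le_card hsub).trans (Finset.card_biUnion_le.trans
          (Finset.sum_le_sum fun b _ => Finset.card_biUnion_le))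
    _ ≤ ∑ b ∈ Finset.Icc (1 : ℕ) (2 ^ (m + 1)),
          (6 * R * (q.totient / q) + 9 * 2 ^ (m + 1) * q.divisors.card) := by
        rw [Nat.cast_sum]
        refine Finset.sum_le_sum fun b hb => ?_
        rw [Finset.mem_Icc] at hb
        have hb0 : (1 : ℝ) ≤ b := by exact_mod_cast hb.1
        have hbB : (b : ℝ) ≤ 2 ^ (m + 1) := by exact_mod_cast hb.2
        rw [Nat.cast_sum]
        calc _ ≤ ∑ c ∈ Finset.range (b + 2),
              (2 * R / b * (q.totient / q) + 3 * (q.divisors.card : ℝ)) := by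
              refine Finset.sum_le_sum fun c _ => ?_
              refine (card_coprime_between_le hq (by gcongr; linarith)).trans (le_of_eq ?_)
              ring
          _ = (b + 2) * (2 * R / b * (q.totient / q) + 3 * (q.divisors.card : ℝ)) := by
              rw [Finset.sum_const, Finset.card_range, nsmul_eq_mul]; push_cast; ring
          _ ≤ (3 * b) * (2 * R / b * (q.totient / q) + 3 * (q.divisors.card : ℝ)) := by
              gcongr; linarith
          _ = 6 * R * (q.totient / q) + 9 * b * q.divisors.card := by
              have : (b : ℝ) ≠ 0 := by positivity
              field_simp; ring
          _ ≤ _ := by gcongr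
    _ = 12 * q.totient / M + 36 * 4 ^ m * q.divisors.card := by
        rw [Finset.sum_const, Nat.card_Icc, nsmul_eq_mul]
        simp only [R]
        have : (4 : ℝ) ^ m = 2 ^ m * 2 ^ m := by rw [← mul_pow]; norm_num
        rw [this]
        push_cast
        field_simp
        simp [pow_succ]
        ring

/-- A nonzero integer `b a - c q` has absolute value at least `1`, so beyond the scale of `q` there
is nothing to exclude. -/
lemma not_wellApproximated_of_lt {q : ℕ} (hq : 0 < q) {a m : ℕ} {M : ℝ} (hM : 1 ≤ M)
    (hm : q < 2 ^ m) : ¬ WellApproximated m M ((a : ℝ) / q) := by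
  rw [wellApproximated_div_iff hq]
  rintro ⟨b, -, -, c, h1, h2⟩
  have h3 : (1 : ℝ) ≤ |(((b : ℤ) * a - c * q : ℤ) : ℝ)| := by
    exact_mod_cast Int.one_le_abs h1
  have h4 : (q : ℝ) / (2 ^ m * M) < 1 := by
    rw [div_lt_one (by positivity)]
    have : (q : ℝ) < 2 ^ m := by exact_mod_cast hm
    nlinarith
  linarith

/-- The threshold sequence `(1 + c m)^κ`. -/
noncomputable def growth (c κ : ℝ) (m : ℕ) : ℝ := (1 + c * m) ^ κ

lemma one_le_growth {c κ : ℝ} (hc : 0 < c) (hκ : 1 < κ) (m : ℕ) : 1 ≤ growth c κ m :=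
  Real.one_le_rpow (by have : 0 ≤ c * m := by positivity
                       linarith) (by linarith)

lemma growth_mono {c κ : ℝ} (hc : 0 < c) (hκ : 1 < κ) : Monotone (growth c κ) := fun m n h =>
  Real.rpow_le_rpow (by positivity) (by gcongr) (by linarith)

lemma summable_inv_growth {c κ : ℝ} (hc : 0 < c) (hκ : 1 < κ) :
    Summable fun m => 1 / growth c κ m := by
  have h1 : Summable fun m : ℕ => c ^ (-κ) * (1 / (m : ℝ) ^ κ) :=
    (Real.summable_one_div_nat_rpow.2 hκ).mul_left _
  rw [← summable_nat_add_iff 1] at h1 ⊢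
  refine Summable.of_nonneg_of_le (fun m => by unfold growth; positivity) (fun m => ?_) h1
  have h2 : growth c κ (m + 1) ≥ (c * ((m + 1 : ℕ) : ℝ)) ^ κ :=
    Real.rpow_le_rpow (by positivity) (by linarith) (by linarith)
  rw [Real.mul_rpow hc.le (by positivity)] at h2
  rw [Real.rpow_neg hc.le, ← one_div, one_div_mul_one_div]
  exact one_div_le_one_div_of_le (by positivity) h2

-- The scales split at `L/8` and `L`, where `L = log₂ q`: the sieve bound is used below `L/8`, the
-- crude count between `L/8` and `L`, and above `L` no fraction is well approximated.
open Classical in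
lemma card_not_tame_le {q : ℕ} (hq : 0 < q) {c κ : ℝ} (hc : 0 < c) (hκ : 1 < κ) (m₁ : ℕ) :
    (((Finset.Icc 1 q).filter fun a : ℕ => Nat.Coprime a q ∧
        ¬ Tame (growth c κ) m₁ ((a : ℝ) / q)).card : ℝ) ≤
      12 * q.totient * ∑' m, 1 / growth c κ (m + m₁) +
        (36 * 4 ^ (Nat.log 2 q / 8) * q.divisors.card +
          (Nat.log 2 q + 1) * (4 * q / growth c κ (Nat.log 2 q / 8))) := by
  set L := Nat.log 2 q
  set S := fun m => (Finset.Icc 1 q).filter fun a : ℕ => Nat.Coprime a q ∧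
    WellApproximated m (growth c κ m) ((a : ℝ) / q)
  have hM := one_le_growth hc hκ
  have hsub : ((Finset.Icc 1 q).filter fun a : ℕ => Nat.Coprime a q ∧
        ¬ Tame (growth c κ) m₁ ((a : ℝ) / q)) ⊆
      (Finset.Ico m₁ (L / 8)).biUnion S ∪ (Finset.Ico (L / 8) (L + 1)).biUnion S := by
    intro a ha
    rw [Finset.mem_filter, not_tame_iff] at ha
    obtain ⟨ha1, hcop, m, hm, hw⟩ := ha
    have hmL : m < L + 1 := by
      by_contra h
      refine not_wellApproximated_of_lt hq (hM m) ?_ hw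
      exact (Nat.lt_pow_succ_log_self one_lt_two q).trans_le
        (Nat.pow_le_pow_right two_pos (by omega))
    have hS : a ∈ S m := Finset.mem_filter.2 ⟨ha1, hcop, hw⟩
    rw [Finset.mem_union, Finset.mem_biUnion, Finset.mem_biUnion]
    rcases lt_or_ge m (L / 8) with h | h
    · exact Or.inl ⟨m, Finset.mem_Ico.2 ⟨hm, h⟩, hS⟩
    · exact Or.inr ⟨m, Finset.mem_Ico.2 ⟨h, hmL⟩, hS⟩
  have h1 : (((Finset.Icc 1 q).filter fun a : ℕ => Nat.Coprime a q ∧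
        ¬ Tame (growth c κ) m₁ ((a : ℝ) / q)).card : ℝ) ≤
      ∑ m ∈ Finset.Ico m₁ (L / 8), ((S m).card : ℝ) +
        ∑ m ∈ Finset.Ico (L / 8) (L + 1), ((S m).card : ℝ) := by
    exact_mod_cast (Finset.card_le_card hsub).trans ((Finset.card_union_le _ _).trans
      (add_le_add Finset.card_biUnion_le Finset.card_biUnion_le))
  have h2 : ∑ m ∈ Finset.Ico m₁ (L / 8), ((S m).card : ℝ) ≤
      12 * q.totient * ∑' m, 1 / growth c κ (m + m₁) +
        36 * 4 ^ (L / 8) * q.divisors.card := by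
    calc _ ≤ ∑ m ∈ Finset.Ico m₁ (L / 8), (12 * q.totient * (1 / growth c κ m) +
          36 * q.divisors.card * 4 ^ m) := by
          refine Finset.sum_le_sum fun m _ =>
            (card_coprime_wellApproximated_le hq m (hM m)).trans (le_of_eq ?_)
          ring
      _ = 12 * q.totient * ∑ m ∈ Finset.Ico m₁ (L / 8), (1 / growth c κ m) +
          36 * q.divisors.card * ∑ m ∈ Finset.Ico m₁ (L / 8), (4 : ℝ) ^ m := by
          rw [Finset.sum_add_distrib, Finset.mul_sum, Finset.mul_sum]
      _ ≤ 12 * q.totient * ∑' m, 1 / growth c κ (m + m₁) +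
          36 * q.divisors.card * 4 ^ (L / 8) := by
          have hs := (summable_nat_add_iff m₁).2 (summable_inv_growth hc hκ)
          refine add_le_add (mul_le_mul_of_nonneg_left ?_ (by positivity))
            (mul_le_mul_of_nonneg_left ?_ (by positivity))
          · rw [Finset.sum_Ico_eq_sum_range]
            simp_rw [add_comm m₁]
            exact hs.sum_le_tsum _ fun m _ => by have := hM (m + m₁); positivity
          · calc ∑ m ∈ Finset.Ico m₁ (L / 8), (4 : ℝ) ^ m ≤ ∑ m ∈ Finset.range (L / 8), (4 : ℝ) ^ m :=
                Finset.sum_le_sum_of_subset_of_nonneg (fun m hm => by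
                  rw [Finset.mem_Ico] at hm; exact Finset.mem_range.2 hm.2)
                  fun _ _ _ => by positivity
              _ ≤ _ := by
                rw [geom_sum_eq (by norm_num)]
                have : (1 : ℝ) ≤ 4 ^ (L / 8) := one_le_pow₀ (by norm_num)
                rw [div_le_iff₀ (by norm_num)]; linarith
      _ = _ := by ring
  have h3 : ∑ m ∈ Finset.Ico (L / 8) (L + 1), ((S m).card : ℝ) ≤
      (L + 1) * (4 * q / growth c κ (L / 8)) := by
    have hpos : (0 : ℝ) ≤ 4 * q / growth c κ (L / 8) := by have := hM (L / 8); positivity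
    calc _ ≤ ∑ m ∈ Finset.Ico (L / 8) (L + 1), 4 * q / growth c κ (L / 8) := by
          refine Finset.sum_le_sum fun m hm => ?_
          have hm' := growth_mono hc hκ (Finset.mem_Ico.1 hm).1
          have h0 : 0 < growth c κ (L / 8) := by have := hM (L / 8); linarith
          have h4 : ((S m).card : ℝ) ≤ 4 * q / growth c κ m := by
            refine le_trans ?_ (card_wellApproximated_le hq m (by have := hM m; linarith))
            exact_mod_cast Finset.card_le_card fun a ha => by
              rw [Finset.mem_filter] at ha ⊢; exact ⟨ha.1, ha.2.2⟩
          exact h4.trans (by gcongr)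
      _ = ((L + 1 - L / 8 : ℕ) : ℝ) * (4 * q / growth c κ (L / 8)) := by
          rw [Finset.sum_const, Nat.card_Ico, nsmul_eq_mul]
      _ ≤ _ := by
          refine mul_le_mul_of_nonneg_right ?_ hpos
          exact_mod_cast Nat.sub_le _ _
  linarith

lemma tendsto_natLog_two_atTop : Tendsto (fun q : ℕ => Nat.log 2 q) atTop atTop :=
  tendsto_atTop_mono' _ (f₁ := fun q => Nat.log 2 q) (Eventually.of_forall fun _ => le_rfl)
    (tendsto_atTop.2 fun n => by
      filter_upwards [eventually_ge_atTop (2 ^ n)] with q hq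
      exact (Nat.le_log_iff_pow_le one_lt_two (by have := Nat.one_le_two_pow (n := n); omega)).2 hq)

lemma natLog_two_le_two_mul_log {q : ℕ} (hq : 1 ≤ q) : (Nat.log 2 q : ℝ) ≤ 2 * Real.log q := by
  have h4 : ((2 ^ Nat.log 2 q : ℕ) : ℝ) ≤ q := by
    exact_mod_cast Nat.pow_log_le_self 2 (by omega)
  have h5 := Real.log_le_log (by positivity) h4
  push_cast at h5
  rw [Real.log_pow] at h5
  have := Real.log_two_gt_d9
  have h6 : (0 : ℝ) ≤ Nat.log 2 q := Nat.cast_nonneg _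
  nlinarith

lemma tendsto_rpow_div_totient :
    Tendsto (fun q : ℕ => (q : ℝ) ^ (3 / 4 : ℝ) / q.totient) atTop (𝓝 0) := by
  obtain ⟨C, hC, h⟩ := exists_le_totient_mul_log_rpow (ε := 1) one_pos
  have h1 : Tendsto (fun q : ℕ => 2 * C * (Real.log q / (q : ℝ) ^ (1 / 4 : ℝ))) atTop (𝓝 0) := by
    have := (isLittleO_log_rpow_atTop (r := 1 / 4) (by norm_num)).tendsto_div_nhds_zero
    simpa using (this.comp tendsto_natCast_atTop_atTop).const_mul (2 * C)
  refine squeeze_zero' (Eventually.of_forall fun q => by positivity) ?_ h1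
  filter_upwards [eventually_ge_atTop 2] with q hq
  have hq0 : (0 : ℝ) < q := by positivity
  have hφ : (0 : ℝ) < q.totient := by exact_mod_cast Nat.totient_pos.2 (by omega)
  have h2 := h q hq
  rw [Real.rpow_one] at h2
  have h3 := natLog_two_le_two_mul_log (q := q) (by omega)
  have h4 : (q : ℝ) ^ (3 / 4 : ℝ) * (q : ℝ) ^ (1 / 4 : ℝ) = q := by
    rw [← Real.rpow_add hq0]; norm_num
  have h5 : (0 : ℝ) < (q : ℝ) ^ (1 / 4 : ℝ) := by positivity
  rw [div_le_iff₀ hφ, ← mul_le_mul_iff_left₀ h5, h4]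
  calc (q : ℝ) ≤ C * q.totient * Nat.log 2 q := h2
    _ ≤ C * q.totient * (2 * Real.log q) := by gcongr
    _ = _ := by field_simp

lemma tendsto_card_divisors_div_totient :
    Tendsto (fun q : ℕ => (q.divisors.card : ℝ) / q.totient) atTop (𝓝 0) := by
  refine squeeze_zero' (Eventually.of_forall fun q => by positivity) ?_
    (by simpa using tendsto_rpow_div_totient.const_mul 2)
  filter_upwards [eventually_ge_atTop 1] with q hq
  rw [← mul_div_assoc]
  refine div_le_div_of_nonneg_right ((card_divisors_le_two_sqrt q).trans ?_) (by positivity)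
  rw [Real.sqrt_eq_rpow]
  have : (1 : ℝ) ≤ q := by exact_mod_cast hq
  exact mul_le_mul_of_nonneg_left (Real.rpow_le_rpow_of_exponent_le this (by norm_num)) two_pos.le

/-- The sieve error is `O(q^(1/4) · q^(1/2))`, because `4^(L/8) ≤ q^(1/4)`. The large scales cost
about `q L^(1-κ)`, which is `o(φ(q))` because `q/φ(q) = O(L^ε)`. -/
lemma tendsto_tame_error {c κ : ℝ} (hc : 0 < c) (hκ : 1 < κ) :
    Tendsto (fun q : ℕ => (36 * 4 ^ (Nat.log 2 q / 8) * (q.divisors.card : ℝ) +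
          (Nat.log 2 q + 1) * (4 * q / growth c κ (Nat.log 2 q / 8))) / q.totient)
      atTop (𝓝 0) := by
  -- Half of the excess `κ - 1` pays for `q/φ(q)`; the other half leaves the decay `(L + 1)^(-ε)`.
  set ε := (κ - 1) / 2 with hεdef
  have hε : 0 < ε := by simp only [hεdef]; linarith
  obtain ⟨C, hC, h⟩ := exists_le_totient_mul_log_rpow hε
  -- Chosen so that `c' (L + 1) ≤ 1 + c ⌊L/8⌋` for every `L`, including `L < 8`, where the floor
  -- vanishes.
  set c' := min 1 c / 8
  have hc' : 0 < c' := by positivity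
  have h1 : Tendsto (fun q : ℕ => 72 * ((q : ℝ) ^ (3 / 4 : ℝ) / q.totient) +
      4 * C * (c' ^ κ)⁻¹ * ((Nat.log 2 q : ℝ) + 1) ^ (-ε)) atTop (𝓝 0) := by
    have h2 := (tendsto_rpow_neg_atTop hε).comp (tendsto_atTop_add_const_right _ 1
      ((tendsto_natCast_atTop_atTop (R := ℝ)).comp tendsto_natLog_two_atTop))
    simpa using (tendsto_rpow_div_totient.const_mul 72).add (h2.const_mul (4 * C * (c' ^ κ)⁻¹))
  refine squeeze_zero' (Eventually.of_forall fun q => ?_) ?_ h1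
  · have := one_le_growth hc hκ (Nat.log 2 q / 8)
    positivity
  filter_upwards [eventually_ge_atTop 2] with q hq
  have hq1 : (1 : ℝ) ≤ q := by exact_mod_cast (by omega : 1 ≤ q)
  have hφ : (0 : ℝ) < q.totient := by exact_mod_cast Nat.totient_pos.2 (by omega)
  have h2 := h q hq
  have hpow : 2 ^ Nat.log 2 q ≤ q := Nat.pow_log_le_self 2 (by omega)
  set L := Nat.log 2 q
  rw [add_div]
  refine add_le_add ?_ ?_
  · rw [← mul_div_assoc]
    refine div_le_div_of_nonneg_right ?_ hφ.le
    have h3 : (4 : ℝ) ^ (L / 8) ≤ (q : ℝ) ^ (1 / 4 : ℝ) := by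
      rw [show (1 / 4 : ℝ) = (4 : ℝ)⁻¹ by norm_num,
        Real.le_rpow_inv_iff_of_pos (by positivity) (by positivity) (by norm_num),
        show (4 : ℝ) ^ (L / 8) = (((4 ^ (L / 8) : ℕ)) : ℝ) by push_cast; rfl,
        show (4 : ℝ) = ((4 : ℕ) : ℝ) by norm_num, Real.rpow_natCast]
      have : (4 ^ (L / 8)) ^ 4 ≤ q := by
        calc (4 ^ (L / 8)) ^ 4 = 2 ^ (8 * (L / 8)) := by
              rw [← pow_mul, show (4 : ℕ) = 2 ^ 2 by norm_num, ← pow_mul]; congr 1; ring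
          _ ≤ 2 ^ L := Nat.pow_le_pow_right two_pos (Nat.mul_div_le _ _)
          _ ≤ q := hpow
      exact_mod_cast this
    have h4 : (q.divisors.card : ℝ) ≤ 2 * (q : ℝ) ^ (1 / 2 : ℝ) := by
      rw [← Real.sqrt_eq_rpow]; exact card_divisors_le_two_sqrt q
    calc 36 * (4 : ℝ) ^ (L / 8) * q.divisors.card
        ≤ 36 * (q : ℝ) ^ (1 / 4 : ℝ) * (2 * (q : ℝ) ^ (1 / 2 : ℝ)) := by gcongr
      _ = 72 * ((q : ℝ) ^ (1 / 4 : ℝ) * (q : ℝ) ^ (1 / 2 : ℝ)) := by ring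
      _ = 72 * (q : ℝ) ^ (3 / 4 : ℝ) := by rw [← Real.rpow_add (by linarith)]; norm_num
  · have h3 : c' ^ κ * ((L : ℝ) + 1) ^ κ ≤ growth c κ (L / 8) := by
      rw [← Real.mul_rpow hc'.le (by positivity)]
      refine Real.rpow_le_rpow (by positivity) ?_ (by linarith)
      have h4 : (L : ℝ) + 1 ≤ 8 * ((L / 8 : ℕ) : ℝ) + 8 := by
        exact_mod_cast (by omega : L + 1 ≤ 8 * (L / 8) + 8)
      calc c' * ((L : ℝ) + 1) ≤ c' * (8 * ((L / 8 : ℕ) : ℝ) + 8) := by gcongr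
        _ = min 1 c * ((L / 8 : ℕ) : ℝ) + min 1 c := by simp only [c']; ring
        _ ≤ c * ((L / 8 : ℕ) : ℝ) + 1 := by
            gcongr
            · exact min_le_right _ _
            · exact min_le_left _ _
        _ = _ := by ring
    have h5 : (L : ℝ) ^ ε ≤ ((L : ℝ) + 1) ^ ε :=
      Real.rpow_le_rpow (by positivity) (by linarith) hε.le
    have hL1 : (0 : ℝ) < (L : ℝ) + 1 := by positivity
    have h6 : ((L : ℝ) + 1) ^ κ = (L + 1) * (((L : ℝ) + 1) ^ ε * ((L : ℝ) + 1) ^ ε) := by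
      rw [← Real.rpow_add hL1, mul_comm, ← Real.rpow_add_one hL1.ne']
      congr 1; simp only [hεdef]; ring
    have hX : (0 : ℝ) < ((L : ℝ) + 1) ^ ε := by positivity
    rw [div_le_iff₀ hφ, Real.rpow_neg hL1.le]
    calc ((L : ℝ) + 1) * (4 * q / growth c κ (L / 8))
        ≤ ((L : ℝ) + 1) * (4 * (C * q.totient * ((L : ℝ) + 1) ^ ε) /
            (c' ^ κ * ((L : ℝ) + 1) ^ κ)) := by
          gcongr
          exact h2.trans (by gcongr)
      _ = _ := by
          rw [h6]
          have : c' ^ κ ≠ 0 := by positivity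
          field_simp

open Classical in
lemma exists_eventually_card_not_tame_le {c κ : ℝ} (hc : 0 < c) (hκ : 1 < κ) {η : ℝ} (hη : 0 < η) :
    ∃ m₁, ∀ᶠ q : ℕ in atTop, (((Finset.Icc 1 q).filter fun a : ℕ => Nat.Coprime a q ∧
        ¬ Tame (growth c κ) m₁ ((a : ℝ) / q)).card : ℝ) ≤ η * q.totient := by
  have h1 := (tendsto_sum_nat_add fun m => 1 / growth c κ m).eventually_lt_const
    (u := η / 24) (by positivity)
  obtain ⟨m₁, hm₁⟩ := h1.exists
  refine ⟨m₁, ?_⟩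
  filter_upwards [(tendsto_tame_error hc hκ).eventually_lt_const (u := η / 2) (by positivity),
    eventually_ge_atTop 1] with q hq hq1
  have hφ : (0 : ℝ) < q.totient := by exact_mod_cast Nat.totient_pos.2 (by omega)
  have h2 := card_not_tame_le hq1 hc hκ m₁
  rw [div_lt_iff₀ hφ] at hq
  have h3 : 12 * (q.totient : ℝ) * ∑' m, 1 / growth c κ (m + m₁) ≤ 12 * q.totient * (η / 24) := by
    gcongr
  linarith

/-! ### Measure of the set of points that are not tame -/

/-- For each `b` there are `b + 3 ≤ 4b` possible `c`, each giving an interval of length `2R/b`,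
hence `8R` in total; summing over `2^(m+1)` values of `b` gives `16/M`. -/
lemma volume_wellApproximated_le (m : ℕ) {M : ℝ} (hM : 1 ≤ M) :
    volume {x ∈ Set.Icc (0 : ℝ) 1 | WellApproximated m M x} ≤ ENNReal.ofReal (16 / M) := by
  set R : ℝ := 1 / (2 ^ m * M)
  have hM0 : 0 < M := by linarith
  have hR : 0 ≤ R := by positivity
  have hR1 : R ≤ 1 := div_le_one_of_le₀
    (one_le_mul_of_one_le_of_one_le (one_le_pow₀ (by norm_num)) hM) (by positivity)
  have hsub : {x ∈ Set.Icc (0 : ℝ) 1 | WellApproximated m M x} ⊆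
      ⋃ b ∈ Finset.Icc (1 : ℕ) (2 ^ (m + 1)), ⋃ c ∈ Finset.Icc (-1 : ℤ) (b + 1),
        Set.Icc ((c - R) / b) ((c + R) / b) := by
    rintro x ⟨hx, b, hb1, hb2, c, -, hc⟩
    have hb0 : (0 : ℝ) < b := by exact_mod_cast hb1
    simp only [Set.mem_iUnion]
    rw [abs_le] at hc
    refine ⟨b, Finset.mem_Icc.2 ⟨hb1, hb2⟩, c, Finset.mem_Icc.2 ⟨?_, ?_⟩, ?_, ?_⟩
    · have : (-1 : ℝ) ≤ c := by nlinarith [hx.1, hc.1]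
      exact_mod_cast this
    · have : (c : ℝ) ≤ b + 1 := by nlinarith [hx.2, hc.1]
      exact_mod_cast this
    · rw [div_le_iff₀ hb0]; linarith [hc.1]
    · rw [le_div_iff₀ hb0]; linarith [hc.2]
  calc _ ≤ ∑ b ∈ Finset.Icc (1 : ℕ) (2 ^ (m + 1)), ∑ c ∈ Finset.Icc (-1 : ℤ) (b + 1),
        volume (Set.Icc (((c : ℝ) - R) / b) ((c + R) / b)) :=
        (measure_mono hsub).trans ((measure_biUnion_finset_le _ _).trans
          (Finset.sum_le_sum fun b _ => measure_biUnion_finset_le _ _))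
    _ ≤ ∑ b ∈ Finset.Icc (1 : ℕ) (2 ^ (m + 1)), ENNReal.ofReal (8 * R) := by
        refine Finset.sum_le_sum fun b hb => ?_
        have hb1 : (1 : ℝ) ≤ b := by exact_mod_cast (Finset.mem_Icc.1 hb).1
        have e : ∀ c ∈ Finset.Icc (-1 : ℤ) (b + 1),
            volume (Set.Icc (((c : ℝ) - R) / b) ((c + R) / b)) = ENNReal.ofReal (2 * R / b) := by
          intro c _
          rw [Real.volume_Icc]; congr 1; ring
        rw [Finset.sum_congr rfl e, Finset.sum_const, Int.card_Icc, nsmul_eq_mul,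
          show ((b : ℤ) + 1 + 1 - -1).toNat = b + 3 by omega, ← ENNReal.ofReal_natCast,
          ← ENNReal.ofReal_mul (by positivity)]
        refine ENNReal.ofReal_le_ofReal ?_
        rw [mul_div_assoc', div_le_iff₀ (by linarith)]
        push_cast
        nlinarith
    _ = ENNReal.ofReal (2 ^ (m + 1) * (8 * R)) := by
        rw [Finset.sum_const, Nat.card_Icc, nsmul_eq_mul, ← ENNReal.ofReal_natCast,
          ← ENNReal.ofReal_mul (by positivity)]
        norm_num
    _ ≤ _ := by
        refine ENNReal.ofReal_le_ofReal (le_of_eq ?_)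
        simp only [R]
        field_simp
        ring

lemma tendsto_volume_not_tame {c κ : ℝ} (hc : 0 < c) (hκ : 1 < κ) :
    Tendsto (fun m₁ => volume {x ∈ Set.Icc (0 : ℝ) 1 | ¬ Tame (growth c κ) m₁ x}) atTop (𝓝 0) := by
  have hM := one_le_growth hc hκ
  have hs := summable_inv_growth hc hκ
  have h1 : Tendsto (fun m₁ => ENNReal.ofReal (16 * ∑' m, 1 / growth c κ (m + m₁))) atTop (𝓝 0) := by
    have := ENNReal.tendsto_ofReal
      ((tendsto_sum_nat_add fun m => 1 / growth c κ m).const_mul 16)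
    simpa using this
  refine tendsto_of_tendsto_of_tendsto_of_le_of_le tendsto_const_nhds h1
    (fun _ => zero_le) fun m₁ => ?_
  have hsub : {x ∈ Set.Icc (0 : ℝ) 1 | ¬ Tame (growth c κ) m₁ x} ⊆
      ⋃ m : ℕ, {x ∈ Set.Icc (0 : ℝ) 1 | WellApproximated (m + m₁) (growth c κ (m + m₁)) x} := by
    rintro x ⟨hx, ht⟩
    obtain ⟨m, hm, hw⟩ := not_tame_iff.1 ht
    exact Set.mem_iUnion.2 ⟨m - m₁, hx, by rwa [Nat.sub_add_cancel hm]⟩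
  calc _ ≤ ∑' m : ℕ, ENNReal.ofReal (16 / growth c κ (m + m₁)) :=
        (measure_mono hsub).trans ((measure_iUnion_le _).trans
          (ENNReal.tsum_le_tsum fun m => volume_wellApproximated_le _ (hM _)))
    _ = _ := by
        rw [← tsum_mul_left, ENNReal.ofReal_tsum_of_nonneg]
        · exact tsum_congr fun m => by rw [mul_one_div]
        · intro m; have := hM (m + m₁); positivity
        · exact ((summable_nat_add_iff m₁).2 hs).mul_left 16

/-- Borel–Cantelli: a point that is tame from no scale lies in every one of the sets whose measures
tend to `0`. -/
lemma ae_exists_tame {c κ : ℝ} (hc : 0 < c) (hκ : 1 < κ) :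
    ∀ᵐ x ∂volume.restrict (Set.Icc (0 : ℝ) 1), ∃ m₁, Tame (growth c κ) m₁ x := by
  rw [ae_restrict_iff' measurableSet_Icc, ae_iff]
  refine le_antisymm (ge_of_tendsto' (tendsto_volume_not_tame hc hκ) fun m₁ => ?_) zero_le
  refine measure_mono fun x hx => ?_
  simp only [Set.mem_ofPred_eq, Classical.not_imp, not_exists] at hx
  exact ⟨hx.1, hx.2 m₁⟩

/-! ### Equidistribution of reduced fractions. -/

/-- The average of `g` over the reduced fractions `a / q ∈ (0, 1]`. -/
noncomputable def coprimeAverage (g : ℝ → ℝ) (q : ℕ) : ℝ :=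
  (∑ a ∈ (Finset.Icc 1 q).filter (fun a => Nat.Coprime a q), g ((a : ℝ) / q)) / q.totient

lemma card_Icc_filter_coprime (q : ℕ) :
    ((Finset.Icc 1 q).filter fun a => Nat.Coprime a q).card = q.totient := by
  rw [← card_coprime_Ioc_self]; rfl

lemma tendsto_card_coprime_lt {t : ℝ} (ht0 : 0 ≤ t) (ht1 : t ≤ 1) :
    Tendsto (fun q : ℕ => (((Finset.Icc 1 q).filter fun a : ℕ =>
      Nat.Coprime a q ∧ (a : ℝ) / q < t).card : ℝ) / q.totient) atTop (𝓝 t) := by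
  rw [tendsto_iff_norm_sub_tendsto_zero]
  have h1 : Tendsto (fun q : ℕ => (q.divisors.card : ℝ) / q.totient + 1 / (q : ℝ)) atTop (𝓝 0) := by
    simpa using tendsto_card_divisors_div_totient.add tendsto_one_div_atTop_nhds_zero_nat
  refine squeeze_zero' (Eventually.of_forall fun _ => norm_nonneg _) ?_ h1
  filter_upwards [eventually_ge_atTop 1] with q hq
  have hq0 : (0 : ℝ) < q := by exact_mod_cast hq
  have hφ : (0 : ℝ) < q.totient := by exact_mod_cast Nat.totient_pos.2 (by omega)
  have e : ((Finset.Icc 1 q).filter fun a : ℕ => Nat.Coprime a q ∧ (a : ℝ) / q < t) =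
      (Finset.Ioc 0 (⌈t * q⌉₊ - 1)).filter fun a => Nat.Coprime a q := by
    ext a
    simp only [Finset.mem_filter, Finset.mem_Icc, Finset.mem_Ioc, div_lt_iff₀ hq0]
    constructor
    · rintro ⟨⟨h1, h2⟩, h3, h4⟩
      have := Nat.lt_ceil.2 h4
      exact ⟨⟨by omega, by omega⟩, h3⟩
    · rintro ⟨⟨h1, h2⟩, h3⟩
      have h4 : a < ⌈t * q⌉₊ := by omega
      have h5 := Nat.lt_ceil.1 h4
      have h6 : (a : ℝ) ≤ q := h5.le.trans (mul_le_of_le_one_left hq0.le ht1)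
      exact ⟨⟨h1, by exact_mod_cast h6⟩, h3, h5⟩
  rw [e, Real.norm_eq_abs]
  have h2 := abs_card_coprime_sub_le (⌈t * q⌉₊ - 1) hq
  set n := ⌈t * q⌉₊ - 1
  set S := ((Finset.Ioc 0 n).filter fun a => Nat.Coprime a q).card
  have h3 : |(n : ℝ) - t * q| ≤ 1 := by
    have h4 : t * q ≤ ⌈t * q⌉₊ := Nat.le_ceil _
    have h5 : (⌈t * q⌉₊ : ℝ) < t * q + 1 := Nat.ceil_lt_add_one (by positivity)
    have h6 : (⌈t * q⌉₊ : ℝ) ≤ n + 1 := by exact_mod_cast (by omega : ⌈t * q⌉₊ ≤ n + 1)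
    have h7 : (n : ℝ) ≤ ⌈t * q⌉₊ := by exact_mod_cast (by omega : n ≤ ⌈t * q⌉₊)
    rw [abs_le]; constructor <;> linarith
  have h4 : (S : ℝ) / q.totient - t =
      ((S : ℝ) - n * q.totient / q) / q.totient + (n - t * q) / q := by field_simp; ring
  rw [h4]
  refine (abs_add_le _ _).trans (add_le_add ?_ ?_)
  · rw [abs_div, abs_of_pos hφ]; gcongr
  · rw [abs_div, abs_of_pos hq0]; gcongr

lemma tendsto_card_coprime_floor {N i : ℕ} (hi : i < N) :
    Tendsto (fun q : ℕ => (((Finset.Icc 1 q).filter fun a : ℕ =>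
      Nat.Coprime a q ∧ ⌊(N : ℝ) * ((a : ℝ) / q)⌋₊ = i).card : ℝ) / q.totient)
      atTop (𝓝 (1 / N)) := by
  classical
  have hN : (0 : ℝ) < N := by exact_mod_cast (by omega : 0 < N)
  have h1 := tendsto_card_coprime_lt (t := ((i + 1 : ℕ) : ℝ) / N) (by positivity)
    (div_le_one_of_le₀ (by exact_mod_cast hi) hN.le)
  have h2 := tendsto_card_coprime_lt (t := (i : ℝ) / N) (by positivity)
    (div_le_one_of_le₀ (by exact_mod_cast hi.le) hN.le)
  have h3 := h1.sub h2
  rw [show ((i + 1 : ℕ) : ℝ) / N - (i : ℝ) / N = 1 / N by push_cast; ring] at h3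
  refine h3.congr fun q => ?_
  rw [← sub_div]
  congr 1
  have hsub : ((Finset.Icc 1 q).filter fun a : ℕ => Nat.Coprime a q ∧ (a : ℝ) / q < (i : ℝ) / N) ⊆
      (Finset.Icc 1 q).filter fun a : ℕ => Nat.Coprime a q ∧ (a : ℝ) / q < ((i + 1 : ℕ) : ℝ) / N := by
    intro a ha
    rw [Finset.mem_filter] at ha ⊢
    refine ⟨ha.1, ha.2.1, ha.2.2.trans_le ?_⟩
    gcongr; omega
  rw [← Nat.cast_sub (Finset.card_le_card hsub), ← Finset.card_sdiff_of_subset hsub]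
  congr 2
  ext a
  have h0 : 0 ≤ (N : ℝ) * ((a : ℝ) / q) := by positivity
  have e : ⌊(N : ℝ) * ((a : ℝ) / q)⌋₊ = i ↔ (i : ℝ) ≤ (a : ℝ) / q * N ∧ (a : ℝ) / q * N < i + 1 := by
    rw [Nat.floor_eq_iff h0, mul_comm (N : ℝ)]
  simp only [Finset.mem_filter, Finset.mem_sdiff, e, lt_div_iff₀ hN]
  push_cast
  constructor
  · rintro ⟨⟨h1, h2, h3⟩, h4⟩
    exact ⟨h1, h2, not_lt.1 fun h => h4 ⟨h1, h2, h⟩, h3⟩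
  · rintro ⟨h1, h2, h3, h4⟩
    exact ⟨⟨h1, h2, h4⟩, fun h => absurd h.2.2 (not_lt.2 h3)⟩

/-- The supremum of `g` over the interval `[i / N, (i + 1) / N)`. -/
noncomputable def cellSup (g : ℝ → ℝ) (N i : ℕ) : ℝ :=
  sSup (g '' {y | 0 ≤ y ∧ ⌊(N : ℝ) * y⌋₊ = i})

section
variable {g : ℝ → ℝ} {K : ℝ}

lemma le_cellSup (hK : ∀ x, |g x| ≤ K) (N : ℕ) {x : ℝ} (hx : 0 ≤ x) :
    g x ≤ cellSup g N ⌊(N : ℝ) * x⌋₊ :=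
  le_csSup ⟨K, by rintro _ ⟨y, -, rfl⟩; exact (le_abs_self _).trans (hK y)⟩ ⟨x, ⟨hx, rfl⟩, rfl⟩

lemma abs_cellSup_le (hK : ∀ x, |g x| ≤ K) (N i : ℕ) : |cellSup g N i| ≤ K := by
  have hK0 : 0 ≤ K := (abs_nonneg _).trans (hK 0)
  rcases (g '' {y | 0 ≤ y ∧ ⌊(N : ℝ) * y⌋₊ = i}).eq_empty_or_nonempty with h | h
  · rw [cellSup, h]; simpa using hK0
  rw [abs_le]
  obtain ⟨_, y, hy, rfl⟩ := h
  refine ⟨?_, csSup_le ⟨_, y, hy, rfl⟩ ?_⟩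
  · have := le_cellSup hK N hy.1
    rw [hy.2] at this
    linarith [(abs_le.1 (hK y)).1]
  · rintro _ ⟨z, -, rfl⟩
    exact (le_abs_self _).trans (hK z)

lemma tendsto_cellSup (hK : ∀ x, |g x| ≤ K) {x : ℝ} (hx : 0 ≤ x) (hc : ContinuousAt g x) :
    Tendsto (fun N : ℕ => cellSup g N ⌊(N : ℝ) * x⌋₊) atTop (𝓝 (g x)) := by
  rw [Metric.tendsto_nhds]
  intro η hη
  obtain ⟨δ, hδ, h⟩ := Metric.continuousAt_iff.1 hc (η / 2) (by positivity)
  filter_upwards [tendsto_natCast_atTop_atTop.eventually_gt_atTop (1 / δ),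
    eventually_gt_atTop 0] with N hN hN0
  have hN0' : (0 : ℝ) < N := by exact_mod_cast hN0
  have h1 := le_cellSup hK N hx
  have h2 : cellSup g N ⌊(N : ℝ) * x⌋₊ ≤ g x + η / 2 := by
    refine csSup_le ⟨_, x, ⟨hx, rfl⟩, rfl⟩ ?_
    rintro _ ⟨y, ⟨hy0, hy⟩, rfl⟩
    have hd : dist y x < δ := by
      have a1 := Nat.floor_le (a := (N : ℝ) * x) (by positivity)
      have a2 := Nat.lt_floor_add_one ((N : ℝ) * x)
      have a3 := Nat.floor_le (a := (N : ℝ) * y) (by positivity)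
      have a4 := Nat.lt_floor_add_one ((N : ℝ) * y)
      rw [hy] at a3 a4
      rw [div_lt_iff₀ hδ] at hN
      rw [Real.dist_eq, abs_lt]
      constructor <;> nlinarith
    have := h hd
    rw [Real.dist_eq] at this
    linarith [(abs_lt.1 this).2]
  rw [Real.dist_eq, abs_lt]
  constructor <;> linarith

lemma measurable_cellSup (g : ℝ → ℝ) (N : ℕ) :
    Measurable fun x : ℝ => cellSup g N ⌊(N : ℝ) * x⌋₊ :=
  (measurable_from_nat (f := cellSup g N)).comp (Nat.measurable_floor.comp (measurable_const_mul _))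

lemma integral_cellSup (hK : ∀ x, |g x| ≤ K) {N : ℕ} (hN : 0 < N) :
    ∫ x in (0 : ℝ)..1, cellSup g N ⌊(N : ℝ) * x⌋₊ = ∑ i ∈ Finset.range N, cellSup g N i * (1 / N) := by
  have hN' : (0 : ℝ) < N := by exact_mod_cast hN
  have hint : ∀ a b : ℝ, IntervalIntegrable (fun x => cellSup g N ⌊(N : ℝ) * x⌋₊) volume a b :=
    fun a b => ⟨Measure.integrableOn_of_bounded (M := K) (by simp)
        (measurable_cellSup g N).aestronglyMeasurable (Eventually.of_forall fun x => abs_cellSup_le hK _ _),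
      Measure.integrableOn_of_bounded (M := K) (by simp)
        (measurable_cellSup g N).aestronglyMeasurable (Eventually.of_forall fun x => abs_cellSup_le hK _ _)⟩
  have h1 := intervalIntegral.sum_integral_adjacent_intervals (μ := volume)
    (f := fun x => cellSup g N ⌊(N : ℝ) * x⌋₊) (a := fun i : ℕ => (i : ℝ) / N) (n := N)
    fun k _ => hint _ _
  simp only [Nat.cast_zero, zero_div, div_self hN'.ne'] at h1
  rw [← h1]
  refine Finset.sum_congr rfl fun i _ => ?_
  have hle : (i : ℝ) / N ≤ ((i + 1 : ℕ) : ℝ) / N := by gcongr; omega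
  have h2 : ∫ x in (i : ℝ) / N..((i + 1 : ℕ) : ℝ) / N, cellSup g N ⌊(N : ℝ) * x⌋₊ =
      ∫ x in (i : ℝ) / N..((i + 1 : ℕ) : ℝ) / N, cellSup g N i := by
    rw [intervalIntegral.integral_of_le hle, intervalIntegral.integral_of_le hle,
      integral_Ioc_eq_integral_Ioo, integral_Ioc_eq_integral_Ioo]
    refine setIntegral_congr_fun measurableSet_Ioo fun x hx => ?_
    have : ⌊(N : ℝ) * x⌋₊ = i := by
      have h3 := (div_lt_iff₀ hN').1 hx.1
      have h4 := (lt_div_iff₀ hN').1 hx.2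
      push_cast at h4
      rw [Nat.floor_eq_iff (by nlinarith [Nat.cast_nonneg (α := ℝ) i])]
      constructor <;> linarith
    simp only [this]
  rw [h2, intervalIntegral.integral_const, smul_eq_mul]
  push_cast
  ring

lemma coprimeAverage_le (hK : ∀ x, |g x| ≤ K) {N q : ℕ} (hN : 0 < N) (hq : 2 ≤ q) :
    coprimeAverage g q ≤ ∑ i ∈ Finset.range N, cellSup g N i *
      ((((Finset.Icc 1 q).filter fun a : ℕ =>
        Nat.Coprime a q ∧ ⌊(N : ℝ) * ((a : ℝ) / q)⌋₊ = i).card : ℝ) / q.totient) := by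
  have hN' : (0 : ℝ) < N := by exact_mod_cast hN
  have hq0 : (0 : ℝ) < q := by positivity
  rw [Finset.sum_congr rfl fun i _ => (mul_div_assoc (cellSup g N i) _ (q.totient : ℝ)).symm,
    coprimeAverage, ← Finset.sum_div]
  refine div_le_div_of_nonneg_right ?_ (Nat.cast_nonneg _)
  calc _ ≤ ∑ a ∈ (Finset.Icc 1 q).filter (fun a => Nat.Coprime a q),
        cellSup g N ⌊(N : ℝ) * ((a : ℝ) / q)⌋₊ :=
        Finset.sum_le_sum fun a _ => le_cellSup hK N (by positivity)
    _ = ∑ i ∈ Finset.range N, ∑ a ∈ ((Finset.Icc 1 q).filter (fun a => Nat.Coprime a q)).filter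
          (fun a : ℕ => ⌊(N : ℝ) * ((a : ℝ) / q)⌋₊ = i),
        cellSup g N ⌊(N : ℝ) * ((a : ℝ) / q)⌋₊ := by
        refine (Finset.sum_fiberwise_of_maps_to (fun a ha => ?_) _).symm
        rw [Finset.mem_filter, Finset.mem_Icc] at ha
        rw [Finset.mem_range, Nat.floor_lt (by positivity)]
        -- The fraction `1` would fall in cell `N`, outside the range; for `q ≥ 2` it is not in the
        -- sum, since `q` is not coprime to itself.
        have : a ≠ q := by
          rintro rfl
          have := (Nat.coprime_self a).1 ha.2
          omega
        have h1 : (a : ℝ) < q := by exact_mod_cast (by omega : a < q)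
        exact mul_lt_of_lt_one_right hN' ((div_lt_one hq0).2 h1)
    _ = _ := by
        refine Finset.sum_congr rfl fun i _ => ?_
        rw [Finset.filter_filter, Finset.sum_congr rfl (g := fun _ => cellSup g N i)
          (fun a ha => by rw [(Finset.mem_filter.1 ha).2.2]), Finset.sum_const, nsmul_eq_mul, mul_comm]

/-- An upper Riemann sum argument: the cell suprema dominate `g`, their averages converge by
counting fractions in cells, and refining the cells recovers the integral by dominated convergence
and continuity almost everywhere. The lower bound follows by applying this to `-g`. -/
lemma eventually_coprimeAverage_le (hK : ∀ x, |g x| ≤ K)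
    (hc : ∀ᵐ x ∂volume.restrict (Set.Icc (0 : ℝ) 1), ContinuousAt g x) {η : ℝ} (hη : 0 < η) :
    ∀ᶠ q in atTop, coprimeAverage g q ≤ (∫ x in (0 : ℝ)..1, g x) + η := by
  rw [ae_restrict_iff' measurableSet_Icc] at hc
  have h1 : Tendsto (fun N : ℕ => ∫ x in (0 : ℝ)..1, cellSup g N ⌊(N : ℝ) * x⌋₊) atTop
      (𝓝 (∫ x in (0 : ℝ)..1, g x)) := by
    refine intervalIntegral.tendsto_integral_filter_of_dominated_convergence (fun _ => K)
      (Eventually.of_forall fun N => (measurable_cellSup g N).aestronglyMeasurable)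
      (Eventually.of_forall fun N => Eventually.of_forall fun x _ => abs_cellSup_le hK _ _)
      intervalIntegrable_const ?_
    filter_upwards [hc] with x hx hx'
    rw [Set.uIoc_of_le zero_le_one] at hx'
    exact tendsto_cellSup hK hx'.1.le (hx ⟨hx'.1.le, hx'.2⟩)
  obtain ⟨N, hN, hN0⟩ := ((h1.eventually_lt_const
    (u := (∫ x in (0 : ℝ)..1, g x) + η / 2) (by linarith)).and (eventually_gt_atTop 0)).exists
  rw [integral_cellSup hK hN0] at hN
  have h2 := tendsto_finsetSum (Finset.range N) fun i hi =>
    (tendsto_card_coprime_floor (Finset.mem_range.1 hi)).const_mul (cellSup g N i)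
  filter_upwards [h2.eventually_lt_const (u := (∫ x in (0 : ℝ)..1, g x) + η) (by linarith),
    eventually_ge_atTop 2] with q hq hq2
  exact (coprimeAverage_le hK hN0 hq2).trans hq.le

end

lemma coprimeAverage_neg (g : ℝ → ℝ) (q : ℕ) :
    coprimeAverage (fun x => -g x) q = -coprimeAverage g q := by
  simp [coprimeAverage, neg_div]

/-- Reduced fractions equidistribute, tested against bounded a.e. continuous functions. -/
theorem tendsto_coprimeAverage {g : ℝ → ℝ} {K : ℝ} (hK : ∀ x, |g x| ≤ K)
    (hc : ∀ᵐ x ∂volume.restrict (Set.Icc (0 : ℝ) 1), ContinuousAt g x) :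
    Tendsto (coprimeAverage g) atTop (𝓝 (∫ x in Set.Icc (0 : ℝ) 1, g x)) := by
  rw [integral_Icc_eq_integral_Ioc, ← intervalIntegral.integral_of_le zero_le_one,
    Metric.tendsto_nhds]
  intro η hη
  filter_upwards [eventually_coprimeAverage_le hK hc (half_pos hη),
    eventually_coprimeAverage_le (g := fun x => -g x) (by simpa using hK)
      (hc.mono fun x hx => hx.neg) (half_pos hη)] with q h1 h2
  rw [coprimeAverage_neg, intervalIntegral.integral_neg] at h2
  rw [Real.dist_eq, abs_lt]
  constructor <;> linarith

/-! ### The series along the Gauss orbit and its convergence at tame points. -/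

/-- The `j`-th term of the series attached to a family `ψ` along the orbit of the Gauss map. -/
noncomputable def gaussTerm (k : ℂ) (ψ : ℕ → ℝ → ℂ) (x : ℝ) (j : ℕ) : ℂ :=
  ((gaussProd x j : ℝ) : ℂ) ^ (-k) * ψ j (gaussMap^[j] x)

/-- The partial sums of the series attached to a family `ψ`. -/
noncomputable def gaussPartial (k : ℂ) (ψ : ℕ → ℝ → ℂ) (J : ℕ) (x : ℝ) : ℂ :=
  ∑ j ∈ Finset.range J, gaussTerm k ψ x j

/-- The sum of the series attached to a family `ψ`. -/
noncomputable def gaussSeries (k : ℂ) (ψ : ℕ → ℝ → ℂ) (x : ℝ) : ℂ := ∑' j, gaussTerm k ψ x j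

/-- A family of functions on `[0, 1]`, continuous on `(0, 1)`, of growth at most
`exp (y⁻¹ ^ θ)` at `0`. -/
structure ModerateFamily (θ C : ℝ) (ψ : ℕ → ℝ → ℂ) : Prop where
  bound : ∀ j y, 0 < y → y ≤ 1 → ‖ψ j y‖ ≤ C * Real.exp (y⁻¹ ^ θ)
  bound_zero : ∀ j, ‖ψ j 0‖ ≤ C
  continuousOn : ∀ j, ContinuousOn (ψ j) (Set.Ioo 0 1)
  measurable : ∀ j, Measurable (ψ j)

/-- The thresholds adapted to the weight `k` and the growth exponent `θ`. -/
noncomputable def weightGrowth (k : ℂ) (θ : ℝ) : ℕ → ℝ :=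
  growth (-k.re * Real.log 2 / 2) (1 / θ)

lemma norm_ofReal_cpow_neg {k : ℂ} (hk : k.re < 0) {β : ℝ} (hβ : 0 ≤ β) :
    ‖(β : ℂ) ^ (-k)‖ = β ^ (-k.re) := by
  have hk0 : k ≠ 0 := by rintro rfl; simp at hk
  rcases hβ.eq_or_lt with h | h
  · rw [← h, Complex.ofReal_zero, Complex.zero_cpow (neg_ne_zero.2 hk0),
      Real.zero_rpow (by linarith)]
    simp
  · rw [Complex.norm_cpow_eq_rpow_re_of_pos h, Complex.neg_re]

section
variable {k : ℂ} {θ C : ℝ} {ψ : ℕ → ℝ → ℂ}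

/-- Half of the weight `β_j^σ` is spent on absorbing the size of `ψ` at `T^j x`; the other half
survives as decay. If `β_j` is about `2^(-m)`, tameness gives `T^j x ≥ 1/M_m`, and the thresholds
are such that `exp(M_m^θ)` is `e · 2^(mσ/2)`. -/
lemma norm_gaussTerm_le_rpow (hk : k.re < 0) (hθ0 : 0 < θ) (hψ : ModerateFamily θ C ψ)
    {x : ℝ} (hx : x ∈ Set.Icc (0 : ℝ) 1) {m₁ j : ℕ} (ht : Tame (weightGrowth k θ) m₁ x)
    (hj : 2 * m₁ ≤ j) :
    ‖gaussTerm k ψ x j‖ ≤ C * Real.exp 1 * gaussProd x j ^ (-k.re / 2) := by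
  set σ := -k.re with hσ
  have hσ0 : 0 < σ := by simp only [hσ]; linarith
  set β := gaussProd x j with hβdef
  have hβ0 : 0 ≤ β := gaussProd_nonneg hx j
  have hβ1 : β ≤ 1 := gaussProd_le_one hx j
  have hC : 0 ≤ C := (norm_nonneg _).trans (hψ.bound_zero 0)
  set y := gaussMap^[j] x
  have hy : y ∈ Set.Icc (0 : ℝ) 1 := iterate_gaussMap_mem hx j
  have hterm : ‖gaussTerm k ψ x j‖ = β ^ σ * ‖ψ j y‖ := by
    rw [gaussTerm, norm_mul, norm_ofReal_cpow_neg hk hβ0]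
  have hsplit : β ^ σ = β ^ (σ / 2) * β ^ (σ / 2) := by
    rw [← Real.rpow_add_of_nonneg hβ0 (by positivity) (by positivity)]; congr 1; ring
  have hhalf1 : β ^ (σ / 2) ≤ 1 := Real.rpow_le_one hβ0 hβ1 (by positivity)
  have hhalf0 : 0 ≤ β ^ (σ / 2) := by positivity
  suffices h : β ^ (σ / 2) * ‖ψ j y‖ ≤ C * Real.exp 1 by
    rw [hterm, hsplit, mul_assoc, mul_comm (C * Real.exp 1)]
    exact mul_le_mul_of_nonneg_left h hhalf0
  have he : (1 : ℝ) ≤ Real.exp 1 := Real.one_le_exp zero_le_one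
  rcases hβ0.eq_or_lt with hβ | hβ
  · rw [← hβ, Real.zero_rpow (by positivity), zero_mul]; positivity
  rcases hy.1.eq_or_lt with hy0 | hy0
  · rw [← hy0]
    calc β ^ (σ / 2) * ‖ψ j 0‖ ≤ 1 * C :=
          mul_le_mul hhalf1 (hψ.bound_zero j) (norm_nonneg _) zero_le_one
      _ ≤ _ := by nlinarith
  -- `m` is the dyadic scale of `β_j`. From `β_j ≤ 2^(-⌊j/2⌋)` and `j ≥ 2 m₁` follows `m ≥ m₁`, so
  -- tameness applies at this scale.
  obtain ⟨m, hm1, hm2⟩ := exists_nat_pow_near_of_lt_one hβ hβ1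
    (by norm_num : (0 : ℝ) < 1 / 2) (by norm_num)
  have hmm : m₁ ≤ m := by
    have h1 := hm1.trans_le (gaussProd_le hx j)
    have h2 : j / 2 < m + 1 := by
      by_contra h
      exact absurd (pow_le_pow_of_le_one (by norm_num : (0 : ℝ) ≤ 1 / 2) (by norm_num)
        (not_lt.1 h)) (not_le.2 h1)
    omega
  -- The continuant satisfies `b ≤ 1/β_j < 2^(m+1)`, so it is an admissible denominator, and its
  -- approximation error is `β_j · T^j x`.
  obtain ⟨b, b', c, hb1, hb'0, -, hbc, hsum⟩ := exists_int_gaussProd hx j hβ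
  have hβ' : gaussProd x (j + 1) = β * y := gaussProd_succ x j
  have hpos : 0 < gaussProd x (j + 1) := by rw [hβ']; positivity
  have hbβ : (b : ℝ) * β ≤ 1 := by
    have : (0 : ℝ) ≤ b' * gaussProd x (j + 1) := mul_nonneg (by exact_mod_cast hb'0) hpos.le
    linarith
  have hb1' : (1 : ℝ) ≤ b := by exact_mod_cast hb1
  have h2m : (0 : ℝ) < 2 ^ m := by positivity
  have hb2 : (b : ℝ) ≤ 2 ^ (m + 1) := by
    have h3 : (b : ℝ) * (1 / 2) ^ (m + 1) ≤ 1 :=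
      (mul_le_mul_of_nonneg_left hm1.le (by linarith)).trans hbβ
    rw [one_div, inv_pow, ← div_eq_mul_inv, div_le_one (by positivity)] at h3
    exact h3
  have hbn : ((b.toNat : ℕ) : ℝ) = b := by exact_mod_cast Int.toNat_of_nonneg (by omega)
  have hlt := ht m hmm b.toNat (by omega) (by rw [← Nat.cast_le (α := ℝ), hbn]; exact_mod_cast hb2) c
    (by rw [hbn]; intro h; rw [h, sub_self, abs_zero] at hbc; exact hpos.ne' hbc)
  rw [hbn, ← hbc, hβ'] at hlt
  set M := weightGrowth k θ m with hMdef
  have hc0 : 0 ≤ σ * Real.log 2 / 2 * m := by have := Real.log_pos one_lt_two; positivity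
  have hM0 : 0 < M := Real.rpow_pos_of_pos (by linarith) _
  have hyM : y⁻¹ ≤ M := by
    have h4 : 1 / (2 ^ m * M) < (1 / 2) ^ m * y := hlt.trans_le (by gcongr)
    rw [one_div_pow, div_lt_iff₀ (by positivity)] at h4
    have h5 : 1 / 2 ^ m * y * (2 ^ m * M) = y * M := by field_simp
    rw [h5] at h4
    rw [inv_le_iff_one_le_mul₀' hy0]
    exact h4.le
  -- The exponent `1/θ` in `weightGrowth` makes `M_m^θ` affine in `m`; its slope `σ log 2 / 2` makes
  -- the exponential `2^(mσ/2)`.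
  have hexp : y⁻¹ ^ θ ≤ 1 + σ * Real.log 2 / 2 * m := by
    calc y⁻¹ ^ θ ≤ M ^ θ := Real.rpow_le_rpow (by positivity) hyM hθ0.le
      _ = _ := by
        rw [hMdef, weightGrowth, growth, ← Real.rpow_mul (by linarith),
          one_div_mul_cancel hθ0.ne', Real.rpow_one]
  have hfin : β ^ (σ / 2) * Real.exp (σ * Real.log 2 / 2 * m) ≤ 1 := by
    have h6 : Real.exp (σ * Real.log 2 / 2 * m) = (2 ^ m : ℝ) ^ (σ / 2) := by
      rw [Real.rpow_def_of_pos h2m, Real.log_pow]; congr 1; ring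
    rw [h6, ← Real.mul_rpow hβ0 h2m.le]
    refine Real.rpow_le_one (by positivity) ?_ (by positivity)
    rw [one_div_pow] at hm2
    exact (le_div_iff₀ h2m).1 hm2
  calc β ^ (σ / 2) * ‖ψ j y‖ ≤ β ^ (σ / 2) * (C * Real.exp (y⁻¹ ^ θ)) :=
        mul_le_mul_of_nonneg_left (hψ.bound j y hy0 hy.2) hhalf0
    _ ≤ β ^ (σ / 2) * (C * Real.exp (1 + σ * Real.log 2 / 2 * m)) := by gcongr
    _ = C * Real.exp 1 * (β ^ (σ / 2) * Real.exp (σ * Real.log 2 / 2 * m)) := by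
        rw [Real.exp_add]; ring
    _ ≤ C * Real.exp 1 * 1 := by gcongr
    _ = _ := mul_one _

/-- The ratio of the geometric series dominating the terms at tame points. -/
noncomputable def weightRatio (k : ℂ) : ℝ := (1 / 2) ^ (-k.re / 4)

lemma weightRatio_pos (k : ℂ) : 0 < weightRatio k := by unfold weightRatio; positivity

lemma weightRatio_lt_one (hk : k.re < 0) : weightRatio k < 1 :=
  Real.rpow_lt_one (by norm_num) (by norm_num) (by linarith)

lemma gaussProd_rpow_le (hk : k.re < 0) {x : ℝ} (hx : x ∈ Set.Icc (0 : ℝ) 1) (j : ℕ) :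
    gaussProd x j ^ (-k.re / 2) ≤ (weightRatio k)⁻¹ * weightRatio k ^ j := by
  have h0 := weightRatio_pos k
  have h1 : ((1 / 2 : ℝ) ^ (j / 2)) ^ (-k.re / 2) = weightRatio k ^ (2 * (j / 2)) := by
    rw [weightRatio, ← Real.rpow_natCast, ← Real.rpow_natCast, ← Real.rpow_mul (by norm_num),
      ← Real.rpow_mul (by norm_num)]
    congr 1; push_cast; ring
  calc _ ≤ ((1 / 2 : ℝ) ^ (j / 2)) ^ (-k.re / 2) :=
        Real.rpow_le_rpow (gaussProd_nonneg hx j) (gaussProd_le hx j) (by linarith)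
    _ = weightRatio k ^ (2 * (j / 2)) := h1
    _ ≤ _ := by
      -- The factor `(weightRatio k)⁻¹` compensates for the rounding in `2 ⌊j/2⌋ ≥ j - 1`.
      rw [inv_mul_eq_div, le_div_iff₀ h0, ← pow_succ]
      exact pow_le_pow_of_le_one h0.le (weightRatio_lt_one hk).le (by omega)

lemma norm_gaussTerm_le (hk : k.re < 0) (hθ0 : 0 < θ) (hψ : ModerateFamily θ C ψ)
    {x : ℝ} (hx : x ∈ Set.Icc (0 : ℝ) 1) {m₁ j : ℕ} (ht : Tame (weightGrowth k θ) m₁ x)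
    (hj : 2 * m₁ ≤ j) :
    ‖gaussTerm k ψ x j‖ ≤ C * Real.exp 1 * (weightRatio k)⁻¹ * weightRatio k ^ j := by
  have hC : 0 ≤ C := (norm_nonneg _).trans (hψ.bound_zero 0)
  refine (norm_gaussTerm_le_rpow hk hθ0 hψ hx ht hj).trans ?_
  rw [mul_assoc (C * Real.exp 1)]
  exact mul_le_mul_of_nonneg_left (gaussProd_rpow_le hk hx j) (by positivity)

lemma summable_gaussTerm (hk : k.re < 0) (hθ0 : 0 < θ) (hψ : ModerateFamily θ C ψ)
    {x : ℝ} (hx : x ∈ Set.Icc (0 : ℝ) 1) {m₁ : ℕ} (ht : Tame (weightGrowth k θ) m₁ x) :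
    Summable (gaussTerm k ψ x) := by
  refine Summable.of_norm_bounded_eventually_nat ((summable_geometric_of_lt_one
    (weightRatio_pos k).le (weightRatio_lt_one hk)).mul_left
      (C * Real.exp 1 * (weightRatio k)⁻¹)) ?_
  filter_upwards [eventually_ge_atTop (2 * m₁)] with j hj
  exact norm_gaussTerm_le hk hθ0 hψ hx ht hj

lemma norm_gaussSeries_sub_le (hk : k.re < 0) (hθ0 : 0 < θ) (hψ : ModerateFamily θ C ψ)
    {x : ℝ} (hx : x ∈ Set.Icc (0 : ℝ) 1) {m₁ J : ℕ} (ht : Tame (weightGrowth k θ) m₁ x)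
    (hJ : 2 * m₁ ≤ J) :
    ‖gaussSeries k ψ x - gaussPartial k ψ J x‖ ≤
      C * Real.exp 1 * (weightRatio k)⁻¹ * (1 - weightRatio k)⁻¹ * weightRatio k ^ J := by
  have hs := summable_gaussTerm hk hθ0 hψ hx ht
  rw [gaussSeries, gaussPartial, ← hs.sum_add_tsum_nat_add J, add_sub_cancel_left]
  have hg := (hasSum_geometric_of_lt_one (weightRatio_pos k).le (weightRatio_lt_one hk)).mul_left
    (C * Real.exp 1 * (weightRatio k)⁻¹ * weightRatio k ^ J)
  refine (tsum_of_norm_bounded hg fun j => ?_).trans (le_of_eq (by ring))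
  refine (norm_gaussTerm_le hk hθ0 hψ hx ht (by omega)).trans (le_of_eq ?_)
  rw [pow_add]; ring

lemma measurable_gaussPartial (hψ : ModerateFamily θ C ψ) (J : ℕ) :
    Measurable (gaussPartial k ψ J) :=
  Finset.measurable_sum _ fun j _ =>
    ((Complex.measurable_ofReal.comp (measurable_gaussProd j)).pow_const _).mul
      ((hψ.measurable j).comp (measurable_iterate_gaussMap j))

lemma gaussProd_pos {x : ℝ} (hx : Irrational x) (h0 : 0 < x) (n : ℕ) : 0 < gaussProd x n :=
  Finset.prod_pos fun i _ => by
    cases i with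
    | zero => exact h0
    | succ i =>
      refine lt_of_le_of_ne ?_ (irrational_iterate_gaussMap hx _).ne_zero.symm
      rw [Function.iterate_succ_apply']
      exact gaussMap_nonneg _

lemma iterate_gaussMap_mem_Ioo {x : ℝ} (hx : Irrational x) (h : x ∈ Set.Icc (0 : ℝ) 1) (n : ℕ) :
    gaussMap^[n] x ∈ Set.Ioo (0 : ℝ) 1 := by
  have h1 := iterate_gaussMap_mem h n
  have h2 := irrational_iterate_gaussMap hx n
  exact ⟨h1.1.lt_of_ne h2.ne_zero.symm, h1.2.lt_of_ne h2.ne_one⟩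

/-- The orbit of an irrational avoids the discontinuities of the Gauss map and stays in the open
interval where `ψ` is continuous. -/
lemma continuousAt_gaussTerm (hψ : ModerateFamily θ C ψ) {x : ℝ} (hx : Irrational x)
    (h : x ∈ Set.Icc (0 : ℝ) 1) (j : ℕ) : ContinuousAt (fun y => gaussTerm k ψ y j) x := by
  have h1 := iterate_gaussMap_mem_Ioo hx h j
  have h2 : 0 < gaussProd x j :=
    gaussProd_pos hx (h.1.lt_of_ne hx.ne_zero.symm) j
  refine ContinuousAt.mul ?_ ?_
  · exact ContinuousAt.cpow
      (ContinuousAt.comp Complex.continuous_ofReal.continuousAt (continuousAt_gaussProd hx j))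
      continuousAt_const (Or.inl (by simpa using h2))
  · exact ContinuousAt.comp ((hψ.continuousOn j).continuousAt (Ioo_mem_nhds h1.1 h1.2))
      (continuousAt_iterate_gaussMap hx j)

lemma continuousAt_gaussPartial (hψ : ModerateFamily θ C ψ) {x : ℝ} (hx : Irrational x)
    (h : x ∈ Set.Icc (0 : ℝ) 1) (J : ℕ) : ContinuousAt (gaussPartial k ψ J) x :=
  tendsto_finsetSum _ fun j _ => continuousAt_gaussTerm hψ hx h j

lemma ae_irrational : ∀ᵐ x : ℝ, Irrational x := by
  rw [ae_iff]
  refine (Set.countable_range ((↑) : ℚ → ℝ)).measure_zero _ |> measure_mono_null ?_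
  intro x hx
  simpa [Irrational] using hx

lemma weight_constants (hk : k.re < 0) (hθ0 : 0 < θ) (hθ1 : θ < 1) :
    0 < -k.re * Real.log 2 / 2 ∧ 1 < 1 / θ := by
  refine ⟨?_, (one_lt_div hθ0).2 hθ1⟩
  have := mul_pos (neg_pos.2 hk) (Real.log_pos one_lt_two)
  linarith

lemma ae_tendsto_gaussPartial (hk : k.re < 0) (hθ0 : 0 < θ) (hθ1 : θ < 1)
    (hψ : ModerateFamily θ C ψ) :
    ∀ᵐ x ∂volume.restrict (Set.Icc (0 : ℝ) 1),
      Tendsto (fun J => gaussPartial k ψ J x) atTop (𝓝 (gaussSeries k ψ x)) := by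
  obtain ⟨hc, hκ⟩ := weight_constants hk hθ0 hθ1
  filter_upwards [ae_exists_tame hc hκ, ae_restrict_mem measurableSet_Icc] with x ⟨m₁, ht⟩ hx
  exact (summable_gaussTerm hk hθ0 hψ hx ht).hasSum.tendsto_sum_nat

lemma aemeasurable_gaussSeries (hk : k.re < 0) (hθ0 : 0 < θ) (hθ1 : θ < 1)
    (hψ : ModerateFamily θ C ψ) :
    AEMeasurable (gaussSeries k ψ) (volume.restrict (Set.Icc (0 : ℝ) 1)) :=
  aemeasurable_of_tendsto_metrizable_ae atTop
    (fun J => (measurable_gaussPartial hψ J).aemeasurable)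
    (ae_tendsto_gaussPartial hk hθ0 hθ1 hψ)

/-! ### Equidistribution of the values of the series at reduced fractions. -/

open Classical in
lemma abs_coprimeAverage_sub_le {g₁ g₂ : ℝ → ℝ} {K τ η : ℝ} {P : ℝ → Prop} {q : ℕ} (hq : 0 < q)
    (hK : 0 ≤ K) (hτ : 0 ≤ τ) (h1 : ∀ x, |g₁ x - g₂ x| ≤ K)
    (h2 : ∀ x ∈ Set.Icc (0 : ℝ) 1, P x → |g₁ x - g₂ x| ≤ τ)
    (h3 : (((Finset.Icc 1 q).filter fun a : ℕ => Nat.Coprime a q ∧ ¬ P ((a : ℝ) / q)).card : ℝ) ≤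
      η * q.totient) :
    |coprimeAverage g₁ q - coprimeAverage g₂ q| ≤ τ + K * η := by
  have hφ : (0 : ℝ) < q.totient := by exact_mod_cast Nat.totient_pos.2 hq
  have hq0 : (0 : ℝ) < q := by positivity
  rw [coprimeAverage, coprimeAverage, ← sub_div, ← Finset.sum_sub_distrib, abs_div, abs_of_pos hφ,
    div_le_iff₀ hφ]
  refine (Finset.abs_sum_le_sum_abs _ _).trans ?_
  calc _ ≤ ∑ a ∈ (Finset.Icc 1 q).filter (fun a => Nat.Coprime a q),
        (τ + if ¬ P ((a : ℝ) / q) then K else 0) := by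
        refine Finset.sum_le_sum fun a ha => ?_
        rw [Finset.mem_filter, Finset.mem_Icc] at ha
        split_ifs with hP
        · rw [add_zero]
          exact h2 _ ⟨by positivity, div_le_one_of_le₀ (by exact_mod_cast ha.1.2) hq0.le⟩ hP
        · linarith [h1 ((a : ℝ) / q)]
    _ = τ * q.totient + K * (((Finset.Icc 1 q).filter fun a : ℕ =>
          Nat.Coprime a q ∧ ¬ P ((a : ℝ) / q)).card : ℝ) := by
        rw [Finset.sum_add_distrib, Finset.sum_const, card_Icc_filter_coprime, ← Finset.sum_filter,
          Finset.filter_filter, Finset.sum_const, nsmul_eq_mul, nsmul_eq_mul]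
        ring
    _ ≤ τ * q.totient + K * (η * q.totient) := by gcongr
    _ = _ := by ring

/-- Truncate at `J` terms. The truncation is continuous almost everywhere, so its averages converge;
the tail is uniformly small at points tame from `m₁` on, and the Lipschitz bound transfers this to
`G`. Boundedness of `G` controls the remaining fractions, of proportion as small as desired. -/
lemma tendsto_coprimeAverage_gaussSeries (hk : k.re < 0) (hθ0 : 0 < θ) (hθ1 : θ < 1)
    (hψ : ModerateFamily θ C ψ) {G : ℂ → ℝ} {K : ℝ} {L : NNReal} (hK : ∀ z, |G z| ≤ K)
    (hL : LipschitzWith L G) :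
    Tendsto (coprimeAverage fun x => G (gaussSeries k ψ x)) atTop
      (𝓝 (∫ x in Set.Icc (0 : ℝ) 1, G (gaussSeries k ψ x))) := by
  obtain ⟨hc, hκ⟩ := weight_constants hk hθ0 hθ1
  have hK0 : 0 ≤ K := (abs_nonneg _).trans (hK 0)
  have hC : 0 ≤ C := (norm_nonneg _).trans (hψ.bound_zero 0)
  have hint : Tendsto (fun J => ∫ x in Set.Icc (0 : ℝ) 1, G (gaussPartial k ψ J x)) atTop
      (𝓝 (∫ x in Set.Icc (0 : ℝ) 1, G (gaussSeries k ψ x))) := by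
    refine tendsto_integral_of_dominated_convergence (fun _ => K)
      (fun J => (hL.continuous.measurable.comp (measurable_gaussPartial hψ J)).aestronglyMeasurable)
      (integrable_const _) (fun J => Eventually.of_forall fun x => hK _) ?_
    filter_upwards [ae_tendsto_gaussPartial hk hθ0 hθ1 hψ] with x hx
    exact (hL.continuous.tendsto _).comp hx
  rw [Metric.tendsto_nhds]
  intro η hη
  -- Two values of `G` differ by at most `2K`, so this proportion costs at most `η/4`. It must be
  -- fixed before `J`, which has to exceed `2 m₁`.
  obtain ⟨m₁, hm₁⟩ := exists_eventually_card_not_tame_le hc hκ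
    (η := η / (4 * (2 * K + 1))) (by positivity)
  set T := fun J : ℕ => (L : ℝ) *
    (C * Real.exp 1 * (weightRatio k)⁻¹ * (1 - weightRatio k)⁻¹ * weightRatio k ^ J)
  have hT : Tendsto T atTop (𝓝 0) := by
    have := ((tendsto_pow_atTop_nhds_zero_of_lt_one (weightRatio_pos k).le
      (weightRatio_lt_one hk)).const_mul
        (C * Real.exp 1 * (weightRatio k)⁻¹ * (1 - weightRatio k)⁻¹)).const_mul (L : ℝ)
    simpa using this
  obtain ⟨J, hJ1, hJ2, hJ3⟩ := ((hT.eventually_lt_const (u := η / 4) (by positivity)).and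
    ((Metric.tendsto_nhds.1 hint (η / 4) (by positivity)).and
      (eventually_ge_atTop (2 * m₁)))).exists
  have hav := tendsto_coprimeAverage (g := fun x => G (gaussPartial k ψ J x)) (K := K)
    (fun x => hK _) (by
      filter_upwards [ae_restrict_mem measurableSet_Icc, ae_restrict_of_ae ae_irrational] with x hx hi
      exact ContinuousAt.comp hL.continuous.continuousAt (continuousAt_gaussPartial hψ hi hx J))
  filter_upwards [hm₁, Metric.tendsto_nhds.1 hav (η / 4) (by positivity),
    eventually_gt_atTop 0] with q hq1 hq2 hq0
  have hdiff := abs_coprimeAverage_sub_le (g₁ := fun x => G (gaussSeries k ψ x))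
    (g₂ := fun x => G (gaussPartial k ψ J x)) (K := 2 * K) (τ := η / 4)
    (P := Tame (weightGrowth k θ) m₁) hq0 (by positivity) (by positivity)
    (fun x => by
      have a1 := abs_le.1 (hK (gaussSeries k ψ x))
      have a2 := abs_le.1 (hK (gaussPartial k ψ J x))
      rw [abs_le]; constructor <;> linarith)
    (fun x hx ht => by
      have a1 := hL.dist_le_mul (gaussSeries k ψ x) (gaussPartial k ψ J x)
      rw [Real.dist_eq, dist_eq_norm] at a1
      refine a1.trans ((mul_le_mul_of_nonneg_left
        (norm_gaussSeries_sub_le hk hθ0 hψ hx ht hJ3) L.2).trans hJ1.le))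
    (by exact hq1)
  have h5 : 2 * K * (η / (4 * (2 * K + 1))) ≤ η / 4 := by
    rw [mul_div_assoc', div_le_div_iff₀ (by positivity) (by positivity)]
    nlinarith
  rw [Real.dist_eq, abs_lt] at *
  rw [abs_le] at hdiff
  constructor <;> linarith [hdiff.1, hdiff.2, hJ2.1, hJ2.2, hq2.1, hq2.2]

end

/-! ### Identification of `f` with the series at rational points. -/

/-- The function `y ↦ h (s y)` on `(0, 1]`, with the value `f s` at `0`, and `0` elsewhere. -/
noncomputable def signedPeriod (f : ℚ → ℂ) (h : ℝ → ℂ) (s : ℤ) (y : ℝ) : ℂ :=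
  if y = 0 then f s else (Set.Ioc (0 : ℝ) 1).indicator (fun y => h (s * y)) y

/-- The family of functions with alternating signs along the orbit of the Gauss map. -/
noncomputable def periodFamily (f : ℚ → ℂ) (h : ℝ → ℂ) (s : ℤ) (j : ℕ) : ℝ → ℂ :=
  signedPeriod f h ((-1) ^ j * s)

lemma signedPeriod_zero (f : ℚ → ℂ) (h : ℝ → ℂ) (s : ℤ) : signedPeriod f h s 0 = f s := by
  simp [signedPeriod]

lemma signedPeriod_of_pos (f : ℚ → ℂ) (h : ℝ → ℂ) (s : ℤ) {y : ℝ} (h0 : 0 < y) (h1 : y ≤ 1) :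
    signedPeriod f h s y = h (s * y) := by
  rw [signedPeriod, if_neg h0.ne', Set.indicator_of_mem (Set.mem_Ioc.2 ⟨h0, h1⟩)]

lemma PeriodRegular.continuousOn {δ : ℝ} {h : ℝ → ℂ} (hreg : PeriodRegular δ h) :
    ContinuousOn h (Set.Icc (-1 : ℝ) 1 \ {0}) := by
  intro x hx
  rw [Metric.continuousWithinAt_iff]
  intro η hη
  have h0 : 0 < |x| := abs_pos.2 hx.2
  have h1 : ∀ᶠ ε : ℝ in 𝓝[>] 0, 2 * ε < |x| := by
    refine Filter.Eventually.filter_mono nhdsWithin_le_nhds ?_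
    filter_upwards [gt_mem_nhds (show (0 : ℝ) < |x| / 2 by positivity)] with ε hε
    linarith
  obtain ⟨ε, h2, h3⟩ := ((hreg.1 (η / 2) (by positivity)).and h1).exists
  refine ⟨Real.exp (-ε ^ (δ - 1)), Real.exp_pos _, fun y hy hyx => ?_⟩
  rw [dist_comm, Real.dist_eq] at hyx
  rw [dist_comm, dist_eq_norm]
  exact (h2 x hx y hy hyx h3).trans_lt (by linarith)

lemma sign_mul_mem {s : ℤ} (hs : s = 1 ∨ s = -1) {y : ℝ} (h0 : 0 < y) (h1 : y ≤ 1) :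
    (s : ℝ) * y ∈ Set.Icc (-1 : ℝ) 1 \ {0} ∧ |(s : ℝ) * y| = y := by
  rcases hs with rfl | rfl
  · refine ⟨⟨⟨by push_cast; linarith, by push_cast; linarith⟩, ?_⟩, ?_⟩
    · simpa using h0.ne'
    · simpa using h0.le
  · refine ⟨⟨⟨by push_cast; linarith, by push_cast; linarith⟩, ?_⟩, ?_⟩
    · simpa using h0.ne'
    · simpa using h0.le

lemma neg_one_pow_mul_sign {s : ℤ} (hs : s = 1 ∨ s = -1) (j : ℕ) :
    (-1) ^ j * s = 1 ∨ (-1) ^ j * s = -1 := by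
  rcases neg_one_pow_eq_or ℤ j with h | h <;> rcases hs with rfl | rfl <;> simp [h]

lemma continuousOn_signed {δ : ℝ} {h : ℝ → ℂ} (hreg : PeriodRegular δ h) {s : ℤ}
    (hs : s = 1 ∨ s = -1) : ContinuousOn (fun y : ℝ => h (s * y)) (Set.Ioc 0 1) :=
  hreg.continuousOn.comp (continuous_const_mul _).continuousOn fun _ hy =>
    (sign_mul_mem hs hy.1 hy.2).1

lemma exists_moderateFamily {δ : ℝ} (hδ : 0 < δ) (f : ℚ → ℂ) {h : ℝ → ℂ}
    (hreg : PeriodRegular δ h) :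
    ∃ θ C : ℝ, 0 < θ ∧ θ < 1 ∧ ∀ s : ℤ, (s = 1 ∨ s = -1) →
      ModerateFamily θ C (periodFamily f h s) := by
  obtain ⟨C, hC⟩ := hreg.2
  -- For `δ < 1` the natural exponent is `1 - δ`; for `δ ≥ 1` the function `h` is bounded and any
  -- exponent in `(0, 1)` will do.
  obtain ⟨θ, hθ0, hθ1, hθ⟩ : ∃ θ : ℝ, 0 < θ ∧ θ < 1 ∧
      ∀ y : ℝ, 0 < y → y ≤ 1 → y ^ (δ - 1) ≤ y⁻¹ ^ θ := by
    rcases lt_or_ge δ 1 with h1 | h1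
    · refine ⟨1 - δ, by linarith, by linarith, fun y hy _ => le_of_eq ?_⟩
      rw [Real.inv_rpow hy.le, ← Real.rpow_neg hy.le, neg_sub]
    · refine ⟨1 / 2, by norm_num, by norm_num, fun y hy hy1 => ?_⟩
      exact (Real.rpow_le_one hy.le hy1 (by linarith)).trans
        (Real.one_le_rpow ((one_le_inv₀ hy).2 hy1) (by norm_num))
  refine ⟨θ, |C| + ‖f 1‖ + ‖f (-1)‖, hθ0, hθ1, fun s hs => ⟨fun j y hy hy1 => ?_, fun j => ?_,
    fun j => ?_, fun j => ?_⟩⟩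
  · obtain ⟨h1, h2⟩ := sign_mul_mem (neg_one_pow_mul_sign hs j) hy hy1
    rw [periodFamily, signedPeriod_of_pos _ _ _ hy hy1]
    have h3 := hC _ h1
    rw [h2] at h3
    refine h3.trans ?_
    calc C * Real.exp (y ^ (δ - 1)) ≤ (|C| + ‖f 1‖ + ‖f (-1)‖) * Real.exp (y ^ (δ - 1)) := by
          refine mul_le_mul_of_nonneg_right ?_ (Real.exp_pos _).le
          linarith [le_abs_self C, norm_nonneg (f 1), norm_nonneg (f (-1))]
      _ ≤ _ := by gcongr; exact hθ y hy hy1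
  · rw [periodFamily, signedPeriod_zero]
    have a1 := abs_nonneg C
    have a2 := norm_nonneg (f 1)
    have a3 := norm_nonneg (f (-1))
    rcases neg_one_pow_mul_sign hs j with h | h <;> rw [h]
    · rw [Int.cast_one]; linarith
    · rw [Int.cast_neg, Int.cast_one]; linarith
  · refine ((continuousOn_signed hreg (neg_one_pow_mul_sign hs j)).mono
      Set.Ioo_subset_Ioc_self).congr fun y hy => ?_
    exact signedPeriod_of_pos _ _ _ hy.1 hy.2.le
  · refine Measurable.ite (measurableSet_singleton 0) measurable_const ?_
    rw [← Set.piecewise_eq_indicator]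
    exact (continuousOn_signed hreg (neg_one_pow_mul_sign hs j)).measurable_piecewise
      continuousOn_const measurableSet_Ioc

lemma periodFamily_succ (f : ℚ → ℂ) (h : ℝ → ℂ) (s : ℤ) (j : ℕ) :
    periodFamily f h s (j + 1) = periodFamily f h (-s) j := by
  rw [periodFamily, periodFamily]; congr 1; ring

lemma gaussTerm_succ {k : ℂ} (f : ℚ → ℂ) (h : ℝ → ℂ) (s : ℤ) {x : ℝ} (hx : 0 ≤ x) (j : ℕ) :
    gaussTerm k (periodFamily f h s) x (j + 1) =
      (x : ℂ) ^ (-k) * gaussTerm k (periodFamily f h (-s)) (gaussMap x) j := by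
  rw [gaussTerm, gaussTerm, gaussProd_succ', periodFamily_succ, Function.iterate_succ_apply,
    Complex.ofReal_mul, Complex.mul_cpow_ofReal_nonneg hx (gaussProd_nonneg (gaussMap_mem x) j),
    mul_assoc]

lemma gaussTerm_zero (k : ℂ) (f : ℚ → ℂ) (h : ℝ → ℂ) (s : ℤ) (x : ℝ) :
    gaussTerm k (periodFamily f h s) x 0 = signedPeriod f h s x := by
  simp [gaussTerm, gaussProd_zero, periodFamily]

lemma hasSum_gaussTerm_step {k : ℂ} {f : ℚ → ℂ} {h : ℝ → ℂ} {s : ℤ} {x : ℝ} (hx : 0 ≤ x) {S : ℂ}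
    (hS : HasSum (gaussTerm k (periodFamily f h (-s)) (gaussMap x)) S) :
    HasSum (gaussTerm k (periodFamily f h s) x) (signedPeriod f h s x + (x : ℂ) ^ (-k) * S) := by
  rw [← hasSum_nat_add_iff' 1]
  simp only [Finset.sum_range_one, gaussTerm_zero, add_sub_cancel_left, gaussTerm_succ f h s hx]
  exact hS.mul_left _

lemma hasSum_gaussTerm_zero {k : ℂ} (hk : k.re < 0) (f : ℚ → ℂ) (h : ℝ → ℂ) (s : ℤ) :
    HasSum (gaussTerm k (periodFamily f h s) 0) (f s) := by
  have hk0 : k ≠ 0 := by rintro rfl; simp at hk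
  have := hasSum_single (f := gaussTerm k (periodFamily f h s) 0) 0 fun j hj => by
    obtain ⟨j, rfl⟩ := Nat.exists_eq_succ_of_ne_zero hj
    rw [Nat.succ_eq_add_one, gaussTerm_succ f h s le_rfl, Complex.ofReal_zero,
      Complex.zero_cpow (neg_ne_zero.2 hk0), zero_mul]
  rwa [gaussTerm_zero, signedPeriod_zero] at this

lemma PeriodicOffZero.add_nat {f : ℚ → ℂ} (hper : PeriodicOffZero f) {s : ℤ}
    (hs : s = 1 ∨ s = -1) {r : ℚ} (hr : 0 < r) (n : ℕ) : f (s * (r + n)) = f (s * r) := by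
  induction n with
  | zero => simp
  | succ n ih =>
    rw [← ih]
    have hn : (0 : ℚ) ≤ n := Nat.cast_nonneg n
    rcases hs with rfl | rfl
    · have := hper (r + n) fun h => by linarith [h.2]
      push_cast
      rw [one_mul, one_mul, this]
      congr 1; ring
    · have := hper (-(r + n + 1)) fun h => by linarith [h.1]
      push_cast
      rw [show (-1 : ℚ) * (r + (n + 1)) = -(r + n + 1) by ring, this]
      congr 1; ring

/-- The reciprocity relation along one step of the Gauss map. -/
lemma reciprocity_step {k : ℂ} {f : ℚ → ℂ} {h : ℝ → ℂ} (hper : PeriodicOffZero f)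
    (hrec : SatisfiesReciprocity k f h) {s : ℤ} (hs : s = 1 ∨ s = -1) {r : ℚ} (h0 : 0 < r)
    (h1 : r ≤ 1) :
    f (s * r) = h (s * r) + ((r : ℝ) : ℂ) ^ (-k) *
      (if Int.fract r⁻¹ = 0 then f (-s : ℤ) else f ((-s : ℤ) * Int.fract r⁻¹)) := by
  have hs' : -s = 1 ∨ -s = -1 := by omega
  have hsr : (s : ℚ) * r ∈ Set.Icc (-1 : ℚ) 1 ∧ (s : ℚ) * r ≠ 0 ∧ |(s : ℚ) * r| = r ∧
      -1 / ((s : ℚ) * r) = (-s : ℤ) * r⁻¹ := by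
    rcases hs with rfl | rfl
    · refine ⟨⟨by push_cast; linarith, by push_cast; linarith⟩, ?_, ?_, ?_⟩
      · simpa using h0.ne'
      · simpa using h0.le
      · field_simp; push_cast; ring
    · refine ⟨⟨by push_cast; linarith, by push_cast; linarith⟩, ?_, ?_, ?_⟩
      · simpa using h0.ne'
      · simpa using h0.le
      · field_simp; push_cast; ring
  obtain ⟨a1, a2, a3, a4⟩ := hsr
  have h2 := hrec _ a1 a2
  rw [a3, a4, sub_eq_iff_eq_add] at h2
  rw [h2]
  push_cast
  congr 2
  have hfl : 1 ≤ ⌊r⁻¹⌋ := by rw [Int.le_floor]; push_cast; exact (one_le_inv₀ h0).2 h1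
  obtain ⟨n, hn⟩ : ∃ n : ℕ, ⌊r⁻¹⌋ = n + 1 := ⟨(⌊r⁻¹⌋ - 1).toNat, by omega⟩
  have hsplit : r⁻¹ = Int.fract r⁻¹ + (n + 1 : ℕ) := by
    have := Int.fract_add_floor r⁻¹
    rw [hn] at this
    push_cast at this ⊢
    linarith
  split_ifs with hf
  -- When `1/r` is an integer the shift starts from `1`, not from `0`: periodicity cannot be used
  -- across `[-1, 0]`.
  · rw [hf, zero_add] at hsplit
    rw [hsplit]
    have := hper.add_nat hs' one_pos n
    push_cast at this ⊢
    rw [add_comm (n : ℚ), this, mul_one]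
  · have hpos : 0 < Int.fract r⁻¹ := (Int.fract_nonneg _).lt_of_ne' hf
    have := hper.add_nat hs' hpos (n + 1)
    rw [← hsplit] at this
    push_cast at this
    exact this

/-- Induction along the Euclidean algorithm, since numerators decrease under the Gauss map. When the
orbit reaches `0` the series stops by itself: later products vanish, and `0^(-k) = 0`. -/
lemma hasSum_gaussTerm_rat {k : ℂ} (hk : k.re < 0) {f : ℚ → ℂ} {h : ℝ → ℂ}
    (hper : PeriodicOffZero f) (hrec : SatisfiesReciprocity k f h) {s : ℤ} (hs : s = 1 ∨ s = -1)
    {r : ℚ} (h0 : 0 ≤ r) (h1 : r ≤ 1) :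
    HasSum (gaussTerm k (periodFamily f h s) r) (if r = 0 then f s else f (s * r)) := by
  induction hn : r.num.natAbs using Nat.strong_induction_on generalizing r s with
  | _ n ih =>
    rcases h0.eq_or_lt with hr | hr
    · rw [if_pos hr.symm, ← hr, Rat.cast_zero]
      exact hasSum_gaussTerm_zero hk f h s
    have hcast : gaussMap (r : ℝ) = ((Int.fract r⁻¹ : ℚ) : ℝ) := by
      rw [gaussMap]; push_cast; rfl
    have hlt : (Int.fract r⁻¹).num.natAbs < n := by
      have h2 := Rat.fract_inv_num_lt_num_of_pos hr
      have h3 : 0 ≤ (Int.fract r⁻¹).num := Rat.num_nonneg.2 (Int.fract_nonneg _)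
      omega
    have h4 := ih _ hlt (s := -s) (by omega) (Int.fract_nonneg r⁻¹) (Int.fract_lt_one _).le rfl
    rw [← hcast] at h4
    have h5 := hasSum_gaussTerm_step (s := s) (by exact_mod_cast h0) h4
    rw [if_neg hr.ne', reciprocity_step hper hrec hs hr h1]
    rwa [signedPeriod_of_pos _ _ _ (by exact_mod_cast hr) (by exact_mod_cast h1)] at h5

lemma gaussSeries_rat {k : ℂ} (hk : k.re < 0) {f : ℚ → ℂ} {h : ℝ → ℂ}
    (hper : PeriodicOffZero f) (hrec : SatisfiesReciprocity k f h) {s : ℤ} (hs : s = 1 ∨ s = -1)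
    {r : ℚ} (h0 : 0 < r) (h1 : r ≤ 1) :
    gaussSeries k (periodFamily f h s) r = f (s * r) := by
  rw [gaussSeries, (hasSum_gaussTerm_rat hk hper hrec hs h0.le h1).tsum_eq, if_neg h0.ne']

/-! ### Weak convergence -/

/-- The normalized counting measure of the multiset `{f(a/q)}`. -/
noncomputable def reducedMeasure (f : ℚ → ℂ) (q : ℕ) : Measure ℂ :=
  ∑ a ∈ (Finset.Icc 1 q).filter (fun a => Nat.Coprime a q),
    ENNReal.ofReal (1 / q.totient) • Measure.dirac (f ((a : ℚ) / q))

lemma isProbabilityMeasure_reducedMeasure (f : ℚ → ℂ) {q : ℕ} (hq : 0 < q) :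
    IsProbabilityMeasure (reducedMeasure f q) := by
  have hφ : (0 : ℝ) < q.totient := by exact_mod_cast Nat.totient_pos.2 hq
  refine ⟨?_⟩
  simp only [reducedMeasure, Measure.coe_finsetSum, Finset.sum_apply, Measure.smul_apply,
    measure_univ, smul_eq_mul, mul_one, Finset.sum_const, card_Icc_filter_coprime, nsmul_eq_mul]
  rw [← ENNReal.ofReal_natCast, ← ENNReal.ofReal_mul hφ.le, mul_one_div_cancel hφ.ne',
    ENNReal.ofReal_one]

lemma integral_reducedMeasure (f : ℚ → ℂ) (q : ℕ) (G : ℂ → ℝ) :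
    ∫ z, G z ∂reducedMeasure f q = reducedAverage f G q := by
  rw [reducedMeasure, integral_finsetSum_measure]
  · simp_rw [integral_smul_measure, integral_dirac, ENNReal.toReal_ofReal
      (show (0 : ℝ) ≤ 1 / (q.totient : ℝ) by positivity), smul_eq_mul]
    rw [reducedAverage, ← Finset.mul_sum, one_div_mul_eq_div]
  · intro a _
    exact (integrable_dirac (by simp)).smul_measure (by simp)

/-- Weak convergence of probability measures can be tested on bounded Lipschitz functions. -/
lemma equidistribute_of_lipschitz {f : ℚ → ℂ} {μ : Measure ℂ} [IsProbabilityMeasure μ]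
    (h : ∀ (G : ℂ → ℝ) (K : ℝ) (L : NNReal), (∀ z, |G z| ≤ K) → LipschitzWith L G →
      Tendsto (fun q => reducedAverage f G q) atTop (𝓝 (∫ z, G z ∂μ))) :
    ReducedValuesEquidistribute f μ := by
  -- The index is shifted because the empty multiset at `q = 0` gives no probability measure.
  set μs : ℕ → ProbabilityMeasure ℂ := fun q =>
    ⟨reducedMeasure f (q + 1), isProbabilityMeasure_reducedMeasure f q.succ_pos⟩
  set μ' : ProbabilityMeasure ℂ := ⟨μ, inferInstance⟩
  have key : Tendsto μs atTop (𝓝 μ') := by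
    rw [tendsto_iff_forall_lipschitz_integral_tendsto]
    rintro G ⟨C, hC⟩ ⟨L, hL⟩
    refine Tendsto.congr (fun q => (integral_reducedMeasure f (q + 1) G).symm) ?_
    refine (h G (C + |G 0|) L (fun z => ?_) hL).comp (tendsto_add_atTop_nat 1)
    have h1 := hC z 0
    rw [Real.dist_eq] at h1
    have h2 := abs_add_le (G z - G 0) (G 0)
    rw [sub_add_cancel] at h2
    linarith
  intro G
  rw [ProbabilityMeasure.tendsto_iff_forall_integral_tendsto] at key
  rw [← tendsto_add_atTop_iff_nat 1]
  exact Tendsto.congr (fun q => integral_reducedMeasure f (q + 1) G) (key G)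

lemma equidistribute_gaussSeries {k : ℂ} (hk : k.re < 0) {f : ℚ → ℂ} {h : ℝ → ℂ}
    (hper : PeriodicOffZero f) (hrec : SatisfiesReciprocity k f h) {θ C : ℝ} (hθ0 : 0 < θ)
    (hθ1 : θ < 1) (hψ : ModerateFamily θ C (periodFamily f h 1)) :
    ReducedValuesEquidistribute f (Measure.map (gaussSeries k (periodFamily f h 1))
      (volume.restrict (Set.Icc (0 : ℝ) 1))) := by
  have hm := aemeasurable_gaussSeries hk hθ0 hθ1 hψ
  have : IsProbabilityMeasure (volume.restrict (Set.Icc (0 : ℝ) 1)) := ⟨by simp⟩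
  have := Measure.isProbabilityMeasure_map hm
  refine equidistribute_of_lipschitz fun G K L hK hL => ?_
  rw [integral_map hm hL.continuous.aestronglyMeasurable]
  refine (tendsto_coprimeAverage_gaussSeries hk hθ0 hθ1 hψ hK hL).congr fun q => ?_
  rw [coprimeAverage, reducedAverage]
  congr 1
  refine Finset.sum_congr rfl fun a ha => ?_
  rw [Finset.mem_filter, Finset.mem_Icc] at ha
  have ha0 : (0 : ℚ) < a := by exact_mod_cast ha.1.1
  have hq0 : (0 : ℚ) < q := ha0.trans_le (by exact_mod_cast ha.1.2)
  have := gaussSeries_rat hk hper hrec (Or.inl rfl) (r := (a : ℚ) / q) (by positivity)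
    (div_le_one_of_le₀ (by exact_mod_cast ha.1.2) hq0.le)
  push_cast at this
  rw [this, one_mul]

/-! ### Convergence of the series along convergents. -/

/-- The continued fraction expansions of `x` and `z` share their first `n` digits. -/
def SameDigits (n : ℕ) (x z : ℝ) : Prop :=
  ∀ i < n, gaussMap^[i] x ≠ 0 ∧ gaussMap^[i] z ≠ 0 ∧ ⌊(gaussMap^[i] x)⁻¹⌋ = ⌊(gaussMap^[i] z)⁻¹⌋

lemma SameDigits.symm {n : ℕ} {x z : ℝ} (h : SameDigits n x z) : SameDigits n z x :=
  fun i hi => ⟨(h i hi).2.1, (h i hi).1, (h i hi).2.2.symm⟩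

lemma SameDigits.exists_continuants {x z : ℝ} (hx : x ∈ Set.Icc (0 : ℝ) 1) {n : ℕ}
    (h : SameDigits n x z) :
    ∃ b b' : ℤ, 1 ≤ b ∧ 0 ≤ b' ∧ b' ≤ b ∧ b * gaussProd x n + b' * gaussProd x (n + 1) = 1 ∧
      b * gaussProd z n + b' * gaussProd z (n + 1) = 1 := by
  induction n with
  | zero => exact ⟨1, 0, le_rfl, le_rfl, by norm_num, by simp [gaussProd], by simp [gaussProd]⟩
  | succ n ih =>
    obtain ⟨b, b', h1, h2, h3, h4, h5⟩ := ih fun i hi => h i (by omega)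
    obtain ⟨hx0, hz0, hd⟩ := h n (by omega)
    set a : ℤ := ⌊(gaussMap^[n] x)⁻¹⌋
    have ha : 1 ≤ a := one_le_floor_inv
      ((iterate_gaussMap_mem hx n).1.lt_of_ne' hx0) (iterate_gaussMap_mem hx n).2
    have key : ∀ w : ℝ, gaussMap^[n] w ≠ 0 → ⌊(gaussMap^[n] w)⁻¹⌋ = a →
        gaussProd w (n + 2) = gaussProd w n - a * gaussProd w (n + 1) := by
      intro w hw hw'
      rw [gaussProd_succ, gaussProd_succ, mul_assoc, Function.iterate_succ_apply',
        mul_gaussMap hw, hw']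
      ring
    refine ⟨a * b + b', b, by nlinarith, by linarith, by nlinarith, ?_, ?_⟩
    · rw [key x hx0 rfl]; push_cast; linear_combination h4
    · rw [key z hz0 hd.symm]; push_cast; linear_combination h5

/-- The continuants `b' ≤ b` depend only on the digits, so they are common to both points: `b β_n(z)
≤ 1 = b β_n(x) + b' β_(n+1)(x) ≤ 2 b β_n(x)`. -/
lemma SameDigits.gaussProd_le {x z : ℝ} (hx : x ∈ Set.Icc (0 : ℝ) 1) (hz : z ∈ Set.Icc (0 : ℝ) 1)
    {n : ℕ} (h : SameDigits n x z) : gaussProd z n ≤ 2 * gaussProd x n := by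
  obtain ⟨b, b', h1, h2, h3, h4, h5⟩ := h.exists_continuants hx
  have h1' : (1 : ℝ) ≤ b := by exact_mod_cast h1
  have h2' : (0 : ℝ) ≤ b' := by exact_mod_cast h2
  have h3' : (b' : ℝ) ≤ b := by exact_mod_cast h3
  have a1 := gaussProd_antitone hx n.le_succ
  have a2 := gaussProd_nonneg hz (n + 1)
  have a3 := gaussProd_nonneg hx (n + 1)
  have a4 : (b : ℝ) * gaussProd z n ≤ 1 := by nlinarith
  have a5 : 1 ≤ 2 * b * gaussProd x n := by
    have := mul_le_mul h3' a1 a3 (by linarith)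
    linarith
  have a6 : (b : ℝ) * gaussProd z n ≤ b * (2 * gaussProd x n) := by linarith
  exact le_of_mul_le_mul_left a6 (by linarith)

lemma convergent_eq_floor_add (x : ℝ) (n : ℕ) :
    x.convergent n = ⌊x⌋ + (Int.fract x).convergent n := by
  cases n with
  | zero => simp
  | succ n => simp [Real.convergent_succ]

lemma convergent_succ_of_mem {x : ℝ} (hx : x ∈ Set.Ioo (0 : ℝ) 1) (n : ℕ) :
    x.convergent (n + 1) = (⌊x⁻¹⌋ + (gaussMap x).convergent n : ℚ)⁻¹ := by
  rw [Real.convergent_succ, Int.floor_eq_zero_iff.2 ⟨hx.1.le, hx.2⟩,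
    Int.fract_eq_self.2 ⟨hx.1.le, hx.2⟩, Int.cast_zero, zero_add, convergent_eq_floor_add]
  rfl

lemma gaussMap_mem_Ioo {x : ℝ} (hx : Irrational x) : gaussMap x ∈ Set.Ioo (0 : ℝ) 1 :=
  ⟨(gaussMap_nonneg x).lt_of_ne (irrational_gaussMap hx).ne_zero.symm, gaussMap_lt_one x⟩

lemma convergent_mem {x : ℝ} (hx : Irrational x) (h : x ∈ Set.Ioo (0 : ℝ) 1) (n : ℕ) :
    0 ≤ x.convergent n ∧ x.convergent n ≤ 1 := by
  induction n generalizing x with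
  | zero => simp [Int.floor_eq_zero_iff.2 ⟨h.1.le, h.2⟩]
  | succ n ih =>
    obtain ⟨h1, h2⟩ := ih (irrational_gaussMap hx) (gaussMap_mem_Ioo hx)
    have h3 : (1 : ℚ) ≤ ⌊x⁻¹⌋ := by exact_mod_cast one_le_floor_inv h.1 h.2.le
    rw [convergent_succ_of_mem h]
    exact ⟨by positivity, inv_le_one_of_one_le₀ (by linarith)⟩

lemma convergent_succ_pos {x : ℝ} (hx : Irrational x) (h : x ∈ Set.Ioo (0 : ℝ) 1) (n : ℕ) :
    0 < x.convergent (n + 1) := by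
  have h1 := (convergent_mem (irrational_gaussMap hx) (gaussMap_mem_Ioo hx) n).1
  have h3 : (1 : ℚ) ≤ ⌊x⁻¹⌋ := by exact_mod_cast one_le_floor_inv h.1 h.2.le
  rw [convergent_succ_of_mem h]
  positivity

/-- The `j`-th Gauss iterate of a convergent of `x`, as long as it is nonzero, is a convergent of
`T^j x`, of the form `(⌊1/T^j x⌋ + w)⁻¹` with `0 ≤ w ≤ 1`; hence the bound with `+ 1`. -/
lemma sameDigits_convergent {x : ℝ} (hx : Irrational x) (h : x ∈ Set.Ioo (0 : ℝ) 1) (n j : ℕ)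
    (hj : gaussMap^[j] (x.convergent n : ℝ) ≠ 0) :
    SameDigits j x (x.convergent n) ∧
      (gaussMap^[j] (x.convergent n : ℝ))⁻¹ ≤ (gaussMap^[j] x)⁻¹ + 1 := by
  induction n generalizing x j with
  | zero =>
    simp only [Real.convergent_zero, Int.floor_eq_zero_iff.2 ⟨h.1.le, h.2⟩, Int.cast_zero,
      Rat.cast_zero, iterate_gaussMap_zero] at hj
    exact absurd rfl hj
  | succ n ih =>
    have hT := irrational_gaussMap hx
    have hT' := gaussMap_mem_Ioo hx
    have ha : (1 : ℝ) ≤ ⌊x⁻¹⌋ := by exact_mod_cast one_le_floor_inv h.1 h.2.le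
    obtain ⟨w0, w1⟩ := convergent_mem hT hT' n
    set w : ℚ := (gaussMap x).convergent n
    have w0' : (0 : ℝ) ≤ w := by exact_mod_cast w0
    have w1' : (w : ℝ) ≤ 1 := by exact_mod_cast w1
    have hv : (x.convergent (n + 1) : ℝ) = (⌊x⁻¹⌋ + (w : ℝ))⁻¹ := by
      rw [convergent_succ_of_mem h]; push_cast; rfl
    cases j with
    | zero =>
      refine ⟨fun i hi => absurd hi (Nat.not_lt_zero i), ?_⟩
      simp only [Function.iterate_zero, id]
      rw [hv, inv_inv]
      linarith [Int.floor_le x⁻¹]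
    | succ j =>
      rw [Function.iterate_succ_apply, hv] at hj ⊢
      rcases w1'.eq_or_lt with hw | hw
      -- A last digit `1` makes `w = 1`; the floor then jumps to the next integer and the orbit ends
      -- a step early, so no later index has to be treated.
      · have : gaussMap ((⌊x⁻¹⌋ + (w : ℝ))⁻¹) = 0 := by
          rw [gaussMap, inv_inv, hw, Int.fract_intCast_add, Int.fract_one]
        rw [this, iterate_gaussMap_zero] at hj
        exact absurd rfl hj
      rw [gaussMap_add_inv w0' hw] at hj ⊢
      obtain ⟨h1, h2⟩ := ih hT hT' j hj
      refine ⟨fun i hi => ?_, by rw [Function.iterate_succ_apply]; exact h2⟩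
      cases i with
      | zero =>
        simp only [Function.iterate_zero, id]
        refine ⟨h.1.ne', by positivity, ?_⟩
        rw [inv_inv, Int.floor_intCast_add, Int.floor_eq_zero_iff.2 ⟨w0', hw⟩, add_zero]
      | succ i =>
        rw [Function.iterate_succ_apply, Function.iterate_succ_apply, gaussMap_add_inv w0' hw]
        exact h1 i (by omega)

lemma tendsto_convergent (x : ℝ) :
    Tendsto (fun n => (x.convergent n : ℝ)) atTop (𝓝 x) :=
  (GenContFract.of_convergence x).congr fun n => Real.convs_eq_convergent x n

section
variable {k : ℂ} {θ C : ℝ} {ψ : ℕ → ℝ → ℂ}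

lemma rpow_add_one_le {a : ℝ} (ha : 0 ≤ a) (hθ0 : 0 < θ) (hθ1 : θ < 1) :
    (a + 1) ^ θ ≤ a ^ θ + 1 := by
  lift a to NNReal using ha
  have := NNReal.rpow_add_le_add_rpow a 1 hθ0.le hθ1.le
  rw [NNReal.one_rpow] at this
  exact_mod_cast this

lemma moderateFamily_majorant (hC : 0 ≤ C) (hθ0 : 0 < θ) :
    ModerateFamily θ C fun _ y => ((C * Real.exp (y⁻¹ ^ θ) : ℝ) : ℂ) := by
  refine ⟨fun j y _ _ => ?_, fun j => ?_, fun j => ?_, fun j => ?_⟩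
  · rw [Complex.norm_real, Real.norm_of_nonneg (by positivity)]
  · rw [Complex.norm_real, Real.norm_of_nonneg (by positivity), inv_zero,
      Real.zero_rpow hθ0.ne', Real.exp_zero, mul_one]
  · refine Complex.continuous_ofReal.comp_continuousOn (continuousOn_const.mul
      (Real.continuous_exp.comp_continuousOn ((continuousOn_inv₀.mono fun y hy => ?_).rpow_const
        fun y _ => Or.inr hθ0.le)))
    exact hy.1.ne'
  · exact Complex.measurable_ofReal.comp
      ((Real.measurable_exp.comp (measurable_inv.pow_const θ)).const_mul C)

/-- The terms at a point whose orbit is controlled by that of a tame point `x`. -/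
lemma norm_gaussTerm_le_of_comparable (hk : k.re < 0) (hθ0 : 0 < θ) (hθ1 : θ < 1)
    (hψ : ModerateFamily θ C ψ) {x r : ℝ} (hx : x ∈ Set.Ioo (0 : ℝ) 1)
    (hr : r ∈ Set.Icc (0 : ℝ) 1) {m₁ j : ℕ} (ht : Tame (weightGrowth k θ) m₁ x) (hj : 2 * m₁ ≤ j)
    (hc : gaussMap^[j] r ≠ 0 →
      (gaussMap^[j] r)⁻¹ ≤ (gaussMap^[j] x)⁻¹ + 1 ∧ gaussProd r j ≤ 2 * gaussProd x j) :
    ‖gaussTerm k ψ r j‖ ≤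
      2 ^ (-k.re) * C * Real.exp 1 * Real.exp 1 * (weightRatio k)⁻¹ * weightRatio k ^ j := by
  have hC : 0 ≤ C := (norm_nonneg _).trans (hψ.bound_zero 0)
  have hx' := Set.Ioo_subset_Icc_self hx
  have hρ := weightRatio_pos k
  have hσ : 0 < -k.re := by linarith
  have h2σ : (1 : ℝ) ≤ 2 ^ (-k.re) := Real.one_le_rpow one_le_two hσ.le
  have he : (1 : ℝ) ≤ Real.exp 1 := Real.one_le_exp zero_le_one
  have hr0 := gaussProd_nonneg hr j
  have hy := iterate_gaussMap_mem hr j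
  rw [gaussTerm, norm_mul, norm_ofReal_cpow_neg hk hr0]
  rcases eq_or_ne (gaussMap^[j] r) 0 with h0 | h0
  · rw [h0]
    have h1 : gaussProd r j ^ (-k.re) ≤ gaussProd r j ^ (-k.re / 2) := by
      rcases hr0.eq_or_lt with h | h
      · rw [← h, Real.zero_rpow hσ.ne', Real.zero_rpow (by linarith)]
      · exact Real.rpow_le_rpow_of_exponent_ge h (gaussProd_le_one hr j) (by linarith)
    calc _ ≤ (weightRatio k)⁻¹ * weightRatio k ^ j * C :=
          mul_le_mul (h1.trans (gaussProd_rpow_le hk hr j)) (hψ.bound_zero j) (norm_nonneg _)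
            (by positivity)
      _ = 1 * C * 1 * 1 * (weightRatio k)⁻¹ * weightRatio k ^ j := by ring
      _ ≤ _ := by gcongr
  · obtain ⟨h1, h2⟩ := hc h0
    have hyx := iterate_gaussMap_mem hx' j
    -- The term at `r` is compared with the majorant `C exp(y^(-θ))` along the orbit of `x`, to
    -- which the bound at tame points applies. Passing from `1/T^j x` to `1/T^j x + 1` costs one
    -- more factor `e`, by subadditivity of `t ↦ t^θ`.
    have hmaj := norm_gaussTerm_le hk hθ0 (moderateFamily_majorant hC hθ0) hx' ht hj
    rw [gaussTerm, norm_mul, norm_ofReal_cpow_neg hk (gaussProd_nonneg hx' j), Complex.norm_real,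
      Real.norm_of_nonneg (by positivity)] at hmaj
    have h3 : ‖ψ j (gaussMap^[j] r)‖ ≤
        C * (Real.exp ((gaussMap^[j] x)⁻¹ ^ θ) * Real.exp 1) := by
      refine (hψ.bound j _ (hy.1.lt_of_ne' h0) hy.2).trans ?_
      rw [← Real.exp_add]
      refine mul_le_mul_of_nonneg_left (Real.exp_le_exp.2 ?_) hC
      exact (Real.rpow_le_rpow (inv_nonneg.2 hy.1) h1 hθ0.le).trans
        (rpow_add_one_le (inv_nonneg.2 hyx.1) hθ0 hθ1)
    have h4 : gaussProd r j ^ (-k.re) ≤ 2 ^ (-k.re) * gaussProd x j ^ (-k.re) := by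
      rw [← Real.mul_rpow zero_le_two (gaussProd_nonneg hx' j)]
      exact Real.rpow_le_rpow hr0 h2 hσ.le
    calc _ ≤ 2 ^ (-k.re) * gaussProd x j ^ (-k.re) *
          (C * (Real.exp ((gaussMap^[j] x)⁻¹ ^ θ) * Real.exp 1)) :=
          mul_le_mul h4 h3 (norm_nonneg _)
            (mul_nonneg (by positivity) (Real.rpow_nonneg (gaussProd_nonneg hx' j) _))
      _ = 2 ^ (-k.re) * Real.exp 1 *
          (gaussProd x j ^ (-k.re) * (C * Real.exp ((gaussMap^[j] x)⁻¹ ^ θ))) := by ring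
      _ ≤ 2 ^ (-k.re) * Real.exp 1 *
          (C * Real.exp 1 * (weightRatio k)⁻¹ * weightRatio k ^ j) := by gcongr
      _ = _ := by ring

/-- Dominated convergence for series. The points `r n` need not be tame themselves: their late terms
are dominated through the orbit of `x`, while the finitely many early terms converge and so stay
bounded. -/
lemma tendsto_gaussSeries_of_comparable (hk : k.re < 0) (hθ0 : 0 < θ) (hθ1 : θ < 1)
    (hψ : ModerateFamily θ C ψ) {x : ℝ} (hx : x ∈ Set.Ioo (0 : ℝ) 1) (hirr : Irrational x)
    {m₁ : ℕ} (ht : Tame (weightGrowth k θ) m₁ x) {r : ℕ → ℝ} (hr : ∀ n, r n ∈ Set.Icc (0 : ℝ) 1)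
    (hlim : Tendsto r atTop (𝓝 x)) (j₀ : ℕ)
    (hc : ∀ᶠ n in atTop, ∀ j, j₀ ≤ j → gaussMap^[j] (r n) ≠ 0 →
      (gaussMap^[j] (r n))⁻¹ ≤ (gaussMap^[j] x)⁻¹ + 1 ∧ gaussProd (r n) j ≤ 2 * gaussProd x j) :
    Tendsto (fun n => gaussSeries k ψ (r n)) atTop (𝓝 (gaussSeries k ψ x)) := by
  have hx' := Set.Ioo_subset_Icc_self hx
  set J := max j₀ (2 * m₁)
  set K := 2 ^ (-k.re) * C * Real.exp 1 * Real.exp 1 * (weightRatio k)⁻¹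
  have hterm : ∀ j, Tendsto (fun n => gaussTerm k ψ (r n) j) atTop (𝓝 (gaussTerm k ψ x j)) :=
    fun j => (continuousAt_gaussTerm hψ hirr hx' j).tendsto.comp hlim
  refine tendsto_tsum_of_dominated_convergence
    (bound := fun j => if j < J then ‖gaussTerm k ψ x j‖ + 1 else K * weightRatio k ^ j) ?_ hterm ?_
  · rw [← summable_nat_add_iff J]
    refine Summable.congr (((summable_nat_add_iff J).2 ((summable_geometric_of_lt_one
      (weightRatio_pos k).le (weightRatio_lt_one hk)).mul_left K))) fun j => ?_
    rw [if_neg (by omega)]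
  · have h1 : ∀ᶠ n in atTop, ∀ j ∈ Finset.range J,
        ‖gaussTerm k ψ (r n) j‖ < ‖gaussTerm k ψ x j‖ + 1 := by
      rw [Filter.eventually_all_finset]
      exact fun j _ => (hterm j).norm.eventually_lt_const (by linarith)
    filter_upwards [h1, hc] with n hn hcn j
    split_ifs with hj
    · exact (hn j (Finset.mem_range.2 hj)).le
    · exact norm_gaussTerm_le_of_comparable hk hθ0 hθ1 hψ hx (hr n) ht (by omega)
        (hcn j (by omega))

lemma tendsto_gaussSeries_convergent (hk : k.re < 0) (hθ0 : 0 < θ) (hθ1 : θ < 1)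
    (hψ : ModerateFamily θ C ψ) {x : ℝ} (hx : x ∈ Set.Ioo (0 : ℝ) 1) (hirr : Irrational x)
    {m₁ : ℕ} (ht : Tame (weightGrowth k θ) m₁ x) :
    Tendsto (fun n => gaussSeries k ψ (x.convergent n)) atTop (𝓝 (gaussSeries k ψ x)) := by
  have hmem : ∀ n, (x.convergent n : ℝ) ∈ Set.Icc (0 : ℝ) 1 := fun n => by
    obtain ⟨h1, h2⟩ := convergent_mem hirr hx n
    exact ⟨by exact_mod_cast h1, by exact_mod_cast h2⟩
  refine tendsto_gaussSeries_of_comparable hk hθ0 hθ1 hψ hx hirr ht hmem (tendsto_convergent x) 0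
    (Eventually.of_forall fun n j _ hj => ?_)
  obtain ⟨h1, h2⟩ := sameDigits_convergent hirr hx n j hj
  exact ⟨h2, h1.gaussProd_le (Set.Ioo_subset_Icc_self hx) (hmem n)⟩

/-- If `y = [0; a, b, …]` with `a ≥ 2`, then `1 - y = [0; 1, a - 1, b, …]`: the two orbits merge,
shifted by one step. This handles negative reals, whose fractional part is measured from the other
side. -/
lemma gaussMap_one_sub {y : ℝ} (h0 : 0 < y) (h1 : y < 1 / 2) :
    gaussMap (1 - y) = y / (1 - y) ∧ gaussMap (gaussMap (1 - y)) = gaussMap y := by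
  have hy : 0 < 1 - y := by linarith
  have e1 : gaussMap (1 - y) = y / (1 - y) := by
    have h2 : (1 - y)⁻¹ = ((1 : ℤ) : ℝ) + y / (1 - y) := by field_simp; push_cast; ring
    rw [gaussMap, h2, Int.fract_intCast_add, Int.fract_eq_self]
    exact ⟨by positivity, (div_lt_one hy).2 (by linarith)⟩
  refine ⟨e1, ?_⟩
  rw [e1, gaussMap, gaussMap, inv_div, show (1 - y) / y = y⁻¹ - ((1 : ℤ) : ℝ) by
    field_simp; push_cast; ring, Int.fract_sub_intCast]

lemma iterate_gaussMap_one_sub {y : ℝ} (h0 : 0 < y) (h1 : y < 1 / 2) (j : ℕ) :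
    gaussMap^[j + 2] (1 - y) = gaussMap^[j + 1] y := by
  rw [Function.iterate_succ_apply, Function.iterate_succ_apply, Function.iterate_succ_apply,
    (gaussMap_one_sub h0 h1).2]

lemma gaussProd_one_sub {y : ℝ} (h0 : 0 < y) (h1 : y < 1 / 2) (j : ℕ) :
    gaussProd (1 - y) (j + 2) = gaussProd y (j + 1) := by
  rw [gaussProd_succ', gaussProd_succ', gaussProd_succ', (gaussMap_one_sub h0 h1).2,
    (gaussMap_one_sub h0 h1).1, ← mul_assoc, mul_div_cancel₀ _ (by linarith)]

lemma Tame.one_sub {M : ℕ → ℝ} {m₁ : ℕ} {x : ℝ} (h : Tame M m₁ x) : Tame M m₁ (1 - x) := by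
  intro m hm b hb1 hb2 c hc
  have h1 := h m hm b hb1 hb2 (b - c) fun h2 => hc (by push_cast at h2; linarith)
  push_cast at h1
  rwa [show (b : ℝ) * x - (b - c) = -(b * (1 - x) - c) by ring, abs_neg] at h1

lemma tendsto_gaussSeries_one_sub_convergent (hk : k.re < 0) (hθ0 : 0 < θ) (hθ1 : θ < 1)
    (hψ : ModerateFamily θ C ψ) {x : ℝ} (hx : x ∈ Set.Ioo (0 : ℝ) 1) (hirr : Irrational x)
    {m₁ : ℕ} (ht : Tame (weightGrowth k θ) m₁ x) :
    Tendsto (fun n => gaussSeries k ψ (1 - x.convergent n)) atTop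
      (𝓝 (gaussSeries k ψ (1 - x))) := by
  have hmem : ∀ n, (x.convergent n : ℝ) ∈ Set.Icc (0 : ℝ) 1 := fun n => by
    obtain ⟨h1, h2⟩ := convergent_mem hirr hx n
    exact ⟨by exact_mod_cast h1, by exact_mod_cast h2⟩
  have hirr' : Irrational (1 - x) := by simpa using hirr.intCast_sub 1
  have hlim := tendsto_convergent x
  refine tendsto_gaussSeries_of_comparable hk hθ0 hθ1 hψ ⟨by linarith [hx.2], by linarith [hx.1]⟩
    hirr' ht.one_sub (fun n => ⟨by linarith [(hmem n).2], by linarith [(hmem n).1]⟩)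
    (tendsto_const_nhds.sub hlim) 2 ?_
  have hpos := hlim.eventually_const_lt hx.1
  have hlt1 := hlim.eventually_lt_const hx.2
  have hhalf : x ≠ 1 / 2 := by
    have := hirr.ne_rat (1 / 2)
    push_cast at this
    exact this
  have key : ∀ n j, gaussMap^[j] (x.convergent n : ℝ) ≠ 0 →
      (gaussMap^[j] (x.convergent n : ℝ))⁻¹ ≤ (gaussMap^[j] x)⁻¹ + 1 ∧
        gaussProd (x.convergent n : ℝ) j ≤ 2 * gaussProd x j := fun n j hj => by
    obtain ⟨h1, h2⟩ := sameDigits_convergent hirr hx n j hj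
    exact ⟨h2, h1.gaussProd_le (Set.Ioo_subset_Icc_self hx) (hmem n)⟩
  -- Below `1/2` the reflected point has one extra digit; above `1/2` it has one fewer, and the same
  -- identities are read from `1 - x`.
  rcases hhalf.lt_or_gt with hlt | hgt
  · filter_upwards [hpos, hlim.eventually_lt_const hlt] with n hn0 hn1 j hj
    obtain ⟨j, rfl⟩ := Nat.exists_eq_add_of_le' hj
    rw [iterate_gaussMap_one_sub hn0 hn1, iterate_gaussMap_one_sub hx.1 hlt,
      gaussProd_one_sub hn0 hn1, gaussProd_one_sub hx.1 hlt]
    exact key n (j + 1)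
  · filter_upwards [hlt1, hlim.eventually_const_lt hgt] with n hn0 hn1 j hj
    obtain ⟨j, rfl⟩ := Nat.exists_eq_add_of_le' hj
    have e1 := iterate_gaussMap_one_sub (y := 1 - x) (by linarith [hx.2]) (by linarith) (j + 1)
    have e2 := iterate_gaussMap_one_sub (y := 1 - (x.convergent n : ℝ)) (by linarith)
      (by linarith) (j + 1)
    have e3 := gaussProd_one_sub (y := 1 - x) (by linarith [hx.2]) (by linarith) (j + 1)
    have e4 := gaussProd_one_sub (y := 1 - (x.convergent n : ℝ)) (by linarith)
      (by linarith) (j + 1)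
    rw [sub_sub_cancel] at e1 e2 e3 e4
    change gaussMap^[j + 1 + 1] _ ≠ 0 → (gaussMap^[j + 1 + 1] _)⁻¹ ≤ (gaussMap^[j + 1 + 1] _)⁻¹ + 1 ∧
      gaussProd _ (j + 1 + 1) ≤ 2 * gaussProd _ (j + 1 + 1)
    rw [← e1, ← e2, ← e3, ← e4]
    exact key n (j + 1 + 2)

end

lemma ae_fract_tame {c κ : ℝ} (hc : 0 < c) (hκ : 1 < κ) :
    ∀ᵐ x : ℝ, ∃ m₁, Tame (growth c κ) m₁ (Int.fract x) := by
  have h := ae_exists_tame hc hκ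
  rw [ae_restrict_iff' measurableSet_Icc] at h
  have h2 : ∀ n : ℤ, ∀ᵐ x : ℝ, x - n ∈ Set.Icc (0 : ℝ) 1 → ∃ m₁, Tame (growth c κ) m₁ (x - n) :=
    fun n => (measurePreserving_sub_right volume (n : ℝ)).quasiMeasurePreserving.ae h
  filter_upwards [ae_all_iff.2 h2] with x hx
  exact hx ⌊x⌋ ⟨Int.fract_nonneg x, (Int.fract_lt_one x).le⟩

/-- The values along convergents converge, at almost every real number. -/
lemma ae_tendsto_convergent {k : ℂ} (hk : k.re < 0) {f : ℚ → ℂ} {h : ℝ → ℂ}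
    (hper : PeriodicOffZero f) (hrec : SatisfiesReciprocity k f h) {θ C : ℝ} (hθ0 : 0 < θ)
    (hθ1 : θ < 1) (hψ : ∀ s : ℤ, (s = 1 ∨ s = -1) → ModerateFamily θ C (periodFamily f h s)) :
    ∀ᵐ x : ℝ, Tendsto (fun n => f (x.convergent n)) atTop (𝓝 (if 0 < x then
      gaussSeries k (periodFamily f h 1) (Int.fract x) else
      gaussSeries k (periodFamily f h (-1)) (1 - Int.fract x))) := by
  obtain ⟨hc, hκ⟩ := weight_constants hk hθ0 hθ1
  filter_upwards [ae_irrational, ae_fract_tame hc hκ] with x hirr ⟨m₁, ht⟩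
  have hirr' : Irrational (Int.fract x) := hirr.sub_intCast _
  have hmem : Int.fract x ∈ Set.Ioo (0 : ℝ) 1 :=
    ⟨(Int.fract_nonneg x).lt_of_ne hirr'.ne_zero.symm, Int.fract_lt_one x⟩
  split_ifs with hx
  · refine (tendsto_gaussSeries_convergent hk hθ0 hθ1 (hψ 1 (Or.inl rfl)) hmem hirr' ht).congr' ?_
    filter_upwards [eventually_ge_atTop 1] with n hn
    obtain ⟨n, rfl⟩ := Nat.exists_eq_add_of_le' hn
    have hpos := convergent_succ_pos hirr' hmem n
    rw [gaussSeries_rat hk hper hrec (Or.inl rfl) hpos (convergent_mem hirr' hmem _).2,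
      convergent_eq_floor_add x]
    have hfl : 0 ≤ ⌊x⌋ := Int.floor_nonneg.2 hx.le
    have := hper.add_nat (s := 1) (Or.inl rfl) hpos ⌊x⌋.toNat
    rw [← this]
    have e : ((⌊x⌋.toNat : ℕ) : ℚ) = ⌊x⌋ := by exact_mod_cast Int.toNat_of_nonneg hfl
    rw [e]
    congr 1; push_cast; ring
  · refine (tendsto_gaussSeries_one_sub_convergent hk hθ0 hθ1 (hψ (-1) (Or.inr rfl)) hmem hirr'
      ht).congr' ?_
    filter_upwards [(tendsto_convergent (Int.fract x)).eventually_lt_const hmem.2] with n hn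
    have hlt : (Int.fract x).convergent n < 1 := by exact_mod_cast hn
    have h0 := (convergent_mem hirr' hmem n).1
    set w := (Int.fract x).convergent n with hw
    have e0 : ((1 : ℝ) - (w : ℝ)) = ((1 - w : ℚ) : ℝ) := by push_cast; ring
    rw [e0, gaussSeries_rat hk hper hrec (Or.inr rfl) (by linarith) (by linarith),
      convergent_eq_floor_add x, ← hw]
    have hfl : ⌊x⌋ ≤ -1 := by
      have : x < 0 := lt_of_le_of_ne (not_lt.1 hx) hirr.ne_zero
      have : ⌊x⌋ < 0 := Int.floor_lt.2 (by simpa using this)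
      omega
    -- For `x < 0` the convergent is `⌊x⌋ + w = -((1 - w) + (-1 - ⌊x⌋))`, where the last bracket is
    -- a natural number and `1 - w > 0`; periodicity on the negative rationals applies.
    have := hper.add_nat (s := -1) (Or.inr rfl) (r := 1 - w) (by linarith) (-1 - ⌊x⌋).toNat
    rw [← this]
    have e : (((-1 - ⌊x⌋).toNat : ℕ) : ℚ) = -1 - ⌊x⌋ := by
      exact_mod_cast Int.toNat_of_nonneg (by omega)
    rw [e]
    congr 1; push_cast; ring

/-! ### Inverse branches of the Gauss map and bounded distortion. -/

/-- The inverse branch of the `n`-th iterate of the Gauss map on the cylinder of `x`. -/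
noncomputable def gaussBranch : ℕ → ℝ → ℝ → ℝ
  | 0, _, y => y
  | n + 1, x, y => (⌊x⁻¹⌋ + gaussBranch n (gaussMap x) y)⁻¹

lemma inv_add_mem_Ioo {a : ℤ} (ha : 1 ≤ a) {y : ℝ} (hy : y ∈ Set.Ioo (0 : ℝ) 1) :
    ((a : ℝ) + y)⁻¹ ∈ Set.Ioo (0 : ℝ) 1 := by
  have ha' : (1 : ℝ) ≤ a := by exact_mod_cast ha
  exact ⟨inv_pos.2 (by linarith [hy.1]), inv_lt_one_of_one_lt₀ (by linarith [hy.1])⟩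

lemma gaussBranch_mem {x : ℝ} (hirr : Irrational x) (hx : x ∈ Set.Ioo (0 : ℝ) 1)
    {y : ℝ} (hy : y ∈ Set.Ioo (0 : ℝ) 1) (n : ℕ) : gaussBranch n x y ∈ Set.Ioo (0 : ℝ) 1 := by
  induction n generalizing x with
  | zero => exact hy
  | succ n ih =>
    exact inv_add_mem_Ioo (one_le_floor_inv hx.1 hx.2.le)
      (ih (irrational_gaussMap hirr) (gaussMap_mem_Ioo hirr))

lemma gaussMap_gaussBranch_succ {x : ℝ} (hirr : Irrational x)
    {y : ℝ} (hy : y ∈ Set.Ioo (0 : ℝ) 1) (n : ℕ) :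
    gaussMap (gaussBranch (n + 1) x y) = gaussBranch n (gaussMap x) y := by
  have h := gaussBranch_mem (irrational_gaussMap hirr) (gaussMap_mem_Ioo hirr) hy n
  exact gaussMap_add_inv h.1.le h.2

lemma iterate_gaussMap_gaussBranch {x : ℝ} (hirr : Irrational x)
    {y : ℝ} (hy : y ∈ Set.Ioo (0 : ℝ) 1) (n : ℕ) : gaussMap^[n] (gaussBranch n x y) = y := by
  induction n generalizing x with
  | zero => rfl
  | succ n ih =>
    rw [Function.iterate_succ_apply, gaussMap_gaussBranch_succ hirr hy]
    exact ih (irrational_gaussMap hirr)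

lemma sameDigits_gaussBranch {x : ℝ} (hirr : Irrational x) (hx : x ∈ Set.Ioo (0 : ℝ) 1)
    {y : ℝ} (hy : y ∈ Set.Ioo (0 : ℝ) 1) (n : ℕ) : SameDigits n x (gaussBranch n x y) := by
  induction n generalizing x with
  | zero => exact fun i hi => absurd hi (Nat.not_lt_zero i)
  | succ n ih =>
    have hT := irrational_gaussMap hirr
    have hT' := gaussMap_mem_Ioo hirr
    intro i hi
    cases i with
    | zero =>
      have h := gaussBranch_mem hT hT' hy n
      refine ⟨hx.1.ne', (gaussBranch_mem hirr hx hy (n + 1)).1.ne', ?_⟩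
      simp only [Function.iterate_zero, id, gaussBranch]
      rw [inv_inv, Int.floor_intCast_add, Int.floor_eq_zero_iff.2 ⟨h.1.le, h.2⟩, add_zero]
    | succ i =>
      rw [Function.iterate_succ_apply, Function.iterate_succ_apply,
        gaussMap_gaussBranch_succ hirr hy]
      exact ih hT hT' i (by omega)

/-- Iterate the exact identity `|1/(a+u) - 1/(a+v)| = |u - v| · 1/(a+u) · 1/(a+v)`. Since orbit
products on one cylinder agree up to a factor `2`, the branch scales distances by `β_n(x)²` up to a
factor `4`. -/
lemma abs_gaussBranch_sub {x : ℝ} (hirr : Irrational x) (hx : x ∈ Set.Ioo (0 : ℝ) 1)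
    {y y' : ℝ} (hy : y ∈ Set.Ioo (0 : ℝ) 1) (hy' : y' ∈ Set.Ioo (0 : ℝ) 1) (n : ℕ) :
    |gaussBranch n x y - gaussBranch n x y'| =
    |y - y'| * (gaussProd (gaussBranch n x y) n * gaussProd (gaussBranch n x y') n) := by
  induction n generalizing x with
  | zero => simp [gaussBranch, gaussProd_zero]
  | succ n ih =>
    have hT := irrational_gaussMap hirr
    have hT' := gaussMap_mem_Ioo hirr
    have h1 := gaussBranch_mem hT hT' hy n
    have h2 := gaussBranch_mem hT hT' hy' n
    have h3 := gaussBranch_mem hirr hx hy (n + 1)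
    have h4 := gaussBranch_mem hirr hx hy' (n + 1)
    have ha : (1 : ℝ) ≤ ⌊x⁻¹⌋ := by exact_mod_cast one_le_floor_inv hx.1 hx.2.le
    rw [gaussProd_succ', gaussProd_succ', gaussMap_gaussBranch_succ hirr hy,
      gaussMap_gaussBranch_succ hirr hy']
    have e : gaussBranch (n + 1) x y - gaussBranch (n + 1) x y' =
        -(gaussBranch n (gaussMap x) y - gaussBranch n (gaussMap x) y') *
          (gaussBranch (n + 1) x y * gaussBranch (n + 1) x y') := by
      have p1 : (⌊x⁻¹⌋ : ℝ) + gaussBranch n (gaussMap x) y ≠ 0 := by linarith [h1.1]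
      have p2 : (⌊x⁻¹⌋ : ℝ) + gaussBranch n (gaussMap x) y' ≠ 0 := by linarith [h2.1]
      simp only [gaussBranch]
      rw [inv_sub_inv p1 p2, div_eq_mul_inv, mul_inv]
      ring
    rw [e, abs_mul, abs_neg, ih hT hT', abs_of_pos (mul_pos h3.1 h4.1)]
    ring

lemma gaussBranch_iterate {x : ℝ} (n : ℕ) :
    gaussBranch n x (gaussMap^[n] x) = x := by
  induction n generalizing x with
  | zero => rfl
  | succ n ih =>
    rw [Function.iterate_succ_apply, gaussBranch, ih, gaussMap, Int.floor_add_fract, inv_inv]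

lemma abs_gaussBranch_sub_le {x : ℝ} (hirr : Irrational x) (hx : x ∈ Set.Ioo (0 : ℝ) 1) {y : ℝ}
    (hy : y ∈ Set.Ioo (0 : ℝ) 1) (n : ℕ) : |gaussBranch n x y - x| ≤ 2 * gaussProd x n ^ 2 := by
  have hx' := Set.Ioo_subset_Icc_self hx
  have hT := iterate_gaussMap_mem_Ioo hirr hx' n
  have h1 := abs_gaussBranch_sub hirr hx hy hT n
  rw [gaussBranch_iterate] at h1
  have h2 := (sameDigits_gaussBranch hirr hx hy n).gaussProd_le hx'
    (Set.Ioo_subset_Icc_self (gaussBranch_mem hirr hx hy n))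
  have h3 : |y - gaussMap^[n] x| ≤ 1 := by
    rw [abs_le]; constructor <;> linarith [hy.1, hy.2, hT.1, hT.2]
  have h4 := gaussProd_nonneg hx' n
  have h5 := gaussProd_nonneg (Set.Ioo_subset_Icc_self (gaussBranch_mem hirr hx hy n)) n
  rw [h1]
  calc _ ≤ 1 * (2 * gaussProd x n * gaussProd x n) := by gcongr
    _ = _ := by ring

/-- Bounded distortion: preimages under the inverse branches. -/
lemma volume_preimage_gaussBranch_le {x : ℝ} (hirr : Irrational x) (hx : x ∈ Set.Ioo (0 : ℝ) 1)
    (n : ℕ) (S : Set ℝ) :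
    volume {y ∈ Set.Ioo (0 : ℝ) 1 | gaussBranch n x y ∈ S} ≤
      ENNReal.ofReal (4 / gaussProd x n ^ 2) * volume S := by
  have hx' := Set.Ioo_subset_Icc_self hx
  have hβ := gaussProd_pos hirr hx.1 n
  set s := gaussBranch n x '' {y ∈ Set.Ioo (0 : ℝ) 1 | gaussBranch n x y ∈ S}
  have hlip : LipschitzOnWith (Real.toNNReal (4 / gaussProd x n ^ 2)) (gaussMap^[n]) s := by
    refine LipschitzOnWith.of_dist_le_mul ?_
    rintro _ ⟨y, ⟨hy, -⟩, rfl⟩ _ ⟨y', ⟨hy', -⟩, rfl⟩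
    rw [iterate_gaussMap_gaussBranch hirr hy, iterate_gaussMap_gaussBranch hirr hy',
      Real.coe_toNNReal _ (by positivity), Real.dist_eq, Real.dist_eq,
      abs_gaussBranch_sub hirr hx hy hy']
    have b1 := Set.Ioo_subset_Icc_self (gaussBranch_mem hirr hx hy n)
    have b2 := Set.Ioo_subset_Icc_self (gaussBranch_mem hirr hx hy' n)
    have h1 := (sameDigits_gaussBranch hirr hx hy n).symm.gaussProd_le b1 hx'
    have h2 := (sameDigits_gaussBranch hirr hx hy' n).symm.gaussProd_le b2 hx'
    rw [div_mul_eq_mul_div, le_div_iff₀ (by positivity)]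
    have h3 : gaussProd x n ^ 2 ≤
        4 * (gaussProd (gaussBranch n x y) n * gaussProd (gaussBranch n x y') n) := by
      calc _ = gaussProd x n * gaussProd x n := sq _
        _ ≤ (2 * gaussProd (gaussBranch n x y) n) * (2 * gaussProd (gaussBranch n x y') n) :=
          mul_le_mul h1 h2 hβ.le (by linarith)
        _ = _ := by ring
    calc |y - y'| * gaussProd x n ^ 2 ≤ |y - y'| *
          (4 * (gaussProd (gaussBranch n x y) n * gaussProd (gaussBranch n x y') n)) := by gcongr
      _ = _ := by ring
  -- Lebesgue measure is one-dimensional Hausdorff measure, so the Lipschitz bound for the inverse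
  -- map `T^n` controls images of arbitrary sets, measurable or not.
  have h1 := hlip.hausdorffMeasure_image_le (d := 1) zero_le_one
  rw [hausdorffMeasure_real] at h1
  simp only [ENNReal.rpow_one] at h1
  have h2 : gaussMap^[n] '' s = {y ∈ Set.Ioo (0 : ℝ) 1 | gaussBranch n x y ∈ S} := by
    rw [Set.image_image]
    ext y
    constructor
    · rintro ⟨w, hw, rfl⟩
      simp only [iterate_gaussMap_gaussBranch hirr hw.1]
      exact hw
    · exact fun hw => ⟨y, hw, iterate_gaussMap_gaussBranch hirr hw.1 n⟩
  rw [h2] at h1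
  refine h1.trans (mul_le_mul' le_rfl (measure_mono ?_))
  rintro _ ⟨y, hy, rfl⟩
  exact hy.2

/-- At a density point of `A`, most of each deep cylinder lies in `A`. -/
lemma tendsto_volume_gaussBranch_compl {A : Set ℝ} (hA : NullMeasurableSet A) {x : ℝ}
    (hirr : Irrational x) (hx : x ∈ Set.Ioo (0 : ℝ) 1)
    (hd : Tendsto (fun r => volume (A ∩ Metric.closedBall x r) / volume (Metric.closedBall x r))
      (𝓝[>] 0) (𝓝 1)) :
    Tendsto (fun n => volume {y ∈ Set.Ioo (0 : ℝ) 1 | gaussBranch n x y ∉ A}) atTop (𝓝 0) := by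
  have hx' := Set.Ioo_subset_Icc_self hx
  -- The ball of this radius contains the whole cylinder. Its length `4 β_n²` times the distortion
  -- constant `4/β_n²` is the factor `16` below, independent of `n`.
  set R := fun n => 2 * gaussProd x n ^ 2
  have hRpos : ∀ n, 0 < R n := fun n => by have := gaussProd_pos hirr hx.1 n; positivity
  have hR : Tendsto R atTop (𝓝[>] 0) := by
    refine tendsto_nhdsWithin_iff.2 ⟨?_, Eventually.of_forall hRpos⟩
    have h1 : Tendsto (fun n : ℕ => (1 / 2 : ℝ) ^ (n / 2)) atTop (𝓝 0) :=
      (tendsto_pow_atTop_nhds_zero_of_lt_one (by norm_num) (by norm_num)).comp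
        (Nat.tendsto_div_const_atTop two_ne_zero)
    have h2 := squeeze_zero (gaussProd_nonneg hx') (gaussProd_le hx') h1
    simpa using (h2.pow 2).const_mul 2
  have h1 := hd.comp hR
  have h2 : Tendsto (fun n => 16 * (1 - volume (A ∩ Metric.closedBall x (R n)) /
      volume (Metric.closedBall x (R n)))) atTop (𝓝 0) := by
    have := ENNReal.Tendsto.const_mul (a := 16) (ENNReal.Tendsto.sub
      (tendsto_const_nhds (x := (1 : ENNReal)) (f := atTop)) h1 (Or.inl ENNReal.one_ne_top))
      (Or.inr (by norm_num))
    simpa using this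
  refine tendsto_of_tendsto_of_tendsto_of_le_of_le tendsto_const_nhds h2
    (fun _ => zero_le) fun n => ?_
  have hβ := gaussProd_pos hirr hx.1 n
  set B := Metric.closedBall x (R n)
  have hB : volume B = ENNReal.ofReal (2 * R n) := Real.volume_closedBall _ _
  have hB0 : volume B ≠ 0 := by rw [hB]; simpa using hRpos n
  have hBt : volume B ≠ ⊤ := by rw [hB]; exact ENNReal.ofReal_ne_top
  have hsub : {y ∈ Set.Ioo (0 : ℝ) 1 | gaussBranch n x y ∉ A} ⊆
      {y ∈ Set.Ioo (0 : ℝ) 1 | gaussBranch n x y ∈ B \ A} := fun y hy =>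
    ⟨hy.1, by rw [Metric.mem_closedBall, Real.dist_eq]; exact abs_gaussBranch_sub_le hirr hx hy.1 n,
      hy.2⟩
  have hdiff : volume (B \ A) = volume B - volume (A ∩ B) := by
    rw [Set.inter_comm, ← measure_inter_add_sdiff₀ B hA, ENNReal.add_sub_cancel_left]
    exact measure_ne_top_of_subset Set.inter_subset_left hBt
  calc _ ≤ ENNReal.ofReal (4 / gaussProd x n ^ 2) * volume (B \ A) :=
        (measure_mono hsub).trans (volume_preimage_gaussBranch_le hirr hx n _)
    _ = ENNReal.ofReal (4 / gaussProd x n ^ 2) * (volume B * (1 - volume (A ∩ B) / volume B)) := by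
        rw [hdiff, ENNReal.mul_sub (fun _ _ => hBt), mul_one, ENNReal.mul_div_cancel hB0 hBt]
    _ = _ := by
        rw [← mul_assoc, hB, ← ENNReal.ofReal_mul (by positivity)]
        congr 1
        rw [show 4 / gaussProd x n ^ 2 * (2 * R n) = 16 by simp only [R]; field_simp; norm_num]
        norm_num

/-! ### Analytic rigidity: a value taken on a non-null set is taken almost everywhere. -/

/-- Otherwise coincidences are isolated, so the coincidence set is locally null and hence null. -/
lemma eqOn_of_analyticOnNhd_of_volume_ne_zero {f g : ℝ → ℂ}
    (hf : AnalyticOnNhd ℝ f (Set.Ioo 0 1)) (hg : AnalyticOnNhd ℝ g (Set.Ioo 0 1))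
    (h : volume {y ∈ Set.Ioo (0 : ℝ) 1 | f y = g y} ≠ 0) : Set.EqOn f g (Set.Ioo 0 1) := by
  by_contra hne
  refine h (measure_null_of_locally_null _ fun y hy => ?_)
  have h1 : ¬ ∃ᶠ z in 𝓝[≠] y, f z = g z := fun h2 =>
    hne (hf.eqOn_of_preconnected_of_frequently_eq hg isPreconnected_Ioo hy.1 h2)
  rw [not_frequently, eventually_nhdsWithin_iff] at h1
  refine ⟨_, inter_mem self_mem_nhdsWithin (mem_nhdsWithin_of_mem_nhds h1), ?_⟩
  refine measure_mono_null (t := {y}) (fun z hz => ?_) (measure_singleton y)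
  by_contra hzy
  exact hz.2 hzy hz.1.2

/-- If `F_s = φ` at `(a + y)⁻¹`, the value of `F_{-s}` at `y` that the reciprocity relation forces. -/
noncomputable def pullTarget (k : ℂ) (h : ℝ → ℂ) (s a : ℤ) (φ : ℝ → ℂ) (y : ℝ) : ℂ :=
  ((((a : ℝ) + y)⁻¹ : ℝ) : ℂ) ^ k * (φ ((a : ℝ) + y)⁻¹ - h (s * ((a : ℝ) + y)⁻¹))

/-- The iterate of `pullTarget` along the first `n` continued fraction digits of `x`. -/
noncomputable def pullTargetIter (k : ℂ) (h : ℝ → ℂ) : ℕ → ℤ → (ℝ → ℂ) → ℝ → ℝ → ℂ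
  | 0, _, φ, _ => φ
  | n + 1, s, φ, x => pullTargetIter k h n (-s) (pullTarget k h s ⌊x⁻¹⌋ φ) (gaussMap x)

lemma analyticAt_ofReal_cpow (k : ℂ) {t : ℝ} (ht : 0 < t) :
    AnalyticAt ℝ (fun u : ℝ => (u : ℂ) ^ k) t := by
  have h1 : AnalyticAt ℂ (fun w : ℂ => w ^ k) (t : ℂ) :=
    analyticAt_id.cpow analyticAt_const (Or.inl (by simpa using ht))
  exact (h1.restrictScalars (𝕜 := ℝ)).comp (Complex.ofRealCLM.analyticAt t)

section
variable {k : ℂ} {f : ℚ → ℂ} {h : ℝ → ℂ} {s : ℤ}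

lemma analyticOnNhd_pullTarget (han : AnalyticOnNhd ℝ h (Set.Ioo (-1 : ℝ) 1 \ {0}))
    (hs : s = 1 ∨ s = -1) {a : ℤ} (ha : 1 ≤ a) {φ : ℝ → ℂ}
    (hφ : AnalyticOnNhd ℝ φ (Set.Ioo 0 1)) :
    AnalyticOnNhd ℝ (pullTarget k h s a φ) (Set.Ioo 0 1) := by
  intro y hy
  have hmem := inv_add_mem_Ioo ha hy
  have ha' : (1 : ℝ) ≤ a := by exact_mod_cast ha
  have hinv : AnalyticAt ℝ (fun y : ℝ => ((a : ℝ) + y)⁻¹) y :=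
    (analyticAt_const.fun_add analyticAt_id).fun_inv
      (show 0 < (a : ℝ) + y by linarith [hy.1]).ne'
  have hsm : (s : ℝ) * ((a : ℝ) + y)⁻¹ ∈ Set.Ioo (-1 : ℝ) 1 \ {0} := by
    rcases hs with rfl | rfl
    · refine ⟨⟨by push_cast; linarith [hmem.1], by push_cast; linarith [hmem.2]⟩, ?_⟩
      simpa using (inv_pos.1 hmem.1).ne'
    · refine ⟨⟨by push_cast; linarith [hmem.2], by push_cast; linarith [hmem.1]⟩, ?_⟩
      simpa using (inv_pos.1 hmem.1).ne'
  refine AnalyticAt.mul ?_ (AnalyticAt.sub ?_ ?_)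
  · exact AnalyticAt.fun_comp (f := fun y : ℝ => ((a : ℝ) + y)⁻¹) (analyticAt_ofReal_cpow k hmem.1) hinv
  · exact AnalyticAt.fun_comp (f := fun y : ℝ => ((a : ℝ) + y)⁻¹) (hφ _ hmem) hinv
  · exact AnalyticAt.fun_comp (f := fun y : ℝ => s * ((a : ℝ) + y)⁻¹) (han _ hsm) (analyticAt_const.fun_mul hinv)

lemma analyticOnNhd_pullTargetIter (han : AnalyticOnNhd ℝ h (Set.Ioo (-1 : ℝ) 1 \ {0}))
    (hs : s = 1 ∨ s = -1) {φ : ℝ → ℂ} (hφ : AnalyticOnNhd ℝ φ (Set.Ioo 0 1)) {x : ℝ}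
    (hirr : Irrational x) (hx : x ∈ Set.Ioo (0 : ℝ) 1) (n : ℕ) :
    AnalyticOnNhd ℝ (pullTargetIter k h n s φ x) (Set.Ioo 0 1) := by
  induction n generalizing s φ x with
  | zero => exact hφ
  | succ n ih =>
    exact ih (by omega) (analyticOnNhd_pullTarget han hs (one_le_floor_inv hx.1 hx.2.le) hφ)
      (irrational_gaussMap hirr) (gaussMap_mem_Ioo hirr)

lemma gaussSeries_inv_add {a : ℤ} (ha : 1 ≤ a) {y : ℝ} (hy : y ∈ Set.Ioo (0 : ℝ) 1)
    (hsum : Summable (gaussTerm k (periodFamily f h (-s)) y)) :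
    HasSum (gaussTerm k (periodFamily f h s) ((a : ℝ) + y)⁻¹)
      (h (s * ((a : ℝ) + y)⁻¹) + ((((a : ℝ) + y)⁻¹ : ℝ) : ℂ) ^ (-k) *
        gaussSeries k (periodFamily f h (-s)) y) := by
  have hmem := inv_add_mem_Ioo ha hy
  have h1 := hsum.hasSum
  rw [← gaussMap_add_inv (a := a) hy.1.le hy.2] at h1
  have h2 := hasSum_gaussTerm_step (s := s) hmem.1.le h1
  rw [signedPeriod_of_pos _ _ _ hmem.1 hmem.2.le, gaussMap_add_inv hy.1.le hy.2] at h2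
  exact h2

lemma gaussSeries_inv_add_eq_iff {a : ℤ} (ha : 1 ≤ a) {y : ℝ} (hy : y ∈ Set.Ioo (0 : ℝ) 1)
    (hsum : Summable (gaussTerm k (periodFamily f h (-s)) y)) (φ : ℝ → ℂ) :
    gaussSeries k (periodFamily f h s) ((a : ℝ) + y)⁻¹ = φ ((a : ℝ) + y)⁻¹ ↔
      gaussSeries k (periodFamily f h (-s)) y = pullTarget k h s a φ y := by
  have hmem := inv_add_mem_Ioo ha hy
  have h1 : gaussSeries k (periodFamily f h s) ((a : ℝ) + y)⁻¹ = _ :=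
    (gaussSeries_inv_add ha hy hsum).tsum_eq
  rw [h1, pullTarget]
  set t : ℂ := ((((a : ℝ) + y)⁻¹ : ℝ) : ℂ)
  have ht : t ≠ 0 := Complex.ofReal_ne_zero.2 hmem.1.ne'
  have h2 : t ^ (-k) * t ^ k = 1 := by rw [← Complex.cpow_add _ _ ht]; simp
  constructor
  · intro h3
    rw [← h3]
    linear_combination -(gaussSeries k (periodFamily f h (-s)) y) * h2
  · intro h3
    rw [h3]
    linear_combination (φ ((a : ℝ) + y)⁻¹ - h (s * ((a : ℝ) + y)⁻¹)) * h2

lemma summable_gaussBranch {y : ℝ} (hy : y ∈ Set.Ioo (0 : ℝ) 1)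
    (hsum : ∀ s : ℤ, (s = 1 ∨ s = -1) → Summable (gaussTerm k (periodFamily f h s) y))
    {x : ℝ} (hirr : Irrational x) (hx : x ∈ Set.Ioo (0 : ℝ) 1) (n : ℕ) (hs : s = 1 ∨ s = -1) :
    Summable (gaussTerm k (periodFamily f h s) (gaussBranch n x y)) := by
  induction n generalizing x s with
  | zero => exact hsum s hs
  | succ n ih =>
    have hT := irrational_gaussMap hirr
    have hT' := gaussMap_mem_Ioo hirr
    exact (gaussSeries_inv_add (one_le_floor_inv hx.1 hx.2.le) (gaussBranch_mem hT hT' hy n)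
      (ih hT hT' (by omega))).summable

/-- Each step `F_s(t) = h(s t) + t^(-k) F_(-s)(y)`, with `t = (a + y)⁻¹`, is affine and invertible
in `F_(-s)(y)`. An equation for `F_s` on a cylinder thus becomes one on all of `(0, 1)`, with a new
target built from `h` and powers, which stays analytic. -/
lemma gaussSeries_gaussBranch_eq_iff {y : ℝ} (hy : y ∈ Set.Ioo (0 : ℝ) 1)
    (hsum : ∀ s : ℤ, (s = 1 ∨ s = -1) → Summable (gaussTerm k (periodFamily f h s) y))
    {x : ℝ} (hirr : Irrational x) (hx : x ∈ Set.Ioo (0 : ℝ) 1) (n : ℕ) (hs : s = 1 ∨ s = -1)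
    (φ : ℝ → ℂ) :
    gaussSeries k (periodFamily f h s) (gaussBranch n x y) = φ (gaussBranch n x y) ↔
      gaussSeries k (periodFamily f h ((-1) ^ n * s)) y = pullTargetIter k h n s φ x y := by
  induction n generalizing x s φ with
  | zero => simp [gaussBranch, pullTargetIter]
  | succ n ih =>
    have hT := irrational_gaussMap hirr
    have hT' := gaussMap_mem_Ioo hirr
    rw [pow_succ, mul_assoc, neg_one_mul, pullTargetIter, ← ih hT hT' (by omega), gaussBranch]
    exact gaussSeries_inv_add_eq_iff (one_le_floor_inv hx.1 hx.2.le) (gaussBranch_mem hT hT' hy n)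
      (summable_gaussBranch hy hsum hT hT' n (by omega)) φ

lemma ae_summable {θ C : ℝ} (hk : k.re < 0) (hθ0 : 0 < θ) (hθ1 : θ < 1)
    (hψ : ∀ s : ℤ, (s = 1 ∨ s = -1) → ModerateFamily θ C (periodFamily f h s)) :
    ∀ᵐ x ∂volume.restrict (Set.Ioo (0 : ℝ) 1), ∀ s : ℤ, (s = 1 ∨ s = -1) →
      Summable (gaussTerm k (periodFamily f h s) x) := by
  obtain ⟨hc, hκ⟩ := weight_constants hk hθ0 hθ1
  filter_upwards [ae_restrict_of_ae_restrict_of_subset Set.Ioo_subset_Icc_self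
    (ae_exists_tame hc hκ), ae_restrict_mem measurableSet_Ioo] with x ⟨m₁, ht⟩ hx s hs
  exact summable_gaussTerm hk hθ0 (hψ s hs) (Set.Ioo_subset_Icc_self hx) ht

lemma ae_gaussBranch_of_ae {P : ℝ → Prop} {x : ℝ} (hirr : Irrational x)
    (hx : x ∈ Set.Ioo (0 : ℝ) 1) (n : ℕ) (hP : ∀ᵐ w ∂volume.restrict (Set.Ioo (0 : ℝ) 1), P w) :
    ∀ᵐ y ∂volume.restrict (Set.Ioo (0 : ℝ) 1), P (gaussBranch n x y) := by
  rw [ae_restrict_iff' measurableSet_Ioo, ae_iff] at hP ⊢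
  refine measure_mono_null (t := {y ∈ Set.Ioo (0 : ℝ) 1 |
    gaussBranch n x y ∈ {w | ¬(w ∈ Set.Ioo (0 : ℝ) 1 → P w)}}) (fun y hy => ?_) ?_
  · obtain ⟨h1, h2⟩ := Classical.not_imp.1 hy
    exact ⟨h1, fun h3 => h2 (h3 (gaussBranch_mem hirr hx h1 n))⟩
  · refine le_antisymm ((volume_preimage_gaussBranch_le hirr hx n _).trans ?_) zero_le
    rw [hP, mul_zero]

/-- If the limit function takes the value `z` on a non-null set, then it is a.e. equal to `z`. -/
theorem ae_gaussSeries_eq_const {θ C : ℝ} (hk : k.re < 0) (hθ0 : 0 < θ) (hθ1 : θ < 1)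
    (hψ : ∀ s : ℤ, (s = 1 ∨ s = -1) → ModerateFamily θ C (periodFamily f h s))
    (han : AnalyticOnNhd ℝ h (Set.Ioo (-1 : ℝ) 1 \ {0})) {z : ℂ}
    (hz : volume {x ∈ Set.Icc (0 : ℝ) 1 | gaussSeries k (periodFamily f h 1) x = z} ≠ 0) :
    ∀ᵐ x ∂volume.restrict (Set.Ioo (0 : ℝ) 1), gaussSeries k (periodFamily f h 1) x = z := by
  set F := gaussSeries k (periodFamily f h 1)
  set A := {x ∈ Set.Icc (0 : ℝ) 1 | F x = z} with hAdef
  have hA : NullMeasurableSet A := by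
    have h1 := (aemeasurable_gaussSeries hk hθ0 hθ1 (hψ 1 (Or.inl rfl))).nullMeasurableSet_preimage
      (measurableSet_singleton z)
    have h2 := (nullMeasurableSet_restrict measurableSet_Icc.nullMeasurableSet).1 h1
    rwa [Set.inter_comm] at h2
  obtain ⟨x, hxA, hirr, hd⟩ : ∃ x ∈ A, Irrational x ∧
      Tendsto (fun r => volume (A ∩ Metric.closedBall x r) / volume (Metric.closedBall x r))
        (𝓝[>] 0) (𝓝 1) := by
    have h1 := Besicovitch.ae_tendsto_measure_inter_div volume A
    have h2 : ∃ᵐ x ∂volume.restrict A, True := by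
      rw [frequently_true_iff_neBot, ae_neBot, Ne, Measure.restrict_eq_zero]
      exact hz
    have h3 := h2.and_eventually (h1.and ((ae_restrict_of_ae ae_irrational).and (ae_restrict_mem₀ hA)))
    obtain ⟨x, -, a1, a2, a3⟩ := h3.exists
    exact ⟨x, a3, a2, a1⟩
  have hx : x ∈ Set.Ioo (0 : ℝ) 1 :=
    ⟨hxA.1.1.lt_of_ne hirr.ne_zero.symm, hxA.1.2.lt_of_ne hirr.ne_one⟩
  -- Only even depths are used: an even number of steps restores the sign, so that every `Ψ n` is
  -- compared with the same function `F`.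
  set Ψ := fun n : ℕ => pullTargetIter k h (2 * n) 1 (fun _ => z) x
  have hΨan : ∀ n, AnalyticOnNhd ℝ (Ψ n) (Set.Ioo 0 1) := fun n =>
    analyticOnNhd_pullTargetIter han (Or.inl rfl) analyticOnNhd_const hirr hx _
  have hsummable := ae_summable (f := f) hk hθ0 hθ1 hψ
  have hiff : ∀ n, ∀ᵐ y ∂volume.restrict (Set.Ioo (0 : ℝ) 1),
      (F (gaussBranch (2 * n) x y) = z ↔ F y = Ψ n y) := by
    intro n
    filter_upwards [hsummable, ae_restrict_mem measurableSet_Ioo] with y hy hy'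
    have := gaussSeries_gaussBranch_eq_iff hy' hy hirr hx (2 * n) (Or.inl rfl) fun _ => z
    rwa [pow_mul, neg_one_sq, one_pow, one_mul] at this
  have hmeas : ∀ n, volume {y ∈ Set.Ioo (0 : ℝ) 1 | F y ≠ Ψ n y} ≤
      volume {y ∈ Set.Ioo (0 : ℝ) 1 | gaussBranch (2 * n) x y ∉ A} := by
    intro n
    have h1 := hiff n
    rw [ae_restrict_iff' measurableSet_Ioo] at h1
    refine measure_mono_ae ?_
    filter_upwards [h1] with y hy hy2
    exact ⟨hy2.1, fun h2 => hy2.2 ((hy hy2.1).1 h2.2)⟩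
  have hlim : Tendsto (fun n => volume {y ∈ Set.Ioo (0 : ℝ) 1 | F y ≠ Ψ n y}) atTop (𝓝 0) := by
    have h1 := (tendsto_volume_gaussBranch_compl hA hirr hx hd).comp
      (tendsto_id.const_mul_atTop' two_pos : Tendsto (fun n : ℕ => 2 * n) atTop atTop)
    exact tendsto_of_tendsto_of_tendsto_of_le_of_le tendsto_const_nhds h1
      (fun _ => zero_le) hmeas
  -- Two exceptional sets of measure below `1/2` cannot cover `(0, 1)`, so any two later targets
  -- agree on a non-null set, hence everywhere.
  obtain ⟨N, hN⟩ := eventually_atTop.1 (hlim.eventually_lt_const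
    (u := ENNReal.ofReal (1 / 2)) (by simp))
  have heq : ∀ n, N ≤ n → Set.EqOn (Ψ n) (Ψ N) (Set.Ioo 0 1) := by
    intro n hn
    refine eqOn_of_analyticOnNhd_of_volume_ne_zero (hΨan n) (hΨan N) fun h0 => ?_
    have hsub : Set.Ioo (0 : ℝ) 1 ⊆ {y ∈ Set.Ioo (0 : ℝ) 1 | Ψ n y = Ψ N y} ∪
        ({y ∈ Set.Ioo (0 : ℝ) 1 | F y ≠ Ψ n y} ∪ {y ∈ Set.Ioo (0 : ℝ) 1 | F y ≠ Ψ N y}) := by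
      intro y hy
      by_cases h1 : F y = Ψ n y
      · by_cases h2 : F y = Ψ N y
        · exact Or.inl ⟨hy, h1.symm.trans h2⟩
        · exact Or.inr (Or.inr ⟨hy, h2⟩)
      · exact Or.inr (Or.inl ⟨hy, h1⟩)
    have h1 : volume (Set.Ioo (0 : ℝ) 1) < ENNReal.ofReal (1 / 2) + ENNReal.ofReal (1 / 2) := by
      refine (measure_mono hsub).trans_lt ((measure_union_le _ _).trans_lt ?_)
      rw [h0, zero_add]
      exact (measure_union_le _ _).trans_lt (ENNReal.add_lt_add (hN n hn) (hN N le_rfl))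
    rw [← ENNReal.ofReal_add (by norm_num) (by norm_num), Real.volume_Ioo] at h1
    norm_num at h1
  have hae : ∀ᵐ y ∂volume.restrict (Set.Ioo (0 : ℝ) 1), F y = Ψ N y := by
    rw [ae_restrict_iff' measurableSet_Ioo, ae_iff]
    have h1 : volume {y ∈ Set.Ioo (0 : ℝ) 1 | F y ≠ Ψ N y} = 0 := by
      refine le_antisymm (ge_of_tendsto hlim ?_) zero_le
      filter_upwards [eventually_ge_atTop N] with n hn
      exact measure_mono fun y hy => ⟨hy.1, by rw [heq n hn hy.1]; exact hy.2⟩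
    refine measure_mono_null (fun y hy => ?_) h1
    exact Classical.not_imp.1 hy
  -- If `Ψ N` were not `z` throughout, then `F ≠ z` almost everywhere, in particular on the cylinder
  -- of depth `2N`. But there `F = z` pulls back to `F = Ψ N`, which holds almost everywhere.
  have hconst : Set.EqOn (Ψ N) (fun _ => z) (Set.Ioo 0 1) := by
    refine eqOn_of_analyticOnNhd_of_volume_ne_zero (hΨan N) analyticOnNhd_const fun h0 => ?_
    have h1 : ∀ᵐ w ∂volume.restrict (Set.Ioo (0 : ℝ) 1), Ψ N w ≠ z := by
      rw [ae_restrict_iff' measurableSet_Ioo, ae_iff]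
      refine measure_mono_null (fun w hw => ?_) h0
      obtain ⟨a1, a2⟩ := Classical.not_imp.1 hw
      exact ⟨a1, not_not.1 a2⟩
    have h2 : ∀ᵐ y ∂volume.restrict (Set.Ioo (0 : ℝ) 1), False := by
      filter_upwards [ae_gaussBranch_of_ae hirr hx (2 * N) h1,
        ae_gaussBranch_of_ae hirr hx (2 * N) hae, hae, hiff N] with y a1 a2 a3 a4
      exact a1 (a2.symm.trans (a4.2 a3))
    rw [ae_iff] at h2
    simp at h2
  filter_upwards [hae, ae_restrict_mem measurableSet_Ioo] with y hy hy'
  rw [hy, hconst hy']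

end

/-! ### From an almost everywhere constant limit to the explicit form of `f`. -/

lemma ae_inv_add_of_ae {P : ℝ → Prop} {a : ℤ} (ha : 1 ≤ a)
    (hP : ∀ᵐ w ∂volume.restrict (Set.Ioo (0 : ℝ) 1), P w) :
    ∀ᵐ y ∂volume.restrict (Set.Ioo (0 : ℝ) 1), P ((a : ℝ) + y)⁻¹ := by
  -- Any irrational base point in `(0, 1)` serves: `y ↦ (a + y)⁻¹` is the depth-one branch at `(a +
  -- (√2 - 1))⁻¹`.
  have ht : Irrational (√2 - 1) := by simpa using irrational_sqrt_two.sub_intCast 1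
  have ht' : √2 - 1 ∈ Set.Ioo (0 : ℝ) 1 := by
    have h1 : (1 : ℝ) < √2 := by rw [Real.lt_sqrt zero_le_one]; norm_num
    have h2 : √2 < 2 := by rw [Real.sqrt_lt' two_pos]; norm_num
    exact ⟨by linarith, by linarith⟩
  have h := ae_gaussBranch_of_ae (x := ((a : ℝ) + (√2 - 1))⁻¹)
    (irrational_inv_iff.2 (ht.intCast_add a)) (inv_add_mem_Ioo ha ht') 1 hP
  simpa only [gaussBranch, inv_inv, Int.floor_intCast_add,
    Int.floor_eq_zero_iff.2 ⟨ht'.1.le, ht'.2⟩, add_zero] using h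

lemma inv_floor_add_gaussMap (x : ℝ) : ((⌊x⁻¹⌋ : ℝ) + gaussMap x)⁻¹ = x := by
  rw [gaussMap, Int.floor_add_fract, inv_inv]

/-- The preimage of a null set is, up to null sets, covered by its countably many images under the
differentiable maps `w ↦ (a + w)⁻¹`. -/
lemma ae_gaussMap_of_ae {P : ℝ → Prop}
    (hP : ∀ᵐ w ∂volume.restrict (Set.Ioo (0 : ℝ) 1), P w) :
    ∀ᵐ y ∂volume.restrict (Set.Ioo (0 : ℝ) 1), P (gaussMap y) := by
  rw [ae_restrict_iff' measurableSet_Ioo, ae_iff] at hP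
  set N := {w | ¬(w ∈ Set.Ioo (0 : ℝ) 1 → P w)}
  have hN : volume (⋃ a : ℤ, (fun w : ℝ => ((a : ℝ) + w)⁻¹) '' (N ∩ {w | (a : ℝ) + w ≠ 0})) = 0 := by
    refine measure_iUnion_null fun a => ?_
    refine addHaar_image_eq_zero_of_differentiableOn_of_addHaar_eq_zero volume ?_
      (measure_mono_null Set.inter_subset_left hP)
    intro w hw
    exact ((differentiableAt_id.const_add _).inv hw.2).differentiableWithinAt
  rw [ae_restrict_iff' measurableSet_Ioo]
  filter_upwards [compl_mem_ae_iff.2 hN, ae_irrational] with y hy hirr hmem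
  by_contra hP'
  have h1 := inv_floor_add_gaussMap y
  refine hy (Set.mem_iUnion.2 ⟨⌊y⁻¹⌋, gaussMap y, ⟨?_, ?_⟩, h1⟩)
  · exact Classical.not_imp.2 ⟨gaussMap_mem_Ioo hirr, hP'⟩
  · intro h2
    rw [h2, inv_zero] at h1
    exact hmem.1.ne h1

section
variable {k : ℂ} {f : ℚ → ℂ} {h : ℝ → ℂ}

lemma continuousOn_right_side {δ : ℝ} (hreg : PeriodRegular δ h) (z : ℂ) {n : ℤ} (hn : 1 ≤ n) :
    ContinuousOn (fun u : ℝ => ((((n : ℝ) + u)⁻¹ : ℝ) : ℂ) ^ k * (z - h ((n : ℝ) + u)⁻¹))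
      (Set.Icc 0 1) := by
  have hn' : (1 : ℝ) ≤ n := by exact_mod_cast hn
  have hinv : ContinuousOn (fun u : ℝ => ((n : ℝ) + u)⁻¹) (Set.Icc 0 1) :=
    (continuousOn_const.add continuousOn_id).inv₀ fun u hu => by
      have := hu.1; simp only [id, Pi.add_apply]; linarith
  have hpos : ∀ u ∈ Set.Icc (0 : ℝ) 1, 0 < ((n : ℝ) + u)⁻¹ := fun u hu =>
    inv_pos.2 (by linarith [hu.1])
  refine ContinuousOn.mul ?_ (continuousOn_const.sub ?_)
  · refine ContinuousOn.cpow (Complex.continuous_ofReal.comp_continuousOn hinv) continuousOn_const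
      fun u hu => Or.inl ?_
    rw [Complex.ofReal_re]
    exact hpos u hu
  · refine ContinuousOn.comp hreg.continuousOn hinv fun u hu => ⟨⟨?_, ?_⟩, (hpos u hu).ne'⟩
    · linarith [hpos u hu]
    · exact inv_le_one_of_one_le₀ (by linarith [hu.1])

lemma continuousOn_left_side {δ : ℝ} (hreg : PeriodRegular δ h) (z : ℂ) :
    ContinuousOn (fun u : ℝ => h (-u) + (u : ℂ) ^ (-k) * z) (Set.Ioc 0 1) := by
  refine ContinuousOn.add ?_ (ContinuousOn.mul ?_ continuousOn_const)
  · refine ContinuousOn.comp hreg.continuousOn continuousOn_neg fun u hu => ⟨⟨?_, ?_⟩, ?_⟩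
    · linarith [hu.2]
    · linarith [hu.1]
    · simpa using hu.1.ne'
  · exact ContinuousOn.cpow Complex.continuous_ofReal.continuousOn continuousOn_const
      fun u hu => Or.inl (by simpa using hu.1)

/-- The functional equation of `h` when the limit function is a.e. constant. -/
lemma period_eq_of_ae_const {δ θ C : ℝ} (hk : k.re < 0) (hθ0 : 0 < θ) (hθ1 : θ < 1)
    (hψ : ∀ s : ℤ, (s = 1 ∨ s = -1) → ModerateFamily θ C (periodFamily f h s))
    (hreg : PeriodRegular δ h) {z : ℂ}
    (hz : ∀ᵐ x ∂volume.restrict (Set.Ioo (0 : ℝ) 1), gaussSeries k (periodFamily f h 1) x = z)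
    {n : ℤ} (hn : 1 ≤ n) {u : ℝ} (hu : u ∈ Set.Ioo (0 : ℝ) 1) :
    h (-u) + (u : ℂ) ^ (-k) * z =
      ((((n : ℝ) + u)⁻¹ : ℝ) : ℂ) ^ k * (z - h ((n : ℝ) + u)⁻¹) := by
  have hae : (fun u : ℝ => h (-u) + (u : ℂ) ^ (-k) * z) =ᵐ[volume.restrict (Set.Ioo (0 : ℝ) 1)]
      fun u : ℝ => ((((n : ℝ) + u)⁻¹ : ℝ) : ℂ) ^ k * (z - h ((n : ℝ) + u)⁻¹) := by
    -- Two consecutive relations are combined: `F_1 = z` at `(n + x)⁻¹` expresses `F_(-1)(x)`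
    -- through `h`, and so does `F_1 = z` at `T x`. The open-set equality follows by continuity of
    -- both sides.
    have hsum := ae_summable (f := f) hk hθ0 hθ1 hψ
    filter_upwards [hsum, ae_gaussMap_of_ae hsum, ae_gaussMap_of_ae hz, ae_inv_add_of_ae hn hz,
      ae_restrict_mem measurableSet_Ioo, ae_restrict_of_ae ae_irrational]
      with x hs1 hs2 hz1 hz2 hx hirr
    have h1 := (gaussSeries_inv_add (s := 1) hn hx (hs1 (-1) (Or.inr rfl))).tsum_eq
    have h2 := (gaussSeries_inv_add (f := f) (h := h) (s := -1) (one_le_floor_inv hx.1 hx.2.le)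
      (gaussMap_mem_Ioo hirr) (hs2 (-(-1)) (Or.inl (neg_neg 1)))).tsum_eq
    rw [inv_floor_add_gaussMap, neg_neg, hz1] at h2
    change gaussSeries k (periodFamily f h 1) _ = _ at h1
    change gaussSeries k (periodFamily f h (-1)) x = _ at h2
    rw [hz2, h2] at h1
    simp only [Int.cast_one, one_mul, Int.cast_neg, neg_mul] at h1
    have ht : ((((n : ℝ) + x)⁻¹ : ℝ) : ℂ) ≠ 0 :=
      Complex.ofReal_ne_zero.2 (inv_add_mem_Ioo hn hx).1.ne'
    have h3 : ((((n : ℝ) + x)⁻¹ : ℝ) : ℂ) ^ (-k) * ((((n : ℝ) + x)⁻¹ : ℝ) : ℂ) ^ k = 1 := by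
      rw [← Complex.cpow_add _ _ ht]; simp
    linear_combination -((((n : ℝ) + x)⁻¹ : ℝ) : ℂ) ^ k * h1 - (h (-x) + (x : ℂ) ^ (-k) * z) * h3
  exact Measure.eqOn_open_of_ae_eq hae isOpen_Ioo
    ((continuousOn_left_side hreg z).mono Set.Ioo_subset_Ioc_self)
    ((continuousOn_right_side hreg z hn).mono Set.Ioo_subset_Icc_self) hu

/-- The left side of the functional equation need not extend to `u = 0`, so the boundary value is
reached through `u = 1` with digit `1`, that is, at `1/2`. The right sides for different digits
agree on `(0, 1)`, hence also at `u = 0`, which carries the value from `1/2` to `1/n`. -/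
lemma period_inv_eq {δ : ℝ} (hreg : PeriodRegular δ h) {z : ℂ}
    (heq : ∀ n : ℤ, 1 ≤ n → ∀ u ∈ Set.Ioo (0 : ℝ) 1, h (-u) + (u : ℂ) ^ (-k) * z =
      ((((n : ℝ) + u)⁻¹ : ℝ) : ℂ) ^ k * (z - h ((n : ℝ) + u)⁻¹)) {n : ℤ} (hn : 1 ≤ n) :
    h (-1) + z = ((((n : ℝ))⁻¹ : ℝ) : ℂ) ^ k * (z - h (n : ℝ)⁻¹) := by
  have hcl : Set.Icc (0 : ℝ) 1 ⊆ closure (Set.Ioo 0 1) := by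
    rw [closure_Ioo zero_ne_one]
  have h1 := Set.EqOn.of_subset_closure (s := Set.Ioo (0 : ℝ) 1) (t := Set.Ioc 0 1)
    (fun u hu => heq 1 le_rfl u hu) (continuousOn_left_side hreg z)
    ((continuousOn_right_side hreg z le_rfl).mono Set.Ioc_subset_Icc_self)
    Set.Ioo_subset_Ioc_self (Set.Ioc_subset_Icc_self.trans hcl)
  have h2 : ∀ m : ℤ, 1 ≤ m → Set.EqOn
      (fun u : ℝ => ((((m : ℝ) + u)⁻¹ : ℝ) : ℂ) ^ k * (z - h ((m : ℝ) + u)⁻¹))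
      (fun u : ℝ => ((((n : ℝ) + u)⁻¹ : ℝ) : ℂ) ^ k * (z - h ((n : ℝ) + u)⁻¹))
      (Set.Icc 0 1) := fun m hm =>
    Set.EqOn.of_subset_closure (s := Set.Ioo (0 : ℝ) 1)
      (fun u hu => (heq m hm u hu).symm.trans (heq n hn u hu))
      (continuousOn_right_side hreg z hm) (continuousOn_right_side hreg z hn)
      Set.Ioo_subset_Icc_self hcl
  have h3 := h1 (Set.right_mem_Ioc.2 zero_lt_one)
  have h4 := h2 2 (by norm_num) (Set.left_mem_Icc.2 zero_le_one)
  simp only [Complex.ofReal_one, Complex.one_cpow, one_mul, Int.cast_one] at h3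
  simp only [add_zero, Int.cast_ofNat] at h4
  rw [h3, show (1 : ℝ) + 1 = 2 by norm_num, h4]

lemma ofReal_cpow_neg_mul_cpow {a b : ℝ} (ha : 0 < a) (hb : 0 < b) :
    (a : ℂ) ^ (-k) * (b : ℂ) ^ k = ((b / a : ℝ) : ℂ) ^ k := by
  have ha' : (a : ℂ) ≠ 0 := Complex.ofReal_ne_zero.2 ha.ne'
  have h1 : (b : ℂ) ^ k = (a : ℂ) ^ k * ((b / a : ℝ) : ℂ) ^ k := by
    rw [← Complex.mul_cpow_ofReal_nonneg ha.le (by positivity), ← Complex.ofReal_mul,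
      mul_div_cancel₀ _ ha.ne']
  rw [h1, ← mul_assoc, ← Complex.cpow_add _ _ ha']
  simp

lemma den_fract_inv_div {r : ℚ} (hr : 0 < r) :
    ((Int.fract r⁻¹).den : ℝ) / (r : ℝ) = r.den := by
  have h1 : (Int.fract r⁻¹).den = r.num.natAbs := by
    rw [Rat.den_intFract, Rat.den_inv_of_ne_zero hr.ne']
  have h2 : ((r.num.natAbs : ℕ) : ℝ) = r.num := by
    rw [Nat.cast_natAbs, abs_of_pos (Rat.num_pos.2 hr)]
  have hr' : (0 : ℝ) < r := by exact_mod_cast hr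
  have h3 : (r : ℝ) * r.den = r.num := by exact_mod_cast Rat.mul_den_eq_num r
  rw [h1, h2, ← h3, mul_div_cancel_left₀ _ hr'.ne']

/-- Induction by two Gauss steps `r ↦ u ↦ v`, which return to the positive side. The functional
equation cancels both values of `h`, leaving `f r - z = r^(-k) u^(-k) (f v - z)`, with `f 1` for `f
v` if `v = 0`; denominators satisfy `den u = r · den r` and `den v = u · den u`, so the powers
telescope. For `r = 1/n` the boundary form `period_inv_eq` replaces the equation. -/
lemma eq_add_mul_den_cpow_of_le_one (hper : PeriodicOffZero f) (hrec : SatisfiesReciprocity k f h)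
    {δ : ℝ} (hreg : PeriodRegular δ h) {z : ℂ}
    (heq : ∀ n : ℤ, 1 ≤ n → ∀ u ∈ Set.Ioo (0 : ℝ) 1, h (-u) + (u : ℂ) ^ (-k) * z =
      ((((n : ℝ) + u)⁻¹ : ℝ) : ℂ) ^ k * (z - h ((n : ℝ) + u)⁻¹)) {r : ℚ} (h0 : 0 < r)
    (h1 : r ≤ 1) : f r = z + (f 1 - z) * (r.den : ℂ) ^ k := by
  induction hN : r.num.natAbs using Nat.strong_induction_on generalizing r with
  | _ N ih =>
    have hr : (0 : ℝ) < r := by exact_mod_cast h0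
    have hr0 : ((r : ℝ) : ℂ) ≠ 0 := Complex.ofReal_ne_zero.2 hr.ne'
    have hrr : ((r : ℝ) : ℂ) ^ (-k) * ((r : ℝ) : ℂ) ^ k = 1 := by
      rw [← Complex.cpow_add _ _ hr0]; simp
    set u := Int.fract r⁻¹ with hu
    have hn : 1 ≤ ⌊r⁻¹⌋ := by rw [Int.le_floor]; push_cast; exact (one_le_inv₀ h0).2 h1
    have hru : (r : ℝ) = ((⌊r⁻¹⌋ : ℝ) + (u : ℝ))⁻¹ := by
      have : r⁻¹ = ⌊r⁻¹⌋ + u := (Int.floor_add_fract _).symm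
      have h2 : ((r⁻¹ : ℚ) : ℝ) = ⌊r⁻¹⌋ + u := by exact_mod_cast this
      rw [← h2]; push_cast; rw [inv_inv]
    have hstep := reciprocity_step hper hrec (s := 1) (Or.inl rfl) h0 h1
    have hden := den_fract_inv_div h0
    rw [← hu] at hstep hden
    simp only [Int.cast_one, one_mul, Int.cast_neg, neg_mul] at hstep
    rcases (Int.fract_nonneg r⁻¹).eq_or_lt with hu0 | hu0
    · rw [← hu] at hu0
      rw [if_pos hu0.symm] at hstep
      rw [← hu0, Rat.cast_zero, add_zero] at hru
      have h2 := period_inv_eq hreg heq hn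
      rw [← hru] at h2
      have h3 := reciprocity_step hper hrec (s := -1) (Or.inr rfl) one_pos le_rfl
      simp only [inv_one, Int.fract_one, if_true, Int.cast_neg, Int.cast_one, mul_one,
        Rat.cast_one, Complex.ofReal_one, Complex.one_cpow, one_mul, neg_neg] at h3
      have h4 : ((r : ℝ) : ℂ) ^ (-k) = (r.den : ℂ) ^ k := by
        rw [← hu0, Rat.den_zero, Nat.cast_one] at hden
        have := ofReal_cpow_neg_mul_cpow (k := k) hr one_pos
        rw [hden] at this
        simpa using this
      rw [hstep, h3, ← h4]
      linear_combination ((r : ℝ) : ℂ) ^ (-k) * h2 + (z - h r) * hrr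
    · have hu1 : u < 1 := Int.fract_lt_one _
      rw [← hu] at hu0
      have hu' : (0 : ℝ) < u := by exact_mod_cast hu0
      rw [if_neg hu0.ne'] at hstep
      have h2 := heq _ hn (u : ℝ) ⟨hu', by exact_mod_cast hu1⟩
      rw [← hru] at h2
      have h3 := reciprocity_step hper hrec (s := -1) (Or.inr rfl) hu0 hu1.le
      simp only [Int.cast_neg, Int.cast_one, neg_mul, one_mul, neg_neg] at h3
      set v := Int.fract u⁻¹ with hv
      have hden' := den_fract_inv_div hu0
      rw [← hv] at hden'
      have hY : (if v = 0 then f 1 else f v) = z + (f 1 - z) * (v.den : ℂ) ^ k := by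
        split_ifs with hv0
        · rw [hv0]; simp
        · have hlt1 := Rat.fract_inv_num_lt_num_of_pos h0
          have hlt2 := Rat.fract_inv_num_lt_num_of_pos hu0
          rw [← hu] at hlt1
          rw [← hv] at hlt2
          have hv1 : 0 < v := (Int.fract_nonneg _).lt_of_ne' hv0
          have hvn : 0 < v.num := Rat.num_pos.2 hv1
          exact ih _ (by omega) hv1 (Int.fract_lt_one _).le rfl
      rw [hY] at h3
      have h5 : ((r : ℝ) : ℂ) ^ (-k) * (((u : ℝ) : ℂ) ^ (-k) * (v.den : ℂ) ^ k) =
          (r.den : ℂ) ^ k := by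
        have e1 := ofReal_cpow_neg_mul_cpow (k := k) hu' (b := v.den)
          (by exact_mod_cast v.den_pos)
        have e2 := ofReal_cpow_neg_mul_cpow (k := k) hr (b := u.den)
          (by exact_mod_cast u.den_pos)
        rw [hden'] at e1
        rw [hden] at e2
        simp only [Complex.ofReal_natCast] at e1 e2
        rw [e1, e2]
      rw [hstep, h3, ← h5]
      linear_combination ((r : ℝ) : ℂ) ^ (-k) * h2 + (z - h r) * hrr

lemma eq_add_mul_den_cpow (hper : PeriodicOffZero f) (hrec : SatisfiesReciprocity k f h)
    {δ : ℝ} (hreg : PeriodRegular δ h) {z : ℂ}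
    (heq : ∀ n : ℤ, 1 ≤ n → ∀ u ∈ Set.Ioo (0 : ℝ) 1, h (-u) + (u : ℂ) ^ (-k) * z =
      ((((n : ℝ) + u)⁻¹ : ℝ) : ℂ) ^ k * (z - h ((n : ℝ) + u)⁻¹)) {r : ℚ} (h0 : 0 < r) :
    f r = z + (f 1 - z) * (r.den : ℂ) ^ k := by
  -- The ceiling, not the floor, places the representative in `(0, 1]`: integers must reduce to `1`,
  -- since periodicity does not relate them to `0`.
  obtain ⟨n, hn⟩ : ∃ n : ℕ, ⌈r⌉ = n + 1 := ⟨(⌈r⌉ - 1).toNat, by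
    have : 0 < ⌈r⌉ := Int.ceil_pos.2 h0
    omega⟩
  have hn' : ((⌈r⌉ : ℤ) : ℚ) = n + 1 := by rw [hn]; push_cast; rfl
  have h1 : 0 < r - n := by have := Int.ceil_lt_add_one r; linarith
  have h2 : r - n ≤ 1 := by have := Int.le_ceil r; linarith
  have h3 := eq_add_mul_den_cpow_of_le_one hper hrec hreg heq h1 h2
  have h4 := hper.add_nat (s := 1) (Or.inl rfl) h1 n
  rw [Int.cast_one, one_mul, one_mul, sub_add_cancel] at h4
  rw [h4, h3, Rat.sub_natCast_den]

end

/-! ### The main theorem. -/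

theorem theorem3 (k : ℂ) (hk : k.re < 0) (δ : ℝ) (hδ : 0 < δ)
    (f : ℚ → ℂ) (h : ℝ → ℂ)
    (hper : PeriodicOffZero f) (hrec : SatisfiesReciprocity k f h) (hreg : PeriodRegular δ h) :
    (∀ᵐ x : ℝ, Tendsto (fun n : ℕ => f (x.convergent n)) atTop (𝓝 (starExt f x))) ∧
    AEMeasurable (starExt f) (volume.restrict (Set.Icc (0 : ℝ) 1)) ∧
    ReducedValuesEquidistribute f
      (Measure.map (starExt f) (volume.restrict (Set.Icc (0 : ℝ) 1))) ∧
    (AnalyticOnNhd ℝ h (Set.Ioo (-1 : ℝ) 1 \ {0}) →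
      (¬ ∃ α β : ℂ, ∀ x : ℚ, 0 < x → f x = α + β * (x.den : ℂ) ^ k) →
      ∀ z : ℂ, Measure.map (starExt f) (volume.restrict (Set.Icc (0 : ℝ) 1)) {z} = 0) := by
  obtain ⟨θ, C, hθ0, hθ1, hψ⟩ := exists_moderateFamily hδ f hreg
  set F := gaussSeries k (periodFamily f h 1)
  have hconv := ae_tendsto_convergent hk hper hrec hθ0 hθ1 hψ
  have hFm : AEMeasurable F (volume.restrict (Set.Icc (0 : ℝ) 1)) :=
    aemeasurable_gaussSeries hk hθ0 hθ1 (hψ 1 (Or.inl rfl))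
  have hae : starExt f =ᵐ[volume.restrict (Set.Icc (0 : ℝ) 1)] F := by
    filter_upwards [ae_restrict_of_ae hconv, ae_restrict_of_ae ae_irrational,
      ae_restrict_mem measurableSet_Icc] with x hx hirr hmem
    have h0 : 0 < x := hmem.1.lt_of_ne hirr.ne_zero.symm
    have h1 : x < 1 := hmem.2.lt_of_ne hirr.ne_one
    rw [if_pos h0, Int.fract_eq_self.2 ⟨h0.le, h1⟩] at hx
    exact hx.limUnder_eq
  have hstar := hFm.congr hae.symm
  refine ⟨?_, hstar, ?_, fun han hnot z => ?_⟩
  · filter_upwards [hconv] with x hx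
    rwa [starExt, hx.limUnder_eq]
  · rw [Measure.map_congr hae]
    exact equidistribute_gaussSeries hk hper hrec hθ0 hθ1 (hψ 1 (Or.inl rfl))
  · by_contra hz
    rw [Measure.map_congr hae, Measure.map_apply_of_aemeasurable hFm (measurableSet_singleton z),
      Measure.restrict_apply₀' measurableSet_Icc.nullMeasurableSet, Set.inter_comm] at hz
    have hc := ae_gaussSeries_eq_const hk hθ0 hθ1 hψ han (z := z) hz
    exact hnot ⟨z, f 1 - z, fun r hr => eq_add_mul_den_cpow hper hrec hreg
      (fun n hn u hu => period_eq_of_ae_const hk hθ0 hθ1 hψ hreg hc hn hu) hr⟩
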